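/- Let $\mathcal X\subset\mathbb R$ be a finite alphabet with $M$ elements, let $\sigma_A,\sigma_E\ge 0$, $0<\sigma_B<1$ and $0<\alpha_1<\alpha_2$. Let $\{A_i\},\{B_i\},\{E_i\},\{W_i\},\{U_i\}$ be mutually independent i.i.d. processes, the first four centred Gaussian with variances $\sigma_A^2,\sigma_B^2,\sigma_E^2,1$, the last uniform on $(\alpha_1,\alpha_2)$. For an input process $\{X_i\}_{i\ge 0}$ with values in $\mathcal X$, such that the six processes are mutually independent, the channel output is $$Y_0=X_0+W_0+U_0,\qquad Y_n=X_n+A_nX_{n-1}+B_n(Y_{n-1}-E_{n-1})+W_n+U_n\quad(n\ge 1).$$ Write $Z_m^n=(Z_m,\dots,Z_n)$, let $I$ denote mutual information in nats and $\log$ the natural logarithm. All mutual informations below are finite. (a) Let $X_{n+1}^{2n+1}$ be an independent copy of $X_0^n$. Then for every $k\le n$, every $x\in\mathcal X$ and every $y\in\mathbb R$, $$\bigl|I(X_0^n;Y_0^n)-I(X_{n+1}^{2n+1};Y_{n+1}^{2n+1}\mid X_n=x,Y_n=y)\bigr|\le 2(k+1)\log M+(n-k)\bigl(\sigma_A^2x^2+2\sigma_B^2(y^2+\sigma_E^2)\bigr)\sigma_B^{2k}\log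 M .$$ Here the conditional mutual information is that of the law of $(X_{n+1}^{2n+1},Y_{n+1}^{2n+1})$ in which the outputs are generated by the channel recursion from the state $(x,y)$ at time $n$; this law is a regular conditional distribution of $(X_{n+1}^{2n+1},Y_{n+1}^{2n+1})$ given $(X_n,Y_n)$. (b) Put $M_0=\max\{|\alpha_1|,|\alpha_2|,|v|:v\in\mathcal X\}$ and $M_1=2M_0+M_0(3\sigma_A^4)^{1/4}+3^{1/4}+(3\sigma_B^4)^{1/4}(3\sigma_E^4)^{1/4}$. There is a constant $M_3>0$ with ${\bf E}[Y_n^2\mid X_0^n=x_0^n]\le M_3$ for all $n$ and all $x_0^n\in\mathcal X^{n+1}$ (the left side being the second moment of the output for the deterministic input $x_0^n$). For every such $M_3$ there are positive constants $M_4,\dots,M_9$, not depending on the input process, such that for every stationary input process $\{X_n\}$ and all $m\le k\le n$, $$\begin{aligned}\Bigl|\tfrac1{n+1}I(X_0^n;Y_0^n)-\tfrac1{n+1}I(X_m^{m+n};Y_m^{m+n})\Bigr|\le{}&\frac{3(k+1)\log(2\pi eM_3)}{n+1}+2M_3\pi e(M_8+3M_9)\sigma_B^{2k}+\frac{M_4+M_5M_3}{n+1}\\&+\Bigl(M_6+\frac{4M_1M_3M_7}{(1-\sigma_B)^2}+\frac{12M_3M_7}{(n+1)(1-\sigma_B^2)}\Bigr)\sigma_B^{2k}.\end{aligned}$$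 -/

import Mathlib

open MeasureTheory ProbabilityTheory
open scoped ENNReal

noncomputable section

namespace FlashChannel

/-- The five noise processes of the channel, indexed by time. -/
structure Noise (Ω : Type*) where
  A : ℕ → Ω → ℝ
  B : ℕ → Ω → ℝ
  E : ℕ → Ω → ℝ
  W : ℕ → Ω → ℝ
  U : ℕ → Ω → ℝ

variable {Ω : Type*}

/-- The channel output `Y` for the input process `X`:
`Y 0 = X 0 + W 0 + U 0` and, for `n ≥ 1`,
`Y n = X n + A n * X (n-1) + B n * (Y (n-1) - E (n-1)) + W n + U n`. -/
def Noise.output (N : Noise Ω) (X : ℕ → Ω → ℝ) : ℕ → Ω → ℝ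
  | 0 => fun ω => X 0 ω + N.W 0 ω + N.U 0 ω
  | n + 1 => fun ω => X (n + 1) ω + N.A (n + 1) ω * X n ω
      + N.B (n + 1) ω * (N.output X n ω - N.E n ω) + N.W (n + 1) ω + N.U (n + 1) ω

/-- The same recursion, run from the state (input `x`, output `y`) at time `t`;
the value at `j` is the output at time `t + j`, so that the value at `0` is `y`. -/
def Noise.outputFrom (N : Noise Ω) (X : ℕ → Ω → ℝ) (t : ℕ) (x y : ℝ) : ℕ → Ω → ℝ
  | 0 => fun _ => y
  | j + 1 => fun ω => X (t + j + 1) ω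
      + N.A (t + j + 1) ω * (if j = 0 then x else X (t + j) ω)
      + N.B (t + j + 1) ω * (N.outputFrom X t x y j ω - N.E (t + j) ω)
      + N.W (t + j + 1) ω + N.U (t + j + 1) ω

/-- The block `Z_m, …, Z_{m+n}` of a process, as a random vector. -/
def block (Z : ℕ → Ω → ℝ) (m n : ℕ) (ω : Ω) : Fin (n + 1) → ℝ := fun i => Z (m + i) ω

/-- The five processes are mutually independent and each is i.i.d.; `A`, `B`, `E`, `W` are centred
Gaussian with variances `σA ^ 2`, `σB ^ 2`, `σE ^ 2`, `1`, and `U` is uniform on `(α₁, α₂)`. -/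
structure Noise.IsChannelNoise [MeasurableSpace Ω] (N : Noise Ω) (P : Measure Ω)
    (σA σB σE α₁ α₂ : ℝ) : Prop where
  measurable_A : ∀ i, Measurable (N.A i)
  measurable_B : ∀ i, Measurable (N.B i)
  measurable_E : ∀ i, Measurable (N.E i)
  measurable_W : ∀ i, Measurable (N.W i)
  measurable_U : ∀ i, Measurable (N.U i)
  law_A : ∀ i, P.map (N.A i) = gaussianReal 0 (σA ^ 2).toNNReal
  law_B : ∀ i, P.map (N.B i) = gaussianReal 0 (σB ^ 2).toNNReal
  law_E : ∀ i, P.map (N.E i) = gaussianReal 0 (σE ^ 2).toNNReal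
  law_W : ∀ i, P.map (N.W i) = gaussianReal 0 1
  law_U : ∀ i, pdf.IsUniform (N.U i) (Set.Ioo α₁ α₂) P volume
  indep_A : iIndepFun N.A P
  indep_B : iIndepFun N.B P
  indep_E : iIndepFun N.E P
  indep_W : iIndepFun N.W P
  indep_U : iIndepFun N.U P
  indep : iIndepFun (fun (j : Fin 5) (ω : Ω) (i : ℕ) => ![N.A, N.B, N.E, N.W, N.U] j i ω) P

/-- `X` is an input process over the finite alphabet `𝒳`, independent of the noise: the six
processes are mutually independent. -/
structure Noise.IsInput [MeasurableSpace Ω] (N : Noise Ω) (P : Measure Ω) (𝒳 : Finset ℝ)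
    (X : ℕ → Ω → ℝ) : Prop where
  measurable : ∀ i, Measurable (X i)
  mem : ∀ i ω, X i ω ∈ 𝒳
  indep : iIndepFun
    (fun (j : Fin 6) (ω : Ω) (i : ℕ) => ![N.A, N.B, N.E, N.W, N.U, X] j i ω) P

/-- Stationarity of a process: the law of a block does not depend on where it starts. -/
def IsStationary [MeasurableSpace Ω] (P : Measure Ω) (X : ℕ → Ω → ℝ) : Prop :=
  ∀ m n, P.map (block X m n) = P.map (block X 0 n)

/-- Mutual information (in nats) of the two coordinates under a joint law: the relative entropy of
the joint law with respect to the product of its marginals. -/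
def mutualInfo {α β : Type*} [MeasurableSpace α] [MeasurableSpace β] (μ : Measure (α × β)) : ℝ≥0∞ :=
  InformationTheory.klDiv μ (μ.fst.prod μ.snd)

/-- `I(X_m^{m+n}; Y_m^{m+n})`, where `Y` is the output for the input `X`. -/
def Noise.blockInfo [MeasurableSpace Ω] (N : Noise Ω) (P : Measure Ω) (X : ℕ → Ω → ℝ)
    (m n : ℕ) : ℝ≥0∞ :=
  mutualInfo (P.map fun ω => (block X m n ω, block (N.output X) m n ω))

/-- The law of `(X_{n+1}^{2n+1}, Y_{n+1}^{2n+1})` given `X_n = x`, `Y_n = y`, when `X_{n+1}^{2n+1}`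
is independent of `X_0^n`: the outputs are generated by the channel from the state `(x, y)`. -/
def Noise.condLaw [MeasurableSpace Ω] (N : Noise Ω) (P : Measure Ω) (X : ℕ → Ω → ℝ)
    (n : ℕ) (x y : ℝ) : Measure ((Fin (n + 1) → ℝ) × (Fin (n + 1) → ℝ)) :=
  P.map fun ω => (block X (n + 1) n ω, block (N.outputFrom X n x y) 1 n ω)

/-- `E[Y_n² | X_0^n = x_0^n] ≤ M₃` for all `n` and all input words `x_0^n` over the alphabet. As the
input is independent of the noise, the left side is the second moment of the output for the
deterministic input `x`. -/
def Noise.PowerBound [MeasurableSpace Ω] (N : Noise Ω) (P : Measure Ω) (𝒳 : Finset ℝ)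
    (M₃ : ℝ) : Prop :=
  ∀ x : ℕ → ℝ, (∀ i, x i ∈ 𝒳) → ∀ n,
    ∫⁻ ω, ENNReal.ofReal (N.output (fun i _ => x i) n ω ^ 2) ∂P ≤ ENNReal.ofReal M₃

/-- `M₀ = max {|α₁|, |α₂|, |v| : v ∈ 𝒳}`. -/
def constM₀ (𝒳 : Finset ℝ) (α₁ α₂ : ℝ) : ℝ :=
  (insert |α₁| (insert |α₂| (𝒳.image fun v => |v|))).max' (Finset.insert_nonempty _ _)

/-- `M₁ = 2 M₀ + M₀ (3 σA⁴)^{1/4} + 3^{1/4} + (3 σB⁴)^{1/4} (3 σE⁴)^{1/4}`. -/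
def constM₁ (𝒳 : Finset ℝ) (α₁ α₂ σA σB σE : ℝ) : ℝ :=
  2 * constM₀ 𝒳 α₁ α₂ + constM₀ 𝒳 α₁ α₂ * (3 * σA ^ 4) ^ (1 / 4 : ℝ) + (3 : ℝ) ^ (1 / 4 : ℝ)
    + (3 * σB ^ 4) ^ (1 / 4 : ℝ) * (3 * σE ^ 4) ^ (1 / 4 : ℝ)

end FlashChannel

end

/-! Mutual information is written as H(word) − H(word | outputs). The two blocks being compared have
input words of the same law, so H(word) cancels and only the two conditional entropies have to be
compared. For a fixed input word the outputs form a Markov chain with transition densities, all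
bounded by the maximum of the Gaussian density because of the noise W. Hence H(word | outputs) is
the integral of a homogeneous entropy, `homEntropy`, of the vector of joint densities indexed by
words; this is `chainEntropy`, and `mutualInfo_mixedLaw` is the identity that links it to the
information. For a given word the two blocks differ in the density of their first output only.

The analytic core is that the channel forgets its state at the rate σB^2 per step
(`lintegral_evolve_sub_le`). Compared with a fresh start, the state (x, y) adds ξ = A x + B (y − E)
to the first output. After k more steps the output is C + D ξ + W, where D is a product of k
independent copies of B. The law of ξ is symmetric, since A and B may change sign together, so the
first-order effect of ξ on the Gaussian density cancels. What remains is E[D²] E[ξ²], of order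
σB^(2k), in total variation.

Part (a). The initial densities depend on the first letter only. By the chain rule, the entropy of
the first k + 1 letters is split off, at a cost of at most (k + 1) log M. Once these letters are
fixed, the first k transitions no longer depend on the word, so by homogeneity the first k outputs
can be integrated out without loss. What is left are two chains whose initial densities are
σB^(2k)-close and whose index takes at most M^(n−k) values (`chainEntropy_prefix_le`,
`chainEntropy_words_le`). The regular conditional distribution comes from expanding both sides of a
disintegration over input words (`Noise.IsInput.map_eq_compProd`).

Part (b). Here the input may be dependent across blocks, so the density of the first output of the
block depends on the whole word and the splitting above is not available. Instead the first k
outputs are discarded at a price. Each carries at most log M₃ + 1 nats about the word given the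
later ones: its differential entropy is controlled from above by the second moment and from below by
the bounded densities (`chainEntropy_step_le`). After that the two families of densities are
σB^(2k)-close by the same contraction averaged over the state just before the block, and continuity
of entropy (`chainEntropy_le_add`) costs this distance times log of M^(n+1), plus log 2. Dividing by
n + 1 gives the claim. -/

noncomputable section

open scoped NNReal

namespace FlashChannel

/-! ### Entropy of unnormalised nonnegative vectors -/

open Real in
/-- The homogeneous extension of the Shannon entropy to nonnegative vectors. -/
def homEntropy {ι : Type*} [Fintype ι] (a : ι → ℝ) : ℝ :=
  ∑ i, negMulLog (a i) - negMulLog (∑ i, a i)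

section HomEntropy

variable {ι : Type*} [Fintype ι] {a b : ι → ℝ}

open Real Finset

/-- The tangent inequality log t ≤ t − 1 at t = y / x, multiplied by x. The last hypothesis is
needed because log 0 = 0 by convention. -/
lemma negMulLog_add_mul_log_le {x y : ℝ} (hx : 0 ≤ x) (hy : 0 ≤ y) (h : y = 0 → x = 0) :
    negMulLog x + x * log y ≤ y - x := by
  rcases hy.eq_or_lt with rfl | hy
  · simp [h rfl]
  rcases hx.eq_or_lt with rfl | hx
  · simpa using hy.le
  have h1 := log_le_sub_one_of_pos (div_pos hy hx)
  rw [log_div hy.ne' hx.ne'] at h1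
  have h2 := mul_le_mul_of_nonneg_left h1 hx.le
  have h3 : x * (y / x - 1) = y - x := by field_simp
  rw [negMulLog]
  linarith

lemma homEntropy_eq_sum (a : ι → ℝ) :
    homEntropy a = ∑ i, a i * (log (∑ j, a j) - log (a i)) := by
  simp only [homEntropy, negMulLog, mul_sub, Finset.sum_sub_distrib, ← Finset.sum_mul]
  simp only [neg_mul, Finset.sum_neg_distrib]
  ring

lemma homEntropy_nonneg (ha : ∀ i, 0 ≤ a i) : 0 ≤ homEntropy a := by
  rw [homEntropy_eq_sum]
  refine sum_nonneg fun i _ => ?_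
  rcases (ha i).eq_or_lt with h | h
  · simp [← h]
  · exact mul_nonneg h.le (sub_nonneg.2 (log_le_log h
      (single_le_sum (f := a) (fun j _ => ha j) (mem_univ i))))

/-- The term for the total mass absorbs the logarithm of c. This homogeneity makes joint densities
usable without normalisation: a factor that does not depend on the index comes out of the entropy.
-/
lemma homEntropy_mul (c : ℝ) (a : ι → ℝ) :
    homEntropy (fun i => c * a i) = c * homEntropy a := by
  simp only [homEntropy, ← mul_sum, negMulLog_mul, sum_add_distrib, ← sum_mul]
  ring

/-- Gibbs' inequality. -/
lemma homEntropy_le_sum (ha : ∀ i, 0 ≤ a i) (hb : ∀ i, 0 ≤ b i) (h : ∀ i, b i = 0 → a i = 0) :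
    homEntropy a ≤ ∑ i, a i * (log (∑ j, b j) - log (b i)) := by
  have hA : 0 ≤ ∑ i, a i := sum_nonneg fun i _ => ha i
  have hB : 0 ≤ ∑ i, b i := sum_nonneg fun i _ => hb i
  rcases hB.eq_or_lt with hB0 | hB
  · have hb0 : ∀ i, b i = 0 := fun i =>
      (sum_eq_zero_iff_of_nonneg fun i _ => hb i).1 hB0.symm i (mem_univ i)
    have ha0 : a = 0 := funext fun i => h i (hb0 i)
    simp [ha0, homEntropy]
  -- The reference vector b is rescaled to the mass of a, so that the linear remainders of the
  -- tangent inequality sum to zero.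
  have key : ∀ i, negMulLog (a i) + a i * (log (∑ j, a j) + log (b i) - log (∑ j, b j))
      ≤ (∑ j, a j) * b i / (∑ j, b j) - a i := by
    intro i
    rcases hA.eq_or_lt with hA0 | hA
    · have : a i = 0 := (sum_eq_zero_iff_of_nonneg fun i _ => ha i).1 hA0.symm i (mem_univ i)
      simp [this, ← hA0]
    rcases (hb i).eq_or_lt with hbi | hbi
    · simp [h i hbi.symm, ← hbi]
    have := negMulLog_add_mul_log_le (ha i) (y := (∑ j, a j) * b i / (∑ j, b j)) (by positivity)
      (fun h0 => absurd h0 (by positivity))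
    rwa [log_div (by positivity) hB.ne', log_mul hA.ne' hbi.ne'] at this
  have hs := sum_le_sum fun i (_ : i ∈ univ) => key i
  rw [sum_sub_distrib, ← sum_div, ← mul_sum, mul_div_assoc, div_self hB.ne', mul_one, sub_self,
    sum_add_distrib] at hs
  have e : ∑ i, a i * (log (∑ j, a j) + log (b i) - log (∑ j, b j))
      = (∑ j, a j) * log (∑ j, a j) - ∑ i, a i * (log (∑ j, b j) - log (b i)) := by
    rw [sum_mul, ← sum_sub_distrib]
    exact sum_congr rfl fun i _ => by ring
  rw [e] at hs
  rw [homEntropy, negMulLog]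
  linarith

/-- Gibbs' inequality with reference b gives the weights log (∑ b) − log b i. These are nonnegative,
so each a i in front of them may be enlarged to b i. -/
lemma homEntropy_mono (ha : ∀ i, 0 ≤ a i) (hab : ∀ i, a i ≤ b i) :
    homEntropy a ≤ homEntropy b := by
  have hb : ∀ i, 0 ≤ b i := fun i => (ha i).trans (hab i)
  refine (homEntropy_le_sum ha hb fun i hi => le_antisymm (hi ▸ hab i) (ha i)).trans ?_
  rw [homEntropy_eq_sum]
  refine sum_le_sum fun i _ => ?_
  rcases (hb i).eq_or_lt with h | h
  · simp [← h, le_antisymm (h ▸ hab i) (ha i)]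
  · exact mul_le_mul_of_nonneg_right (hab i) (sub_nonneg.2 (log_le_log h
      (single_le_sum (f := b) (fun j _ => hb j) (mem_univ i))))

/-- Gibbs' inequality against the uniform vector. -/
lemma homEntropy_le_mul_log_card (ha : ∀ i, 0 ≤ a i) :
    homEntropy a ≤ (∑ i, a i) * log (Fintype.card ι) := by
  refine (homEntropy_le_sum ha (b := fun _ => 1) (by simp) (by simp)).trans ?_
  simp [sum_mul]

lemma mul_log_add_le {x y : ℝ} (hx : 0 ≤ x) (hy : 0 ≤ y) :
    x * (log (x + y) - log x) + y * (log (x + y) - log y) ≤ (x + y) * log 2 := by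
  have := homEntropy_le_mul_log_card (a := ![x, y]) (by intro i; fin_cases i <;> simpa)
  rw [homEntropy_eq_sum] at this
  simpa [Fin.sum_univ_two] using this

/-- A mixture has at most the entropies of its parts plus the entropy of the bit that tells the
parts apart, which is at most log 2 per unit of mass. -/
lemma homEntropy_add_le (ha : ∀ i, 0 ≤ a i) (hb : ∀ i, 0 ≤ b i) :
    homEntropy (fun i => a i + b i)
      ≤ homEntropy a + homEntropy b + (∑ i, (a i + b i)) * log 2 := by
  have hA : 0 ≤ ∑ i, a i := sum_nonneg fun i _ => ha i
  have hB : 0 ≤ ∑ i, b i := sum_nonneg fun i _ => hb i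
  have key : ∀ {x y : ℝ}, 0 ≤ x → 0 ≤ y → x * log x ≤ x * log (x + y) := by
    intro x y hx hy
    rcases hx.eq_or_lt with rfl | hx
    · simp
    · exact mul_le_mul_of_nonneg_left (log_le_log hx (by linarith)) hx.le
  have h2 := mul_log_add_le hA hB
  have h3 : ∑ i, a i * log (a i) + ∑ i, b i * log (b i)
      ≤ ∑ i, (a i + b i) * log (a i + b i) := by
    rw [← sum_add_distrib]
    refine sum_le_sum fun i _ => ?_
    have e1 := key (ha i) (hb i)
    have e2 := key (hb i) (ha i)
    rw [add_comm (b i)] at e2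
    linarith [add_mul (a i) (b i) (log (a i + b i))]
  simp only [homEntropy, negMulLog, sum_add_distrib, neg_mul, sum_neg_distrib] at *
  linarith [add_mul (∑ i, a i) (∑ i, b i) (log (∑ i, a i + ∑ i, b i))]

/-- Continuity of the entropy under a one-sided perturbation. -/
lemma homEntropy_le_add (ha : ∀ i, 0 ≤ a i) (hb : ∀ i, 0 ≤ b i) :
    homEntropy a ≤ homEntropy b + (∑ i, max (a i - b i) 0) * log (Fintype.card ι)
      + (∑ i, a i) * log 2 := by
  -- The first part of this splitting is dominated by b and the second is the excess of a over b,
  -- which is small in the application.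
  have e : a = fun i => min (a i) (b i) + max (a i - b i) 0 := by
    funext i
    rcases le_total (a i) (b i) with h | h <;> simp [h]
  have h1 := homEntropy_add_le (a := fun i => min (a i) (b i)) (b := fun i => max (a i - b i) 0)
    (fun i => le_min (ha i) (hb i)) (fun i => le_max_right _ _)
  have h2 := homEntropy_mono (a := fun i => min (a i) (b i)) (b := b)
    (fun i => le_min (ha i) (hb i)) fun i => min_le_right _ _
  have h3 := homEntropy_le_mul_log_card (a := fun i => max (a i - b i) 0) fun i => le_max_right _ _
  rw [← e] at h1
  linarith

/-- The chain rule for the entropy. -/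
lemma homEntropy_chain {υ : Type*} [Fintype υ] [DecidableEq υ] (p : ι → υ) (a : ι → ℝ) :
    homEntropy a = homEntropy (fun u => ∑ i : {i // p i = u}, a i)
      + ∑ u, homEntropy fun i : {i // p i = u} => a i := by
  have key : ∀ f : ι → ℝ, ∑ u, ∑ i : {i // p i = u}, f i = ∑ i, f i := fun f => by
    rw [← (Equiv.sigmaFiberEquiv p).sum_comp, Fintype.sum_sigma]
    rfl
  simp only [homEntropy, sum_sub_distrib, key, key (fun i => negMulLog (a i))]
  ring

end HomEntropy

/-- `homEntropy` for vectors of extended nonnegative reals. -/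
def eEntropy {ι : Type*} [Fintype ι] (f : ι → ℝ≥0∞) : ℝ≥0∞ :=
  ENNReal.ofReal (homEntropy fun i => (f i).toReal)

section EEntropy

variable {ι : Type*} [Fintype ι] {f g : ι → ℝ≥0∞}

lemma ofReal_sum_toReal (hf : ∀ i, f i ≠ ∞) : ENNReal.ofReal (∑ i, (f i).toReal) = ∑ i, f i := by
  rw [← ENNReal.toReal_sum fun i _ => hf i, ENNReal.ofReal_toReal (ENNReal.sum_ne_top.2 fun i _ => hf i)]

lemma measurable_eEntropy {β : Type*} [MeasurableSpace β] {f : ι → β → ℝ≥0∞}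
    (hf : ∀ i, Measurable (f i)) : Measurable fun y => eEntropy fun i => f i y := by
  unfold eEntropy homEntropy
  have h1 : Measurable Real.negMulLog := Real.continuous_negMulLog.measurable
  have h2 : ∀ i, Measurable fun y => (f i y).toReal := fun i => (hf i).ennreal_toReal
  fun_prop

lemma eEntropy_mul {c : ℝ≥0∞} (hc : c ≠ ∞) (f : ι → ℝ≥0∞) :
    eEntropy (fun i => c * f i) = c * eEntropy f := by
  simp only [eEntropy, ENNReal.toReal_mul, homEntropy_mul]
  rw [ENNReal.ofReal_mul ENNReal.toReal_nonneg, ENNReal.ofReal_toReal hc]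

lemma eEntropy_le (hf : ∀ i, f i ≠ ∞) :
    eEntropy f ≤ (∑ i, f i) * ENNReal.ofReal (Real.log (Fintype.card ι)) := by
  rw [← ofReal_sum_toReal hf, ← ENNReal.ofReal_mul (Finset.sum_nonneg fun i _ => ENNReal.toReal_nonneg)]
  exact ENNReal.ofReal_le_ofReal (homEntropy_le_mul_log_card fun i => ENNReal.toReal_nonneg)

lemma eEntropy_le_add (hf : ∀ i, f i ≠ ∞) (hg : ∀ i, g i ≠ ∞) :
    eEntropy f ≤ eEntropy g + (∑ i, (f i - g i)) * ENNReal.ofReal (Real.log (Fintype.card ι))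
      + (∑ i, f i) * ENNReal.ofReal (Real.log 2) := by
  have h1 : ∀ i, f i - g i ≠ ∞ := fun i => ENNReal.sub_ne_top (hf i)
  have h2 : ∀ i, (f i - g i).toReal = max ((f i).toReal - (g i).toReal) 0 := fun i => by
    rcases le_total (g i) (f i) with h | h
    · rw [ENNReal.toReal_sub_of_le h (hf i), max_eq_left
        (sub_nonneg.2 (ENNReal.toReal_mono (hf i) h))]
    · rw [tsub_eq_zero_of_le h, max_eq_right (sub_nonpos.2 (ENNReal.toReal_mono (hg i) h))]
      rfl
  rw [← ofReal_sum_toReal hf, ← ofReal_sum_toReal h1,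
    ← ENNReal.ofReal_mul (Finset.sum_nonneg fun i _ => ENNReal.toReal_nonneg),
    ← ENNReal.ofReal_mul (Finset.sum_nonneg fun i _ => ENNReal.toReal_nonneg)]
  have h3 := homEntropy_le_add (a := fun i => (f i).toReal) (b := fun i => (g i).toReal)
    (fun i => ENNReal.toReal_nonneg) (fun i => ENNReal.toReal_nonneg)
  simp only [h2]
  refine (ENNReal.ofReal_le_ofReal h3).trans (ENNReal.ofReal_add_le.trans ?_)
  gcongr
  exact ENNReal.ofReal_add_le

lemma eEntropy_chain {υ : Type*} [Fintype υ] [DecidableEq υ] (p : ι → υ) (hf : ∀ i, f i ≠ ∞) :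
    eEntropy f = eEntropy (fun u => ∑ i : {i // p i = u}, f i)
      + ∑ u, eEntropy fun i : {i // p i = u} => f i := by
  have h : ∀ u, (∑ i : {i // p i = u}, f i).toReal = ∑ i : {i // p i = u}, (f i).toReal :=
    fun u => ENNReal.toReal_sum fun i _ => hf i
  unfold eEntropy
  rw [homEntropy_chain p, ENNReal.ofReal_add, ENNReal.ofReal_sum_of_nonneg]
  · simp only [h]
  · exact fun u _ => homEntropy_nonneg fun i => ENNReal.toReal_nonneg
  · exact homEntropy_nonneg fun u => Finset.sum_nonneg fun i _ => ENNReal.toReal_nonneg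
  · exact Finset.sum_nonneg fun u _ => homEntropy_nonneg fun i => ENNReal.toReal_nonneg

/-- The relation I = H(p) − H(index | y) at one point y. Since klFun t = t log t + 1 − t, the linear
terms cancel after summation because p has mass one. -/
lemma klFun_identity {p a : ι → ℝ} (hp : ∀ i, 0 ≤ p i)
    (ha : ∀ i, 0 ≤ a i) (h : ∀ i, p i = 0 → a i = 0) (hps : ∑ i, p i = 1) :
    ∑ i, p i * (∑ j, a j) * InformationTheory.klFun (a i / (p i * ∑ j, a j)) + homEntropy a
      = ∑ i, a i * -Real.log (p i) := by
  have hA : 0 ≤ ∑ i, a i := Finset.sum_nonneg fun i _ => ha i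
  rcases hA.eq_or_lt with hA0 | hA
  · have ha0 : ∀ i, a i = 0 := fun i =>
      (Finset.sum_eq_zero_iff_of_nonneg fun i _ => ha i).1 hA0.symm i (Finset.mem_univ i)
    simp [ha0, homEntropy]
  have key : ∀ i, p i * (∑ j, a j) * InformationTheory.klFun (a i / (p i * ∑ j, a j))
      = a i * -Real.log (p i) - a i * (Real.log (∑ j, a j) - Real.log (a i))
        + (p i * ∑ j, a j) - a i := by
    intro i
    rcases (hp i).eq_or_lt with hpi | hpi
    · simp [h i hpi.symm, ← hpi]
    rcases (ha i).eq_or_lt with hai | hai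
    · simp [← hai, InformationTheory.klFun]
    rw [InformationTheory.klFun, Real.log_div hai.ne' (by positivity),
      Real.log_mul hpi.ne' hA.ne']
    field_simp
    ring
  simp only [key, homEntropy_eq_sum, Finset.sum_sub_distrib, Finset.sum_add_distrib,
    ← Finset.sum_mul, hps]
  ring

end EEntropy

/-! ### Mutual information as a drop of entropy -/

section MutualInfo

variable {ι α β : Type*} [Fintype ι] [MeasurableSpace α] [MeasurableSpace β] {l : Measure β} [SigmaFinite l]

/-- The joint law of a finitely valued variable and a variable with conditional densities. -/
def mixedLaw (e : ι → α) (l : Measure β) (f : ι → β → ℝ≥0∞) : Measure (α × β) :=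
  ∑ i, (Measure.dirac (e i)).prod (l.withDensity (f i))

lemma lintegral_mixedLaw (e : ι → α) {f : ι → β → ℝ≥0∞} (hf : ∀ i, Measurable (f i))
    {h : α × β → ℝ≥0∞} (hh : Measurable h) :
    ∫⁻ z, h z ∂mixedLaw e l f = ∑ i, ∫⁻ y, f i y * h (e i, y) ∂l := by
  rw [mixedLaw, lintegral_finsetSum_measure]
  refine Finset.sum_congr rfl fun i _ => ?_
  rw [Measure.dirac_prod, lintegral_map hh measurable_prodMk_left,
    lintegral_withDensity_eq_lintegral_mul _ (hf i) (by fun_prop)]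
  rfl

/-- `klFun_identity` integrated over y: the integral of `eEntropy` is the entropy of the index given
the second coordinate. The additive form avoids subtraction in `ℝ≥0∞` and yields finiteness of both
summands. -/
lemma mutualInfo_mixedLaw [MeasurableSingletonClass α] {e : ι → α} (he : Function.Injective e) {f : ι → β → ℝ≥0∞}
    (hf : ∀ i, Measurable (f i)) (hft : ∀ i y, f i y ≠ ∞) {p : ι → ℝ≥0∞}
    (hp : ∀ i, ∫⁻ y, f i y ∂l = p i) (hp1 : ∑ i, p i = 1) :
    mutualInfo (mixedLaw e l f) + ∫⁻ y, eEntropy (fun i => f i y) ∂l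
      = ENNReal.ofReal (∑ i, Real.negMulLog (p i).toReal) := by
  classical
  have hpt : ∀ i, p i ≠ ∞ := fun i => ENNReal.sum_ne_top.1 (by rw [hp1]; simp) i (Finset.mem_univ i)
  have hfst : (mixedLaw e l f).fst = ∑ i, p i • Measure.dirac (e i) := by
    ext s hs
    rw [Measure.fst_apply hs, ← lintegral_indicator_one (measurable_fst hs),
      lintegral_mixedLaw e hf (measurable_one.indicator (measurable_fst hs))]
    simp only [Measure.coe_finsetSum, Finset.sum_apply, Measure.smul_apply, smul_eq_mul]
    refine Finset.sum_congr rfl fun i _ => ?_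
    rw [Measure.dirac_apply' _ hs, ← hp i, ← lintegral_mul_const _ (hf i)]
    rfl
  have hfm : Measurable fun y => ∑ i, f i y := by fun_prop
  have hsnd : (mixedLaw e l f).snd = l.withDensity fun y => ∑ i, f i y := by
    ext s hs
    rw [Measure.snd_apply hs, ← lintegral_indicator_one (measurable_snd hs),
      lintegral_mixedLaw e hf (measurable_one.indicator (measurable_snd hs)),
      withDensity_apply _ hs, lintegral_finsetSum' _ fun i _ => (hf i).aemeasurable]
    refine Finset.sum_congr rfl fun i _ => ?_
    rw [← lintegral_indicator hs]
    refine lintegral_congr fun y => ?_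
    by_cases hy : y ∈ s <;> simp [hy]
  have hprod : (mixedLaw e l f).fst.prod (mixedLaw e l f).snd
      = mixedLaw e l fun i y => p i * ∑ j, f j y := by
    rw [hfst, hsnd, mixedLaw]
    ext s hs
    simp only [Measure.coe_finsetSum, Finset.sum_apply]
    have hfin : IsFiniteMeasure (l.withDensity fun y => ∑ i, f i y) := by
      refine isFiniteMeasure_withDensity ?_
      rw [lintegral_finsetSum' _ fun i _ => (hf i).aemeasurable]
      simp [hp, hp1]
    rw [Measure.prod_apply hs, lintegral_finsetSum_measure]
    refine Finset.sum_congr rfl fun i _ => ?_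
    have hd : l.withDensity (fun y => p i * ∑ j, f j y)
        = p i • l.withDensity fun y => ∑ j, f j y := by
      rw [← withDensity_smul _ hfm]; rfl
    rw [lintegral_smul_measure, lintegral_dirac' _ (measurable_measure_prodMk_left hs), hd,
      Measure.dirac_prod, Measure.map_apply measurable_prodMk_left hs]
    simp
  -- Indices of probability zero have densities vanishing almost everywhere; without this the
  -- quotient that defines the density below would lose mass.
  have hpf : ∀ᵐ y ∂l, ∀ i, p i = 0 → f i y = 0 := by
    rw [ae_all_iff]
    intro i
    by_cases h0 : p i = 0
    · have := (lintegral_eq_zero_iff (hf i)).1 ((hp i).trans h0)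
      filter_upwards [this] with y hy _ using hy
    · exact Filter.Eventually.of_forall fun y h => absurd h h0
  -- the density
  set D : α × β → ℝ≥0∞ := fun z =>
    ∑ i, Set.indicator {e i} (fun _ => f i z.2 / (p i * ∑ j, f j z.2)) z.1 with hD
  have hDe : ∀ i y, D (e i, y) = f i y / (p i * ∑ j, f j y) := by
    intro i y
    simp only [hD]
    rw [Finset.sum_eq_single i]
    · simp
    · intro j _ hj
      simp [he.ne hj.symm]
    · simp
  have hDm : Measurable D := by
    refine Finset.measurable_sum _ fun i _ => ?_
    have : (fun z : α × β => Set.indicator {e i} (fun _ => f i z.2 / (p i * ∑ j, f j z.2)) z.1)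
        = Set.indicator (Prod.fst ⁻¹' {e i}) fun z => f i z.2 / (p i * ∑ j, f j z.2) := by
      funext z; simp [Set.indicator]
    rw [this]
    exact Measurable.indicator (by fun_prop) (measurable_fst (measurableSet_singleton _))
  have hpos : ∀ i, Measurable fun y => p i * ∑ j, f j y := fun i => by fun_prop
  set ν := mixedLaw e l fun i y => p i * ∑ j, f j y with hν
  have hμν : mixedLaw e l f = ν.withDensity D := by
    ext s hs
    rw [withDensity_apply _ hs, ← lintegral_indicator hs, ← lintegral_indicator_one hs,
      lintegral_mixedLaw e hf (measurable_one.indicator hs),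
      lintegral_mixedLaw e hpos (hDm.indicator hs)]
    refine Finset.sum_congr rfl fun i _ => lintegral_congr_ae ?_
    filter_upwards [hpf] with y hy
    by_cases hys : (e i, y) ∈ s
    · simp only [hys, Set.indicator_of_mem, Pi.one_apply, mul_one, hDe]
      rcases eq_or_ne (p i * ∑ j, f j y) 0 with h0 | h0
      · rw [h0]
        rcases mul_eq_zero.1 h0 with h0 | h0
        · simp [hy i h0]
        · simp [Finset.sum_eq_zero_iff.1 h0 i (Finset.mem_univ i)]
      · rw [ENNReal.mul_div_cancel h0 (ENNReal.mul_ne_top (hpt i)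
          (ENNReal.sum_ne_top.2 fun j _ => hft j y))]
    · simp [hys]
  have hfin1 : IsFiniteMeasure (mixedLaw e l f) := ⟨by
    rw [← lintegral_one, lintegral_mixedLaw e hf (h := fun _ => 1) measurable_const]
    simp [hp, hp1]⟩
  have hfin2 : IsFiniteMeasure ν := by rw [← hprod]; infer_instance
  have hac : mixedLaw e l f ≪ ν := by rw [hμν]; exact withDensity_absolutelyContinuous _ _
  have hrn : (mixedLaw e l f).rnDeriv ν =ᵐ[ν] D := by
    rw [hμν]; exact Measure.rnDeriv_withDensity _ hDm
  rw [mutualInfo, hprod, InformationTheory.klDiv_eq_lintegral_klFun_of_ac hac]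
  have e1 : ∫⁻ x, ENNReal.ofReal (InformationTheory.klFun ((mixedLaw e l f).rnDeriv ν x).toReal) ∂ν
      = ∫⁻ x, ENNReal.ofReal (InformationTheory.klFun (D x).toReal) ∂ν := by
    refine lintegral_congr_ae ?_
    filter_upwards [hrn] with x hx
    rw [hx]
  have hkm : Measurable InformationTheory.klFun := InformationTheory.measurable_klFun
  rw [e1, lintegral_mixedLaw e hpos (by fun_prop),
    ← lintegral_finsetSum' _ fun i _ => by fun_prop,
    ← lintegral_add_right _ (measurable_eEntropy hf)]
  have hlog : ∀ i, 0 ≤ -Real.log (p i).toReal := fun i => by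
    refine neg_nonneg.2 (Real.log_nonpos ENNReal.toReal_nonneg ?_)
    refine ENNReal.toReal_le_of_le_ofReal zero_le_one ?_
    rw [ENNReal.ofReal_one, ← hp1]
    exact Finset.single_le_sum (f := p) (fun _ _ => zero_le) (Finset.mem_univ i)
  have hp1' : ∑ i, (p i).toReal = 1 := by
    rw [← ENNReal.toReal_sum fun i _ => hpt i, hp1]; rfl
  have e2 : ∀ᵐ y ∂l, ∑ i, (p i * ∑ j, f j y) * ENNReal.ofReal (InformationTheory.klFun
        (D (e i, y)).toReal) + eEntropy (fun i => f i y)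
      = ∑ i, f i y * ENNReal.ofReal (-Real.log (p i).toReal) := by
    filter_upwards [hpf] with y hy
    have hA : ∀ i, (f i y).toReal ≥ 0 := fun i => ENNReal.toReal_nonneg
    have hs : (∑ j, f j y).toReal = ∑ j, (f j y).toReal := ENNReal.toReal_sum fun j _ => hft j y
    have id := klFun_identity (p := fun i => (p i).toReal)
      (a := fun i => (f i y).toReal) (fun i => ENNReal.toReal_nonneg) hA
      (fun i h => by
        rcases (ENNReal.toReal_eq_zero_iff _).1 h with h | h
        · simp [hy i h]
        · exact absurd h (hpt i)) hp1'
    have t1 : ∀ i, (p i * ∑ j, f j y) * ENNReal.ofReal (InformationTheory.klFun (D (e i, y)).toReal)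
        = ENNReal.ofReal ((p i).toReal * (∑ j, (f j y).toReal)
          * InformationTheory.klFun ((f i y).toReal / ((p i).toReal * ∑ j, (f j y).toReal))) := by
      intro i
      rw [hDe, ENNReal.toReal_div, ENNReal.toReal_mul, hs, ENNReal.ofReal_mul
        (mul_nonneg ENNReal.toReal_nonneg (Finset.sum_nonneg fun j _ => hA j)),
        ENNReal.ofReal_mul ENNReal.toReal_nonneg, ENNReal.ofReal_toReal (hpt i),
        ofReal_sum_toReal fun j => hft j y]
    have t2 : ∀ i, f i y * ENNReal.ofReal (-Real.log (p i).toReal)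
        = ENNReal.ofReal ((f i y).toReal * -Real.log (p i).toReal) := fun i => by
      rw [ENNReal.ofReal_mul (hA i), ENNReal.ofReal_toReal (hft i y)]
    simp only [t1, t2, eEntropy]
    have hk : ∀ i, 0 ≤ (p i).toReal * (∑ j, (f j y).toReal)
        * InformationTheory.klFun ((f i y).toReal / ((p i).toReal * ∑ j, (f j y).toReal)) := by
      intro i
      have h1 : 0 ≤ (p i).toReal * ∑ j, (f j y).toReal :=
        mul_nonneg ENNReal.toReal_nonneg (Finset.sum_nonneg fun j _ => hA j)
      exact mul_nonneg h1 (InformationTheory.klFun_nonneg (div_nonneg (hA i) h1))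
    rw [← ENNReal.ofReal_sum_of_nonneg fun i _ => hk i,
      ← ENNReal.ofReal_sum_of_nonneg fun i _ => mul_nonneg (hA i) (hlog i),
      ← ENNReal.ofReal_add (Finset.sum_nonneg fun i _ => hk i) (homEntropy_nonneg hA), id]
  rw [lintegral_congr_ae e2, lintegral_finsetSum' _ fun i _ => by fun_prop]
  have e3 : ∀ i, ∫⁻ y, f i y * ENNReal.ofReal (-Real.log (p i).toReal) ∂l
      = ENNReal.ofReal ((p i).toReal * -Real.log (p i).toReal) := fun i => by
    rw [lintegral_mul_const _ (hf i), hp, ENNReal.ofReal_mul ENNReal.toReal_nonneg,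
      ENNReal.ofReal_toReal (hpt i)]
  simp only [e3]
  rw [← ENNReal.ofReal_sum_of_nonneg fun i _ => mul_nonneg ENNReal.toReal_nonneg (hlog i)]
  simp [Real.negMulLog]

end MutualInfo

/-! ### Paths of Markov chains with bounded transition densities -/

/-- The product of the transition densities `k j` along `y`. -/
def chainTail (k : ℕ → ℝ → ℝ → ℝ≥0∞) (n : ℕ) (y : Fin (n + 1) → ℝ) : ℝ≥0∞ :=
  ∏ i : Fin n, k i (y i.castSucc) (y i.succ)

/-- The density of a Markov chain with initial density `a` and transition densities `k j`. -/
def chainDensity (k : ℕ → ℝ → ℝ → ℝ≥0∞) (a : ℝ → ℝ≥0∞) (n : ℕ) (y : Fin (n + 1) → ℝ) : ℝ≥0∞ :=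
  a (y 0) * chainTail k n y

/-- The density after one step with the transition density `k`. -/
def stepDensity (k : ℝ → ℝ → ℝ≥0∞) (a : ℝ → ℝ≥0∞) (y' : ℝ) : ℝ≥0∞ :=
  ∫⁻ y, a y * k y y'

/-- Measurable bounded transition densities of total mass one. -/
structure IsTransition (c : ℝ≥0∞) (k : ℝ → ℝ → ℝ≥0∞) : Prop where
  measurable : Measurable (Function.uncurry k)
  le : ∀ y y', k y y' ≤ c
  lintegral : ∀ y, ∫⁻ y', k y y' = 1

section Chain

variable {k : ℕ → ℝ → ℝ → ℝ≥0∞} {a b : ℝ → ℝ≥0∞} {c : ℝ≥0∞} {n : ℕ}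

lemma lintegral_fin_cons {n : ℕ} {F : (Fin (n + 1) → ℝ) → ℝ≥0∞} (hF : Measurable F) :
    ∫⁻ y, F y = ∫⁻ y : Fin n → ℝ, ∫⁻ y₀ : ℝ, F (Fin.cons y₀ y) := by
  have h := (volume_preserving_piFinSuccAbove (fun _ : Fin (n + 1) => ℝ) 0).symm
  rw [← h.lintegral_comp hF, Measure.volume_eq_prod, lintegral_prod_symm' _ (by fun_prop)]
  simp only [MeasurableEquiv.piFinSuccAbove_symm_apply, Fin.insertNthEquiv_zero]
  rfl

lemma lintegral_fin_one {F : (Fin 1 → ℝ) → ℝ≥0∞} (hF : Measurable F) :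
    ∫⁻ y, F y = ∫⁻ y₀ : ℝ, F fun _ => y₀ := by
  rw [lintegral_fin_cons hF, volume_pi, Measure.pi_of_empty, lintegral_dirac]
  refine lintegral_congr fun y₀ => congrArg F (funext fun i => ?_)
  exact Fin.cases rfl (fun j => j.elim0) i

lemma measurable_fin_cons {n : ℕ} :
    Measurable fun z : ℝ × (Fin n → ℝ) => (Fin.cons z.1 z.2 : Fin (n + 1) → ℝ) := by
  refine measurable_pi_lambda _ fun i => ?_
  refine Fin.cases ?_ (fun j => ?_) i
  · simpa using measurable_fst
  · simp only [Fin.cons_succ]; fun_prop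

lemma chainTail_cons (y₀ : ℝ) (y : Fin (n + 1) → ℝ) :
    chainTail k (n + 1) (Fin.cons y₀ y) = k 0 y₀ (y 0) * chainTail (fun j => k (j + 1)) n y := by
  simp [chainTail, Fin.prod_univ_succ]

lemma chainTail_snoc (y : Fin (n + 1) → ℝ) (y' : ℝ) :
    chainTail k (n + 1) (Fin.snoc y y') = chainTail k n y * k n (y (Fin.last n)) y' := by
  simp only [chainTail, Fin.prod_univ_castSucc, Fin.snoc_castSucc, Fin.succ_last, Fin.snoc_last,
    Fin.val_castSucc, Fin.val_last]
  congr 1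
  refine Finset.prod_congr rfl fun i _ => ?_
  rw [← Fin.castSucc_succ, Fin.snoc_castSucc]

lemma measurable_chainTail (hk : ∀ j, IsTransition c (k j)) : Measurable (chainTail k n) := by
  unfold chainTail
  refine Finset.measurable_prod _ fun i _ => ?_
  exact (hk i).measurable.comp (f := fun y : Fin (n + 1) → ℝ => (y i.castSucc, y i.succ))
    (by fun_prop)

lemma measurable_chainDensity (hk : ∀ j, IsTransition c (k j)) (ha : Measurable a) :
    Measurable (chainDensity k a n) :=
  (ha.comp (measurable_pi_apply 0)).mul (measurable_chainTail hk)

lemma chainTail_ne_top (hc : c ≠ ∞) (hk : ∀ j, IsTransition c (k j)) (y : Fin (n + 1) → ℝ) :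
    chainTail k n y ≠ ∞ :=
  ENNReal.prod_ne_top fun i _ => ne_top_of_le_ne_top hc ((hk i).le _ _)

lemma measurable_stepDensity {k : ℝ → ℝ → ℝ≥0∞} (hk : IsTransition c k) (ha : Measurable a) :
    Measurable (stepDensity k a) := by
  have := hk.measurable
  unfold stepDensity
  refine Measurable.lintegral_prod_right' (f := fun z : ℝ × ℝ => a z.2 * k z.2 z.1) ?_
  exact (ha.comp measurable_snd).mul (this.comp measurable_swap)

lemma lintegral_stepDensity {k : ℝ → ℝ → ℝ≥0∞} (hk : IsTransition c k) (ha : Measurable a) :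
    ∫⁻ y, stepDensity k a y = ∫⁻ y, a y := by
  have := hk.measurable
  unfold stepDensity
  rw [lintegral_lintegral_swap]
  · refine lintegral_congr fun y => ?_
    rw [lintegral_const_mul _ (by fun_prop), hk.lintegral, mul_one]
  · exact ((ha.comp measurable_snd).mul (this.comp measurable_swap)).aemeasurable

/-- One transition turns any density of finite mass into a bounded one. -/
lemma stepDensity_le {k : ℝ → ℝ → ℝ≥0∞} (hk : IsTransition c k) (ha : Measurable a) (y : ℝ) :
    stepDensity k a y ≤ (∫⁻ y, a y) * c := by
  rw [stepDensity, ← lintegral_mul_const _ ha]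
  exact lintegral_mono fun y' => by gcongr; exact hk.le _ _

/-- Forgetting the first output leaves a chain of the same kind, started from the evolved density.
All later arguments about discarded outputs rest on this recursion. -/
lemma lintegral_chainDensity_cons (hk : ∀ j, IsTransition c (k j)) (ha : Measurable a)
    (y : Fin (n + 1) → ℝ) :
    ∫⁻ y₀, chainDensity k a (n + 1) (Fin.cons y₀ y)
      = chainDensity (fun j => k (j + 1)) (stepDensity (k 0) a) n y := by
  have := (hk 0).measurable
  simp only [chainDensity, chainTail_cons, Fin.cons_zero, stepDensity, ← mul_assoc]
  rw [lintegral_mul_const _ (by fun_prop)]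

lemma lintegral_chainDensity (hk : ∀ j, IsTransition c (k j)) (ha : Measurable a) :
    ∫⁻ y, chainDensity k a n y = ∫⁻ y, a y := by
  induction n generalizing k a with
  | zero =>
    rw [lintegral_fin_one (measurable_chainDensity hk ha)]
    simp [chainDensity, chainTail]
  | succ n ih =>
    rw [lintegral_fin_cons (measurable_chainDensity hk ha)]
    simp only [lintegral_chainDensity_cons hk ha]
    rw [ih (fun j => hk (j + 1)) (measurable_stepDensity (hk 0) ha),
      lintegral_stepDensity (hk 0) ha]

end Chain

/-! ### What a single observation reveals about the index -/

section EntropyDrop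

variable {ι : Type*} [Fintype ι]

/-- Jensen's inequality for the entropy: averaging increases the entropy. -/
lemma lintegral_eEntropy_le {β : Type*} [MeasurableSpace β] {l : Measure β} {r : ι → β → ℝ≥0∞}
    (hr : ∀ i, Measurable (r i)) (hrt : ∀ i y, r i y ≠ ∞) (hR : ∀ i, ∫⁻ y, r i y ∂l ≠ ∞) :
    ∫⁻ y, eEntropy (fun i => r i y) ∂l ≤ eEntropy fun i => ∫⁻ y, r i y ∂l := by
  set R : ι → ℝ≥0∞ := fun i => ∫⁻ y, r i y ∂l
  have h0 : ∀ᵐ y ∂l, ∀ i, R i = 0 → r i y = 0 := by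
    rw [ae_all_iff]
    intro i
    by_cases h : R i = 0
    · filter_upwards [(lintegral_eq_zero_iff (hr i)).1 h] with y hy _ using hy
    · exact Filter.Eventually.of_forall fun y h' => absurd h' h
  have hpos : ∀ i, 0 ≤ (R i).toReal * (Real.log (∑ j, (R j).toReal) - Real.log (R i).toReal) := by
    intro i
    rcases (ENNReal.toReal_nonneg (a := R i)).eq_or_lt with h | h
    · simp [← h]
    · exact mul_nonneg h.le (sub_nonneg.2 (Real.log_le_log h (Finset.single_le_sum
        (f := fun j => (R j).toReal) (fun j _ => ENNReal.toReal_nonneg) (Finset.mem_univ i))))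
  -- Gibbs' inequality with the averaged vector R as the reference at every y; the right side is
  -- linear in r and integrates to exactly the entropy of R.
  have h1 : ∀ᵐ y ∂l, eEntropy (fun i => r i y) ≤ ∑ i, r i y * ENNReal.ofReal
      (Real.log (∑ j, (R j).toReal) - Real.log (R i).toReal) := by
    filter_upwards [h0] with y hy
    refine (ENNReal.ofReal_le_ofReal (homEntropy_le_sum (b := fun i => (R i).toReal)
      (fun i => ENNReal.toReal_nonneg) (fun i => ENNReal.toReal_nonneg) fun i hi => ?_)).trans ?_
    · rcases (ENNReal.toReal_eq_zero_iff _).1 hi with h | h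
      · simp [hy i h]
      · exact absurd h (hR i)
    · refine (Finset.le_sum_of_subadditive ENNReal.ofReal ENNReal.ofReal_zero.le
        (fun _ _ => ENNReal.ofReal_add_le) _ _).trans (Finset.sum_le_sum fun i _ => ?_)
      rw [ENNReal.ofReal_mul ENNReal.toReal_nonneg, ENNReal.ofReal_toReal (hrt i y)]
  refine (lintegral_mono_ae h1).trans ?_
  rw [lintegral_finsetSum' _ fun i _ => by fun_prop, eEntropy, homEntropy_eq_sum,
    ENNReal.ofReal_sum_of_nonneg fun i _ => hpos i]
  refine Finset.sum_le_sum fun i _ => ?_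
  rw [lintegral_mul_const _ (hr i), ENNReal.ofReal_mul ENNReal.toReal_nonneg,
    ENNReal.ofReal_toReal (hR i)]

/-- The information of one observation y about the index is h(y) − h(y | index). The first term is
bounded by a cross entropy with the density q₀. For the second, r ≤ C w reduces the question to the
logarithm of w / R, and comparing w q₁ with R bounds that by another cross entropy. Each comparison
uses log t ≤ t − 1, and the two resulting −∑ r make up the doubled sum on the left. -/
lemma entropy_drop_pointwise {r R w : ι → ℝ} {C q₀ q₁ : ℝ} (hr : ∀ i, 0 ≤ r i) (hR : ∀ i, 0 ≤ R i)
    (hC : 0 < C) (hq₀ : 0 < q₀) (hq₁ : 0 < q₁) (hrw : ∀ i, r i ≤ C * w i)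
    (h0 : ∀ i, R i = 0 → r i = 0) :
    ∑ i, r i * (Real.log (∑ j, R j) - Real.log (R i)) + 2 * ∑ i, r i
      ≤ homEntropy r + (∑ i, r i) * (Real.log C - Real.log q₀ - Real.log q₁) + q₀ * ∑ i, R i
        + ∑ i, w i * q₁ * (r i / R i) := by
  have hS : 0 ≤ ∑ i, R i := Finset.sum_nonneg fun i _ => hR i
  -- The mixture ∑ r against the reference q₀ ∑ R.
  have h1 : -((∑ i, r i) * Real.log (∑ i, r i))
      + (∑ i, r i) * (Real.log q₀ + Real.log (∑ i, R i)) ≤ q₀ * (∑ i, R i) - ∑ i, r i := by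
    rcases hS.eq_or_lt with hS0 | hS0
    · have : ∀ i, r i = 0 := fun i => h0 i
        ((Finset.sum_eq_zero_iff_of_nonneg fun i _ => hR i).1 hS0.symm i (Finset.mem_univ i))
      simp [this, ← hS0]
    · have := negMulLog_add_mul_log_le (x := ∑ i, r i) (y := q₀ * ∑ i, R i)
        (Finset.sum_nonneg fun i _ => hr i) (by positivity) fun h => absurd h (by positivity)
      rwa [Real.log_mul hq₀.ne' hS0.ne', Real.negMulLog, neg_mul] at this
  -- For each index, R i against w i q₁. The last summand is kept with the factor r i / R i, which
  -- integrates to at most one over y.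
  have h2 : ∀ i, r i * Real.log (r i) - r i * Real.log (R i) + r i
      ≤ r i * (Real.log C - Real.log q₁) + w i * q₁ * (r i / R i) := by
    intro i
    rcases (hr i).eq_or_lt with h | h
    · simp [← h]
    have hRi : 0 < R i := (hR i).lt_of_ne fun h' => h.ne' (h0 i h'.symm)
    have hw : 0 < w i := by
      by_contra hw
      have := mul_nonpos_of_nonneg_of_nonpos hC.le (not_lt.1 hw)
      linarith [hrw i]
    have e1 := Real.log_le_log h (hrw i)
    rw [Real.log_mul hC.ne' hw.ne'] at e1
    have e2 := Real.log_le_sub_one_of_pos (x := w i * q₁ / R i) (by positivity)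
    rw [Real.log_div (by positivity) hRi.ne', Real.log_mul hw.ne' hq₁.ne'] at e2
    have e3 : w i * q₁ * (r i / R i) = r i * (w i * q₁ / R i) := by ring
    rw [e3]
    nlinarith [mul_le_mul_of_nonneg_left e1 h.le, mul_le_mul_of_nonneg_left e2 h.le]
  have h3 := Finset.sum_le_sum fun i (_ : i ∈ Finset.univ) => h2 i
  simp only [Finset.sum_add_distrib, Finset.sum_sub_distrib, ← Finset.sum_mul] at h3
  simp only [homEntropy, Real.negMulLog, mul_sub, Finset.sum_sub_distrib, ← Finset.sum_mul,
    neg_mul, Finset.sum_neg_distrib]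
  linarith

end EntropyDrop

section EntropyDrop

open scoped NNReal

variable {ι : Type*} [Fintype ι]

lemma log_gaussianPDFReal {v : ℝ≥0} (hv : v ≠ 0) (x : ℝ) :
    Real.log (gaussianPDFReal 0 v x) = -(Real.log (2 * Real.pi * v) / 2) - x ^ 2 / (2 * v) := by
  have hv' : (0 : ℝ) < v := NNReal.coe_pos.2 (pos_iff_ne_zero.2 hv)
  have : 0 < Real.pi := Real.pi_pos
  rw [gaussianPDFReal, Real.log_mul (by positivity) (Real.exp_ne_zero _), Real.log_exp,
    Real.log_inv, Real.log_sqrt (by positivity)]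
  simp
  ring

/-- `entropy_drop_pointwise` integrated over y, with both references Gaussian of variance v: one
evaluated at the observation y being discarded, the other at the following observation y₁. The
constant C = 1 / (2π) in the bound on r i is the product of two suprema of the standard Gaussian
density. -/
lemma eEntropy_lintegral_le {r : ι → ℝ → ℝ≥0∞} (hr : ∀ i, Measurable (r i))
    (hrt : ∀ i y, r i y ≠ ∞) (hR : ∀ i, ∫⁻ y, r i y ≠ ∞) {w : ι → ℝ≥0∞} (hw : ∀ i, w i ≠ ∞)
    {v : ℝ≥0} (hv : 1 ≤ v) (y₁ : ℝ)
    (hrw : ∀ i y, r i y ≤ ENNReal.ofReal (2 * Real.pi)⁻¹ * w i) :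
    eEntropy (fun i => ∫⁻ y, r i y) + 2 * ∑ i, ∫⁻ y, r i y
      ≤ (∫⁻ y, eEntropy (fun i => r i y))
        + (∫⁻ y, (∑ i, r i y) * ENNReal.ofReal (Real.log v + (y ^ 2 + y₁ ^ 2) / (2 * v)))
        + (∑ i, ∫⁻ y, r i y) + (∑ i, w i) * gaussianPDF 0 v y₁ := by
  have hpi : 0 < Real.pi := Real.pi_pos
  have hv0 : v ≠ 0 := (zero_lt_one.trans_le hv).ne'
  have hv1 : (1 : ℝ) ≤ v := by exact_mod_cast hv
  set R : ι → ℝ≥0∞ := fun i => ∫⁻ y, r i y with hRdef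
  have h0 : ∀ᵐ y : ℝ, ∀ i, R i = 0 → r i y = 0 := by
    rw [ae_all_iff]
    intro i
    by_cases h : R i = 0
    · filter_upwards [(lintegral_eq_zero_iff (hr i)).1 h] with y hy _ using hy
    · exact Filter.Eventually.of_forall fun y h' => absurd h' h
  have hlog : ∀ i, 0 ≤ (R i).toReal * (Real.log (∑ j, (R j).toReal) - Real.log (R i).toReal) := by
    intro i
    rcases (ENNReal.toReal_nonneg (a := R i)).eq_or_lt with h | h
    · simp [← h]
    · exact mul_nonneg h.le (sub_nonneg.2 (Real.log_le_log h (Finset.single_le_sum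
        (f := fun j => (R j).toReal) (fun j _ => ENNReal.toReal_nonneg) (Finset.mem_univ i))))
  have hpt : ∀ᵐ y : ℝ, ∑ i, r i y * ENNReal.ofReal
        (Real.log (∑ j, (R j).toReal) - Real.log (R i).toReal) + 2 * ∑ i, r i y
      ≤ eEntropy (fun i => r i y)
        + (∑ i, r i y) * ENNReal.ofReal (Real.log v + (y ^ 2 + y₁ ^ 2) / (2 * v))
        + gaussianPDF 0 v y * ∑ i, R i + ∑ i, w i * gaussianPDF 0 v y₁ * (r i y * (R i)⁻¹) := by
    filter_upwards [h0] with y hy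
    have hy' : ∀ i, (R i).toReal = 0 → (r i y).toReal = 0 := fun i hi => by
      rcases (ENNReal.toReal_eq_zero_iff _).1 hi with h | h
      · simp [hy i h]
      · exact absurd h (hR i)
    have key := entropy_drop_pointwise (r := fun i => (r i y).toReal) (R := fun i => (R i).toReal)
      (w := fun i => (w i).toReal) (C := (2 * Real.pi)⁻¹) (q₀ := gaussianPDFReal 0 v y)
      (q₁ := gaussianPDFReal 0 v y₁) (fun i => ENNReal.toReal_nonneg)
      (fun i => ENNReal.toReal_nonneg) (by positivity) (gaussianPDFReal_pos _ _ _ hv0)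
      (gaussianPDFReal_pos _ _ _ hv0) (fun i => by
        have := ENNReal.toReal_mono (ENNReal.mul_ne_top ENNReal.ofReal_ne_top (hw i)) (hrw i y)
        rwa [ENNReal.toReal_mul, ENNReal.toReal_ofReal (by positivity)] at this) hy'
    -- The factor 2π of C cancels against the normalisations of the two Gaussians, so that only log
    -- v and the quadratic terms survive.
    have hlc : Real.log (2 * Real.pi)⁻¹ - Real.log (gaussianPDFReal 0 v y)
        - Real.log (gaussianPDFReal 0 v y₁) = Real.log v + (y ^ 2 + y₁ ^ 2) / (2 * v) := by
      rw [log_gaussianPDFReal hv0, log_gaussianPDFReal hv0, Real.log_inv,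
        Real.log_mul (x := 2 * Real.pi) (by positivity) (by positivity)]
      ring
    rw [hlc] at key
    have hlv : 0 ≤ Real.log v + (y ^ 2 + y₁ ^ 2) / (2 * v) :=
      add_nonneg (Real.log_nonneg hv1) (by positivity)
    have t1 : ∀ i, r i y * ENNReal.ofReal (Real.log (∑ j, (R j).toReal) - Real.log (R i).toReal)
        = ENNReal.ofReal ((r i y).toReal
          * (Real.log (∑ j, (R j).toReal) - Real.log (R i).toReal)) := fun i => by
      rw [ENNReal.ofReal_mul ENNReal.toReal_nonneg, ENNReal.ofReal_toReal (hrt i y)]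
    have hl : ∀ i, 0 ≤ (r i y).toReal
        * (Real.log (∑ j, (R j).toReal) - Real.log (R i).toReal) := by
      intro i
      rcases (ENNReal.toReal_nonneg (a := r i y)).eq_or_lt with h | h
      · simp [← h]
      have hRi : 0 < (R i).toReal :=
        ENNReal.toReal_nonneg.lt_of_ne fun h' => h.ne' (hy' i h'.symm)
      exact mul_nonneg h.le (sub_nonneg.2 (Real.log_le_log hRi (Finset.single_le_sum
        (f := fun j => (R j).toReal) (fun j _ => ENNReal.toReal_nonneg) (Finset.mem_univ i))))
    have t2 : ∀ i, w i * gaussianPDF 0 v y₁ * (r i y * (R i)⁻¹) = ENNReal.ofReal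
        ((w i).toReal * gaussianPDFReal 0 v y₁ * ((r i y).toReal / (R i).toReal)) := by
      intro i
      by_cases hRi : R i = 0
      · simp [hRi, hy i hRi]
      rw [ENNReal.ofReal_mul (mul_nonneg ENNReal.toReal_nonneg (gaussianPDFReal_nonneg _ _ _)),
        ENNReal.ofReal_mul ENNReal.toReal_nonneg, ENNReal.ofReal_toReal (hw i),
        ← ENNReal.toReal_div, ENNReal.ofReal_toReal (ENNReal.div_ne_top (hrt i y) hRi)]
      rfl
    have hrs : ∑ i, r i y = ENNReal.ofReal (∑ i, (r i y).toReal) :=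
      (ofReal_sum_toReal fun i => hrt i y).symm
    have hRs : ∑ i, R i = ENNReal.ofReal (∑ i, (R i).toReal) := (ofReal_sum_toReal hR).symm
    have p1 : 0 ≤ ∑ i, (r i y).toReal := Finset.sum_nonneg fun i _ => ENNReal.toReal_nonneg
    have p2 : 0 ≤ ∑ i, (R i).toReal := Finset.sum_nonneg fun i _ => ENNReal.toReal_nonneg
    have p3 : 0 ≤ gaussianPDFReal 0 v y := gaussianPDFReal_nonneg _ _ _
    have p4 : 0 ≤ homEntropy fun i => (r i y).toReal :=
      homEntropy_nonneg fun i => ENNReal.toReal_nonneg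
    have p5 : ∀ i, 0 ≤ (w i).toReal * gaussianPDFReal 0 v y₁ * ((r i y).toReal / (R i).toReal) :=
      fun i => mul_nonneg (mul_nonneg ENNReal.toReal_nonneg (gaussianPDFReal_nonneg _ _ _))
        (div_nonneg ENNReal.toReal_nonneg ENNReal.toReal_nonneg)
    simp only [t1, t2]
    rw [hrs, hRs, gaussianPDF, eEntropy, ← ENNReal.ofReal_sum_of_nonneg fun i _ => hl i,
      ← ENNReal.ofReal_sum_of_nonneg fun i _ => p5 i,
      show (2 : ℝ≥0∞) = ENNReal.ofReal 2 by simp, ← ENNReal.ofReal_mul zero_le_two,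
      ← ENNReal.ofReal_mul p1, ← ENNReal.ofReal_mul p3,
      ← ENNReal.ofReal_add (Finset.sum_nonneg fun i _ => hl i) (by positivity),
      ← ENNReal.ofReal_add p4 (by positivity), ← ENNReal.ofReal_add (by positivity) (by positivity),
      ← ENNReal.ofReal_add (by positivity) (Finset.sum_nonneg fun i _ => p5 i)]
    exact ENNReal.ofReal_le_ofReal key
  have hint := lintegral_mono_ae hpt
  have hq : Measurable (gaussianPDF 0 v) := measurable_gaussianPDF 0 v
  have hE := measurable_eEntropy hr
  rw [lintegral_add_left (by fun_prop), lintegral_add_left (by fun_prop),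
    lintegral_add_left (by fun_prop), lintegral_add_left hE,
    lintegral_const_mul _ (by fun_prop), lintegral_mul_const _ hq, lintegral_gaussianPDF_eq_one 0 hv0,
    one_mul, lintegral_finsetSum' _ fun i _ => by fun_prop,
    lintegral_finsetSum' _ fun i _ => by fun_prop,
    lintegral_finsetSum' _ fun i _ => by fun_prop] at hint
  have l1 : eEntropy R = ∑ i, ∫⁻ y, r i y * ENNReal.ofReal
      (Real.log (∑ j, (R j).toReal) - Real.log (R i).toReal) := by
    rw [eEntropy, homEntropy_eq_sum, ENNReal.ofReal_sum_of_nonneg fun i _ => hlog i]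
    refine Finset.sum_congr rfl fun i _ => ?_
    rw [lintegral_mul_const _ (hr i), ENNReal.ofReal_mul ENNReal.toReal_nonneg,
      ENNReal.ofReal_toReal (hR i)]
  -- Each r i / R i integrates to one, or to zero when R i = 0.
  have l2 : ∑ i, ∫⁻ y, w i * gaussianPDF 0 v y₁ * (r i y * (R i)⁻¹)
      ≤ (∑ i, w i) * gaussianPDF 0 v y₁ := by
    rw [Finset.sum_mul]
    refine Finset.sum_le_sum fun i _ => ?_
    rw [lintegral_const_mul _ (by fun_prop), lintegral_mul_const _ (hr i)]
    exact mul_le_of_le_one_right zero_le (ENNReal.mul_inv_le_one _)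
  rw [← l1] at hint
  exact hint.trans (add_le_add le_rfl l2)

end EntropyDrop

/-- The maximum of the standard Gaussian density. -/
def gaussBound : ℝ≥0∞ := ENNReal.ofReal (Real.sqrt (2 * Real.pi))⁻¹

lemma gaussBound_ne_top : gaussBound ≠ ∞ := ENNReal.ofReal_ne_top

lemma gaussBound_mul_self : gaussBound * gaussBound = ENNReal.ofReal (2 * Real.pi)⁻¹ := by
  have : 0 < Real.pi := Real.pi_pos
  rw [gaussBound, ← ENNReal.ofReal_mul (by positivity), ← mul_inv,
    Real.mul_self_sqrt (by positivity)]

/-! ### Entropy of the index given the path -/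

section ChainEntropy

open scoped NNReal

variable {ι : Type*} [Fintype ι] {k : ι → ℕ → ℝ → ℝ → ℝ≥0∞} {α : ι → ℝ → ℝ≥0∞} {n : ℕ}

/-- The entropy of the index given the path of a Markov chain with densities depending on it. -/
def chainEntropy (k : ι → ℕ → ℝ → ℝ → ℝ≥0∞) (α : ι → ℝ → ℝ≥0∞) (n : ℕ) : ℝ≥0∞ :=
  ∫⁻ y, eEntropy fun i => chainDensity (k i) (α i) n y

lemma chainDensity_ne_top {c : ℝ≥0∞} (hc : c ≠ ∞) {k : ℕ → ℝ → ℝ → ℝ≥0∞} {a : ℝ → ℝ≥0∞}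
    (hk : ∀ j, IsTransition c (k j)) (ha : ∀ y, a y ≠ ∞) (y : Fin (n + 1) → ℝ) :
    chainDensity k a n y ≠ ∞ :=
  ENNReal.mul_ne_top (ha _) (chainTail_ne_top hc hk y)

lemma stepDensity_ne_top {c : ℝ≥0∞} (hc : c ≠ ∞) {k : ℝ → ℝ → ℝ≥0∞} {a : ℝ → ℝ≥0∞}
    (hk : IsTransition c k) (ha : Measurable a) (ha1 : ∫⁻ y, a y ≠ ∞) (y : ℝ) :
    stepDensity k a y ≠ ∞ :=
  ne_top_of_le_ne_top (ENNReal.mul_ne_top ha1 hc) (stepDensity_le hk ha y)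

/-- Less observation means more uncertainty: Jensen's inequality in the first output, for every
fixed tail of the path. -/
lemma chainEntropy_succ_le (hk : ∀ i j, IsTransition gaussBound (k i j))
    (hα : ∀ i, Measurable (α i)) (hαt : ∀ i y, α i y ≠ ∞) (hα1 : ∀ i, ∫⁻ y, α i y ≠ ∞) :
    chainEntropy k α (n + 1)
      ≤ chainEntropy (fun i j => k i (j + 1)) (fun i => stepDensity (k i 0) (α i)) n := by
  rw [chainEntropy, lintegral_fin_cons (measurable_eEntropy fun i =>
    measurable_chainDensity (hk i) (hα i)), chainEntropy]
  refine lintegral_mono fun y => ?_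
  simp only [← fun i => lintegral_chainDensity_cons (hk i) (hα i) y]
  refine lintegral_eEntropy_le (fun i => (measurable_chainDensity (hk i) (hα i)).comp
    (measurable_fin_cons.comp measurable_prodMk_right))
    (fun i y₀ => chainDensity_ne_top gaussBound_ne_top (hk i) (hαt i) _) fun i => ?_
  rw [lintegral_chainDensity_cons (hk i) (hα i)]
  exact chainDensity_ne_top gaussBound_ne_top (fun j => hk i (j + 1))
    (stepDensity_ne_top gaussBound_ne_top (hk i 0) (hα i) (hα1 i)) y

/-- Conversely, the first output Y₀ carries at most log v + 1 nats about the index given the rest.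
Its entropy is at most that of a Gaussian of variance v. Given the index and the rest, its density
is the product of two Gaussian-bounded factors divided by the density of Y₁, and the entropy of Y₁
is again at most Gaussian. The two second moments contribute (v + v) / (2v) = 1. -/
lemma chainEntropy_step_le {v : ℝ≥0} (hv : 1 ≤ v) {p : ι → ℝ≥0∞}
    (hk : ∀ i j, IsTransition gaussBound (k i j))
    (hα : ∀ i, Measurable (α i)) (hαp : ∀ i y, α i y ≤ p i * gaussBound)
    (hα1 : ∀ i, ∫⁻ y, α i y = p i) (hp : ∑ i, p i = 1)
    (hm₀ : ∑ i, ∫⁻ y, α i y * ENNReal.ofReal (y ^ 2) ≤ v)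
    (hm₁ : ∑ i, ∫⁻ y, stepDensity (k i 0) (α i) y * ENNReal.ofReal (y ^ 2) ≤ v) :
    chainEntropy (fun i j => k i (j + 1)) (fun i => stepDensity (k i 0) (α i)) n
      ≤ chainEntropy k α (n + 1) + (ENNReal.ofReal (Real.log v) + 1) := by
  have hv0 : v ≠ 0 := (zero_lt_one.trans_le hv).ne'
  have hv1 : (1 : ℝ) ≤ v := by exact_mod_cast hv
  have hpt : ∀ i, p i ≠ ∞ := fun i => ENNReal.sum_ne_top.1 (by rw [hp]; simp) i (Finset.mem_univ i)
  have hαt : ∀ i y, α i y ≠ ∞ := fun i y =>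
    ne_top_of_le_ne_top (ENNReal.mul_ne_top (hpt i) gaussBound_ne_top) (hαp i y)
  set k' : ι → ℕ → ℝ → ℝ → ℝ≥0∞ := fun i j => k i (j + 1) with hk'
  set α' : ι → ℝ → ℝ≥0∞ := fun i => stepDensity (k i 0) (α i) with hα'
  have hkk : ∀ i j, IsTransition gaussBound (k' i j) := fun i j => hk i (j + 1)
  have hαm : ∀ i, Measurable (α' i) := fun i => measurable_stepDensity (hk i 0) (hα i)
  have hq : Measurable (gaussianPDF 0 v) := measurable_gaussianPDF 0 v
  have hcm : ∀ i (y : Fin (n + 1) → ℝ),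
      Measurable fun y₀ : ℝ => chainDensity (k i) (α i) (n + 1) (Fin.cons y₀ y : Fin (n + 2) → ℝ) :=
    fun i y => (measurable_chainDensity (hk i) (hα i)).comp
      (measurable_fin_cons.comp measurable_prodMk_right)
  have hsq : ∀ y : Fin (n + 1) → ℝ, ∀ y₀ : ℝ, ENNReal.ofReal
      (Real.log v + (y₀ ^ 2 + y 0 ^ 2) / (2 * v)) = ENNReal.ofReal (Real.log v)
        + (ENNReal.ofReal (y₀ ^ 2) + ENNReal.ofReal (y 0 ^ 2)) * (2 * v : ℝ≥0∞)⁻¹ := by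
    intro y y₀
    rw [ENNReal.ofReal_add (Real.log_nonneg hv1) (by positivity),
      ENNReal.ofReal_div_of_pos (by positivity), ENNReal.ofReal_add (by positivity) (by positivity),
      ENNReal.ofReal_mul zero_le_two, div_eq_mul_inv]
    simp
  -- the inequality for a fixed tail
  have hfix : ∀ y : Fin (n + 1) → ℝ,
      eEntropy (fun i => chainDensity (k' i) (α' i) n y) + 2 * ∑ i, chainDensity (k' i) (α' i) n y
        ≤ (∫⁻ y₀ : ℝ, eEntropy (fun i => chainDensity (k i) (α i) (n + 1)
              (Fin.cons y₀ y : Fin (n + 2) → ℝ)))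
          + ((∑ i, chainDensity (k' i) (α' i) n y * ENNReal.ofReal (Real.log v))
              + ((∑ i, chainDensity (k' i) (stepDensity (k i 0)
                  fun y => α i y * ENNReal.ofReal (y ^ 2)) n y)
                + ∑ i, chainDensity (k' i) (fun y => α' i y * ENNReal.ofReal (y ^ 2)) n y)
                * (2 * v : ℝ≥0∞)⁻¹)
          + (∑ i, chainDensity (k' i) (α' i) n y)
          + ∑ i, p i * chainDensity (k' i) (gaussianPDF 0 v) n y := by
    intro y
    -- The initial density is at most p i times `gaussBound` and so is the first transition without
    -- p i; their product leaves w i = p i times the remaining transitions.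
    have h := eEntropy_lintegral_le
      (r := fun i y₀ => chainDensity (k i) (α i) (n + 1) (Fin.cons y₀ y : Fin (n + 2) → ℝ))
      (w := fun i => p i * chainTail (k' i) n y) (fun i => hcm i y)
      (fun i y₀ => chainDensity_ne_top gaussBound_ne_top (hk i) (hαt i) _)
      (fun i => by
        rw [lintegral_chainDensity_cons (hk i) (hα i)]
        exact chainDensity_ne_top gaussBound_ne_top (hkk i) (stepDensity_ne_top gaussBound_ne_top
          (hk i 0) (hα i) (by rw [hα1]; exact hpt i)) y)
      (fun i => ENNReal.mul_ne_top (hpt i) (chainTail_ne_top gaussBound_ne_top (hkk i) y)) hv (y 0)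
      (fun i y₀ => by
        rw [chainDensity, chainTail_cons, Fin.cons_zero, ← gaussBound_mul_self]
        calc α i y₀ * (k i 0 y₀ (y 0) * chainTail (k' i) n y)
            ≤ p i * gaussBound * (gaussBound * chainTail (k' i) n y) := by
              gcongr
              · exact hαp i y₀
              · exact (hk i 0).le _ _
          _ = _ := by ring)
    simp only [fun i => lintegral_chainDensity_cons (hk i) (hα i) y] at h
    refine h.trans (le_of_eq ?_)
    congr 1
    · congr 2
      simp only [hsq, Finset.sum_mul]
      have e : ∀ i, ∫⁻ y₀ : ℝ, chainDensity (k i) (α i) (n + 1) (Fin.cons y₀ y : Fin (n + 2) → ℝ)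
            * (ENNReal.ofReal (Real.log v)
              + (ENNReal.ofReal (y₀ ^ 2) + ENNReal.ofReal (y 0 ^ 2)) * (2 * v : ℝ≥0∞)⁻¹)
          = chainDensity (k' i) (α' i) n y * ENNReal.ofReal (Real.log v)
            + (chainDensity (k' i) (stepDensity (k i 0)
                  fun y => α i y * ENNReal.ofReal (y ^ 2)) n y
                + chainDensity (k' i) (fun y => α' i y * ENNReal.ofReal (y ^ 2)) n y)
                * (2 * v : ℝ≥0∞)⁻¹ := by
        intro i
        have hm := hcm i y
        have e0 : ∀ y₀ : ℝ, chainDensity (k i) (α i) (n + 1) (Fin.cons y₀ y : Fin (n + 2) → ℝ)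
              * (ENNReal.ofReal (Real.log v)
                + (ENNReal.ofReal (y₀ ^ 2) + ENNReal.ofReal (y 0 ^ 2)) * (2 * v : ℝ≥0∞)⁻¹)
            = chainDensity (k i) (α i) (n + 1) (Fin.cons y₀ y : Fin (n + 2) → ℝ)
                * ENNReal.ofReal (Real.log v)
              + (chainDensity (k i) (fun y => α i y * ENNReal.ofReal (y ^ 2)) (n + 1)
                  (Fin.cons y₀ y : Fin (n + 2) → ℝ)
                + chainDensity (k i) (α i) (n + 1) (Fin.cons y₀ y : Fin (n + 2) → ℝ)
                  * ENNReal.ofReal (y 0 ^ 2)) * (2 * v : ℝ≥0∞)⁻¹ := by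
          intro y₀
          simp only [chainDensity, Fin.cons_zero]
          ring
        have hα2 : Measurable fun y => α i y * ENNReal.ofReal (y ^ 2) := by
          have := hα i
          fun_prop
        simp only [e0]
        rw [lintegral_add_left (by fun_prop), lintegral_mul_const _ hm,
          lintegral_mul_const' _ _ (by simp [hv0]), lintegral_add_right _ (by fun_prop),
          lintegral_mul_const _ hm, lintegral_chainDensity_cons (hk i) (hα i),
          lintegral_chainDensity_cons (hk i) hα2]
        simp only [chainDensity, hα', hk']
        ring
      have hm' : ∀ i ∈ Finset.univ, AEMeasurable fun y₀ : ℝ =>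
          chainDensity (k i) (α i) (n + 1) (Fin.cons y₀ y : Fin (n + 2) → ℝ)
            * (ENNReal.ofReal (Real.log v)
              + (ENNReal.ofReal (y₀ ^ 2) + ENNReal.ofReal (y 0 ^ 2)) * (2 * v : ℝ≥0∞)⁻¹) := by
        intro i _
        have := hcm i y
        fun_prop
      rw [lintegral_finsetSum' _ hm', Finset.sum_congr rfl fun i _ => e i, Finset.sum_add_distrib,
        ← Finset.sum_mul, ← Finset.sum_mul, Finset.sum_add_distrib]
    · rw [Finset.sum_mul]
      refine Finset.sum_congr rfl fun i _ => ?_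
      rw [chainDensity]
      ring
  have hint := lintegral_mono (μ := (volume : Measure (Fin (n + 1) → ℝ))) hfix
  have hd : ∀ i, Measurable (chainDensity (k' i) (α' i) n) := fun i =>
    measurable_chainDensity (hkk i) (hαm i)
  have hα2 : ∀ i, Measurable fun y => α i y * ENNReal.ofReal (y ^ 2) := fun i => by
    have := hα i
    fun_prop
  have hs2 : ∀ i, Measurable (stepDensity (k i 0) fun y => α i y * ENNReal.ofReal (y ^ 2)) :=
    fun i => measurable_stepDensity (hk i 0) (hα2 i)
  have hd2 : ∀ i, Measurable (chainDensity (k' i) (stepDensity (k i 0)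
      fun y => α i y * ENNReal.ofReal (y ^ 2)) n) := fun i =>
    measurable_chainDensity (hkk i) (hs2 i)
  have hα2' : ∀ i, Measurable fun y => α' i y * ENNReal.ofReal (y ^ 2) := fun i => by
    have := hαm i
    fun_prop
  have hd3 : ∀ i, Measurable (chainDensity (k' i) (fun y => α' i y * ENNReal.ofReal (y ^ 2)) n) :=
    fun i => measurable_chainDensity (hkk i) (hα2' i)
  have hd4 : ∀ i, Measurable (chainDensity (k' i) (gaussianPDF 0 v) n) :=
    fun i => measurable_chainDensity (hkk i) hq
  have i1 : ∀ i, ∫⁻ y, chainDensity (k' i) (α' i) n y = p i := fun i => by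
    rw [lintegral_chainDensity (hkk i) (hαm i), lintegral_stepDensity (hk i 0) (hα i), hα1]
  have i2 : ∀ i, ∫⁻ y, chainDensity (k' i) (stepDensity (k i 0)
      fun y => α i y * ENNReal.ofReal (y ^ 2)) n y = ∫⁻ y, α i y * ENNReal.ofReal (y ^ 2) :=
    fun i => by rw [lintegral_chainDensity (hkk i) (hs2 i), lintegral_stepDensity (hk i 0) (hα2 i)]
  have i4 : ∀ i, ∫⁻ y, chainDensity (k' i) (gaussianPDF 0 v) n y = 1 := fun i => by
    rw [lintegral_chainDensity (hkk i) hq, lintegral_gaussianPDF_eq_one 0 hv0]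
  have s1 : ∫⁻ y, ∑ i, chainDensity (k' i) (α' i) n y = 1 := by
    rw [lintegral_finsetSum _ fun i _ => hd i, Finset.sum_congr rfl fun i _ => i1 i, hp]
  have s2 : ∫⁻ y, ∑ i, chainDensity (k' i) (stepDensity (k i 0)
      fun y => α i y * ENNReal.ofReal (y ^ 2)) n y ≤ v := by
    rw [lintegral_finsetSum _ fun i _ => hd2 i, Finset.sum_congr rfl fun i _ => i2 i]
    exact hm₀
  have s3 : ∫⁻ y, ∑ i, chainDensity (k' i) (fun y => α' i y * ENNReal.ofReal (y ^ 2)) n y ≤ v := by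
    rw [lintegral_finsetSum _ fun i _ => hd3 i,
      Finset.sum_congr rfl fun i _ => lintegral_chainDensity (hkk i) (hα2' i)]
    exact hm₁
  have s4 : ∫⁻ y, ∑ i, p i * chainDensity (k' i) (gaussianPDF 0 v) n y = 1 := by
    rw [lintegral_finsetSum _ fun i _ => (hd4 i).const_mul _]
    rw [Finset.sum_congr rfl fun i _ => lintegral_const_mul (p i) (hd4 i)]
    simp only [i4, mul_one, hp]
  have s5 : ∫⁻ y, ∑ i, chainDensity (k' i) (α' i) n y * ENNReal.ofReal (Real.log v)
      = ENNReal.ofReal (Real.log v) := by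
    simp only [← Finset.sum_mul]
    rw [lintegral_mul_const _ (by fun_prop), s1, one_mul]
  have hent : Measurable fun y : Fin (n + 1) → ℝ => ∫⁻ y₀ : ℝ, eEntropy fun i =>
      chainDensity (k i) (α i) (n + 1) (Fin.cons y₀ y : Fin (n + 2) → ℝ) := by
    refine Measurable.lintegral_prod_right' (f := fun z : (Fin (n + 1) → ℝ) × ℝ =>
      eEntropy fun i => chainDensity (k i) (α i) (n + 1) (Fin.cons z.2 z.1 : Fin (n + 2) → ℝ)) ?_
    exact measurable_eEntropy fun i => (measurable_chainDensity (hk i) (hα i)).comp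
      (measurable_fin_cons.comp measurable_swap)
  have hent' := measurable_eEntropy hd
  rw [lintegral_add_left hent', lintegral_const_mul _ (by fun_prop), s1,
    lintegral_add_right _ (by fun_prop), s4, lintegral_add_right _ (by fun_prop), s1,
    lintegral_add_left hent, lintegral_add_left (by fun_prop), s5,
    lintegral_mul_const _ (by fun_prop), lintegral_add_left (by fun_prop),
    ← lintegral_fin_cons (F := fun y => eEntropy fun i => chainDensity (k i) (α i) (n + 1) y)
      (measurable_eEntropy fun i => measurable_chainDensity (hk i) (hα i))] at hint
  have h2v : ((v : ℝ≥0∞) + v) * (2 * v : ℝ≥0∞)⁻¹ = 1 := by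
    rw [← two_mul]
    exact ENNReal.mul_inv_cancel (by simp [hv0]) (by finiteness)
  -- All masses are one: the linear remainders on the right add up to 1 + 1 and cancel the doubled
  -- mass on the left.
  have hfin : chainEntropy k' α' n + 2 ≤ chainEntropy k α (n + 1)
      + (ENNReal.ofReal (Real.log v) + 1) + 2 := by
    have h23 := mul_le_mul' (add_le_add s2 s3) (le_refl (2 * v : ℝ≥0∞)⁻¹)
    rw [h2v] at h23
    rw [mul_one] at hint
    refine hint.trans ((add_le_add (add_le_add (add_le_add le_rfl (add_le_add le_rfl h23)) le_rfl)
      le_rfl).trans (le_of_eq ?_))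
    rw [add_assoc _ 1 1, one_add_one_eq_two]
    rfl
  exact (ENNReal.add_le_add_iff_right (by simp)).1 hfin

end ChainEntropy

section ChainEntropy

open scoped NNReal

variable {ι : Type*} [Fintype ι] {k : ι → ℕ → ℝ → ℝ → ℝ≥0∞} {n : ℕ}

/-- Discarding the first `d` outputs of a chain changes the entropy of the index by at most
`d * (log v + 1)`, where `v` bounds the second moments of the outputs. -/
lemma chainEntropy_shift {v : ℝ≥0} (hv : 1 ≤ v) {p : ι → ℝ≥0∞} {α : ℕ → ι → ℝ → ℝ≥0∞}
    (hk : ∀ i j, IsTransition gaussBound (k i j))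
    (hα : ∀ j i, Measurable (α j i)) (hαp : ∀ j i y, α j i y ≤ p i * gaussBound)
    (hα1 : ∀ j i, ∫⁻ y, α j i y = p i) (hp : ∑ i, p i = 1)
    (hm : ∀ j, ∑ i, ∫⁻ y, α j i y * ENNReal.ofReal (y ^ 2) ≤ v)
    (hstep : ∀ j i, α (j + 1) i = stepDensity (k i j) (α j i)) (d n : ℕ) :
    chainEntropy k (α 0) (n + d) ≤ chainEntropy (fun i j => k i (j + d)) (α d) n ∧
    chainEntropy (fun i j => k i (j + d)) (α d) n
      ≤ chainEntropy k (α 0) (n + d) + d * (ENNReal.ofReal (Real.log v) + 1) := by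
  have hpt : ∀ i, p i ≠ ∞ := fun i => ENNReal.sum_ne_top.1 (by rw [hp]; simp) i (Finset.mem_univ i)
  have hαt : ∀ j i y, α j i y ≠ ∞ := fun j i y =>
    ne_top_of_le_ne_top (ENNReal.mul_ne_top (hpt i) gaussBound_ne_top) (hαp j i y)
  induction d generalizing n with
  | zero => simp
  | succ d ih =>
    have hfun : (fun i => stepDensity (k i (0 + d)) (α d i)) = α (d + 1) := by
      funext i; rw [zero_add, hstep]
    have hk' : (fun i j => k i (j + 1 + d)) = fun i j => k i (j + (d + 1)) := by
      funext i j; congr 1; omega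
    -- The induction hypothesis is used for paths longer by one, and then the output at time d is
    -- discarded.
    have h1 := chainEntropy_succ_le (k := fun i j => k i (j + d)) (n := n) (fun i j => hk i _) (hα d)
      (hαt d) fun i => by rw [hα1]; exact hpt i
    have h2 := chainEntropy_step_le (k := fun i j => k i (j + d)) (n := n) hv (fun i j => hk i _)
      (hα d) (hαp d) (hα1 d) hp (hm d) (by
        simp only [fun i => congrFun hfun i]
        exact hm (d + 1))
    rw [hfun, hk'] at h1 h2
    obtain ⟨i1, i2⟩ := ih (n + 1)
    have e : n + 1 + d = n + (d + 1) := by omega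
    rw [e] at i1 i2
    refine ⟨i1.trans h1, h2.trans ?_⟩
    calc _ ≤ _ := add_le_add_left i2 _
      _ = _ := by push_cast; ring

/-- Continuity of the entropy of the index in the initial densities. -/
lemma chainEntropy_le_add {α α' : ι → ℝ → ℝ≥0∞} (hk : ∀ i j, IsTransition gaussBound (k i j))
    (hα : ∀ i, Measurable (α i)) (hα' : ∀ i, Measurable (α' i)) (hαt : ∀ i y, α i y ≠ ∞)
    (hαt' : ∀ i y, α' i y ≠ ∞) :
    chainEntropy k α n ≤ chainEntropy k α' n
      + (∑ i, ∫⁻ y, (α i y - α' i y)) * ENNReal.ofReal (Real.log (Fintype.card ι))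
      + (∑ i, ∫⁻ y, α i y) * ENNReal.ofReal (Real.log 2) := by
  have hd : ∀ i, Measurable (chainDensity (k i) (α i) n) := fun i =>
    measurable_chainDensity (hk i) (hα i)
  have hs : ∀ i, Measurable fun y => α i y - α' i y := fun i => (hα i).sub (hα' i)
  have hds : ∀ i, Measurable (chainDensity (k i) (fun y => α i y - α' i y) n) := fun i =>
    measurable_chainDensity (hk i) (hs i)
  have hE := measurable_eEntropy fun i => measurable_chainDensity (n := n) (hk i) (hα' i)
  have key : ∀ y : Fin (n + 1) → ℝ, eEntropy (fun i => chainDensity (k i) (α i) n y)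
      ≤ eEntropy (fun i => chainDensity (k i) (α' i) n y)
        + (∑ i, chainDensity (k i) (fun y => α i y - α' i y) n y)
          * ENNReal.ofReal (Real.log (Fintype.card ι))
        + (∑ i, chainDensity (k i) (α i) n y) * ENNReal.ofReal (Real.log 2) := by
    intro y
    have h := eEntropy_le_add (f := fun i => chainDensity (k i) (α i) n y)
      (g := fun i => chainDensity (k i) (α' i) n y)
      (fun i => chainDensity_ne_top gaussBound_ne_top (hk i) (hαt i) y)
      (fun i => chainDensity_ne_top gaussBound_ne_top (hk i) (hαt' i) y)
    refine h.trans (le_of_eq ?_)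
    congr 3
    refine Finset.sum_congr rfl fun i _ => ?_
    simp only [chainDensity]
    -- Both chains have the same transitions, so the excess of one path density over the other is
    -- itself a chain density, started from the excess of the initial densities. Its mass is
    -- therefore unchanged along the path.
    rw [ENNReal.sub_mul fun _ _ => chainTail_ne_top gaussBound_ne_top (hk i) y]
  refine (lintegral_mono (μ := (volume : Measure (Fin (n + 1) → ℝ))) key).trans (le_of_eq ?_)
  rw [lintegral_add_right _ (by fun_prop), lintegral_add_left hE, lintegral_mul_const _ (by fun_prop),
    lintegral_mul_const _ (by fun_prop), lintegral_finsetSum _ fun i _ => hds i,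
    lintegral_finsetSum _ fun i _ => hd i,
    Finset.sum_congr rfl fun i _ => lintegral_chainDensity (hk i) (hs i),
    Finset.sum_congr rfl fun i _ => lintegral_chainDensity (hk i) (hα i)]
  rfl

/-- If the initial density is the same for all indices up to the weights p i, the entropy is linear
in it by homogeneity. So, unlike in `chainEntropy_le_add`, no log 2 is lost. -/
lemma chainEntropy_common_le {a a' : ℝ → ℝ≥0∞} {p : ι → ℝ≥0∞} (hp : ∀ i, p i ≠ ∞)
    (hk : ∀ i j, IsTransition gaussBound (k i j))
    (ha : Measurable a) (ha' : Measurable a') (hat : ∀ y, a y ≠ ∞)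
    (hat' : ∀ y, a' y ≠ ∞) :
    chainEntropy k (fun i y => p i * a y) n ≤ chainEntropy k (fun i y => p i * a' y) n
      + (∑ i, p i) * (∫⁻ y, (a y - a' y)) * ENNReal.ofReal (Real.log (Fintype.card ι)) := by
  have hs : Measurable fun y => a y - a' y := ha.sub ha'
  have hds : ∀ i, Measurable (chainDensity (k i) (fun y => a y - a' y) n) := fun i =>
    measurable_chainDensity (hk i) hs
  have ht : ∀ y i, p i * chainTail (k i) n y ≠ ∞ := fun y i =>
    ENNReal.mul_ne_top (hp i) (chainTail_ne_top gaussBound_ne_top (hk i) y)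
  have e : ∀ (b : ℝ → ℝ≥0∞) (y : Fin (n + 1) → ℝ), b (y 0) ≠ ∞ →
      eEntropy (fun i => chainDensity (k i) (fun y => p i * b y) n y)
        = b (y 0) * eEntropy fun i => p i * chainTail (k i) n y := by
    intro b y hb
    rw [← eEntropy_mul hb]
    congr 1
    funext i
    rw [chainDensity]
    ring
  have hE := measurable_eEntropy fun i => measurable_chainDensity (n := n) (hk i) (ha'.const_mul (p i))
  have key : ∀ y : Fin (n + 1) → ℝ, eEntropy (fun i => chainDensity (k i) (fun y => p i * a y) n y)
      ≤ eEntropy (fun i => chainDensity (k i) (fun y => p i * a' y) n y)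
        + (∑ i, p i * chainDensity (k i) (fun y => a y - a' y) n y)
          * ENNReal.ofReal (Real.log (Fintype.card ι)) := by
    intro y
    rw [e a y (hat _), e a' y (hat' _)]
    calc a (y 0) * eEntropy (fun i => p i * chainTail (k i) n y)
        ≤ (a' (y 0) + (a (y 0) - a' (y 0))) * eEntropy (fun i => p i * chainTail (k i) n y) := by
          gcongr
          exact le_add_tsub
      _ ≤ a' (y 0) * eEntropy (fun i => p i * chainTail (k i) n y) + (a (y 0) - a' (y 0))
            * ((∑ i, p i * chainTail (k i) n y) * ENNReal.ofReal (Real.log (Fintype.card ι))) := by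
          rw [add_mul]
          gcongr
          exact eEntropy_le (ht y)
      _ = _ := by
          rw [← mul_assoc, Finset.mul_sum]
          congr 2
          refine Finset.sum_congr rfl fun i _ => ?_
          rw [chainDensity]
          ring
  refine (lintegral_mono (μ := (volume : Measure (Fin (n + 1) → ℝ))) key).trans (le_of_eq ?_)
  rw [lintegral_add_left hE, lintegral_mul_const _ (by fun_prop),
    lintegral_finsetSum _ fun i _ => (hds i).const_mul _,
    Finset.sum_congr rfl fun i _ => lintegral_const_mul _ (hds i),
    Finset.sum_congr rfl fun i _ => congrArg (p i * ·) (lintegral_chainDensity (hk i) hs),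
    ← Finset.sum_mul]
  rfl

/-- While the transitions do not depend on the index, the outputs can be discarded. -/
lemma chainEntropy_common_shift {p : ι → ℝ≥0∞} {a : ℕ → ℝ → ℝ≥0∞}
    (hk : ∀ i j, IsTransition gaussBound (k i j)) (ha : ∀ j, Measurable (a j))
    (hat : ∀ j y, a j y ≠ ∞) {d : ℕ} {κ : ℕ → ℝ → ℝ → ℝ≥0∞} (hκ : ∀ i, ∀ j < d, k i j = κ j)
    (hκt : ∀ j, IsTransition gaussBound (κ j))
    (hstep : ∀ j < d, a (j + 1) = stepDensity (κ j) (a j)) (n : ℕ) :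
    chainEntropy k (fun i y => p i * a 0 y) (n + d)
      = chainEntropy (fun i j => k i (j + d)) (fun i y => p i * a d y) n := by
  induction d generalizing n with
  | zero => simp
  | succ d ih =>
    have h := ih (fun i j hj => hκ i j (by omega)) (fun j hj => hstep j (by omega)) (n + 1)
    have e : n + 1 + d = n + (d + 1) := by omega
    rw [e] at h
    rw [h, chainEntropy, lintegral_fin_cons (measurable_eEntropy fun i =>
      measurable_chainDensity (fun j => hk i _) ((ha d).const_mul (p i)))]
    refine lintegral_congr fun y => ?_
    have hκm := (hκt d).measurable
    have had := ha d
    have hT : ∀ b : ℝ → ℝ≥0∞, ∀ i, chainDensity (fun j => k i (j + (d + 1))) (fun y => p i * b y) n y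
        = b (y 0) * (p i * chainTail (fun j => k i (j + (d + 1))) n y) := fun b i => by
      rw [chainDensity]; ring
    -- The part that involves y₀ does not depend on the index; it leaves the entropy as a factor,
    -- and its integral is the next density.
    have hC : ∀ (y₀ : ℝ) i, chainDensity (fun j => k i (j + d)) (fun y => p i * a d y) (n + 1)
        (Fin.cons y₀ y : Fin (n + 2) → ℝ)
        = a d y₀ * κ d y₀ (y 0) * (p i * chainTail (fun j => k i (j + (d + 1))) n y) := fun y₀ i => by
      rw [chainDensity, chainTail_cons, Fin.cons_zero, zero_add, hκ i d (by omega)]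
      have : (fun j => k i (j + 1 + d)) = fun j => k i (j + (d + 1)) := by
        funext j; congr 1; omega
      rw [this]
      ring
    have hf : ∀ y₀ : ℝ, a d y₀ * κ d y₀ (y 0) ≠ ∞ := fun y₀ =>
      ENNReal.mul_ne_top (hat _ _) (ne_top_of_le_ne_top gaussBound_ne_top ((hκt d).le _ _))
    simp only [hC, hT, eEntropy_mul (hat (d + 1) (y 0))]
    rw [lintegral_congr fun y₀ => eEntropy_mul (hf y₀) _, lintegral_mul_const _ (by fun_prop), hstep d (by omega)]
    rfl

end ChainEntropy

/-! ### Transition densities of the channel and the affine dependence on the start -/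

section Channel

/-- The mean of the next output, up to the noise `W`: `x`, `x'` are the two last inputs, `y` is the
last output and `z = (u, a, b, e)` are the other noise variables. -/
def shiftTerm (x x' y : ℝ) (z : ℝ × ℝ × ℝ × ℝ) : ℝ :=
  x' + z.1 + (z.2.1 * x + z.2.2.1 * (y - z.2.2.2))

/-- The transition density of the channel. -/
def chanDensity (ρ : Measure (ℝ × ℝ × ℝ × ℝ)) (x x' y y' : ℝ) : ℝ≥0∞ :=
  ∫⁻ z, gaussianPDF 0 1 (y' - shiftTerm x x' y z) ∂ρ

/-- The density of the first output, for the input `x`. -/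
def freshDensity (μ : Measure ℝ) (x y : ℝ) : ℝ≥0∞ := ∫⁻ u, gaussianPDF 0 1 (y - (x + u)) ∂μ

/-- The density of the output at time `j`, for the inputs `z` and the initial density `a`. -/
def evolve (ρ : Measure (ℝ × ℝ × ℝ × ℝ)) (z : ℕ → ℝ) (a : ℝ → ℝ≥0∞) : ℕ → ℝ → ℝ≥0∞
  | 0 => a
  | j + 1 => stepDensity (chanDensity ρ (z j) (z (j + 1))) (evolve ρ z a j)

/-- The density of `C + D * ξ + W`, where `θ` is the law of `(C, D)` and `W` is an independent
standard Gaussian. -/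
def affineDensity (θ : Measure (ℝ × ℝ)) (ξ y : ℝ) : ℝ≥0∞ :=
  ∫⁻ q, gaussianPDF 0 1 (y - q.1 - q.2 * ξ) ∂θ

/-- The law of the coefficients after one use of the channel. -/
def nextAffine (ρ : Measure (ℝ × ℝ × ℝ × ℝ)) (x x' : ℝ) (θ : Measure (ℝ × ℝ)) : Measure (ℝ × ℝ) :=
  (θ.prod ((gaussianReal 0 1).prod ρ)).map fun q =>
    (shiftTerm x x' (q.1.1 + q.2.1) q.2.2, q.2.2.2.2.1 * q.1.2)

@[fun_prop]
lemma Measurable.gaussianPDF_comp {α : Type*} [MeasurableSpace α] {f : α → ℝ} (hf : Measurable f) :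
    Measurable fun x => gaussianPDF 0 1 (f x) :=
  (measurable_gaussianPDF 0 1).comp hf

lemma gaussianPDF_le (y : ℝ) : gaussianPDF 0 1 y ≤ gaussBound := by
  refine ENNReal.ofReal_le_ofReal ?_
  rw [gaussianPDFReal]
  simp only [NNReal.coe_one, mul_one, sub_zero]
  refine mul_le_of_le_one_right (by positivity) (Real.exp_le_one_iff.2 ?_)
  have := sq_nonneg y
  linarith

lemma lintegral_gaussianPDF_sub (c : ℝ) : ∫⁻ y, gaussianPDF 0 1 (y - c) = 1 := by
  rw [lintegral_sub_right_eq_self (fun y => gaussianPDF 0 1 y), lintegral_gaussianPDF_eq_one 0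
    one_ne_zero]

lemma lintegral_gaussianReal_one {f : ℝ → ℝ≥0∞} (hf : Measurable f) :
    ∫⁻ w, f w ∂gaussianReal 0 1 = ∫⁻ w, gaussianPDF 0 1 w * f w := by
  rw [gaussianReal_of_var_ne_zero 0 one_ne_zero,
    lintegral_withDensity_eq_lintegral_mul _ (measurable_gaussianPDF 0 1) hf]
  rfl

@[fun_prop]
lemma Measurable.shiftTerm {α : Type*} {mα : MeasurableSpace α} {f g h : α → ℝ}
    {z : α → ℝ × ℝ × ℝ × ℝ} (hf : Measurable f) (hg : Measurable g) (hh : Measurable h)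
    (hz : Measurable z) : Measurable fun t => FlashChannel.shiftTerm (f t) (g t) (h t) (z t) := by
  unfold FlashChannel.shiftTerm
  fun_prop

variable {ρ : Measure (ℝ × ℝ × ℝ × ℝ)}

lemma evolve_add (z : ℕ → ℝ) (a : ℝ → ℝ≥0∞) (m j : ℕ) :
    evolve ρ z a (m + j) = evolve ρ (fun i => z (m + i)) (evolve ρ z a m) j := by
  induction j with
  | zero => rfl
  | succ j ih => rw [← add_assoc, evolve, ih]; rfl

lemma evolve_congr {z z' : ℕ → ℝ} (a : ℝ → ℝ≥0∞) {j : ℕ} (h : ∀ i ≤ j, z i = z' i) :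
    evolve ρ z a j = evolve ρ z' a j := by
  induction j with
  | zero => rfl
  | succ j ih => rw [evolve, evolve, ih fun i hi => h i (by omega), h j (by omega), h (j + 1) le_rfl]

variable [IsProbabilityMeasure ρ]

lemma measurable_chanDensity (x x' : ℝ) : Measurable (Function.uncurry (chanDensity ρ x x')) := by
  refine Measurable.lintegral_prod_right' (f := fun q : (ℝ × ℝ) × (ℝ × ℝ × ℝ × ℝ) =>
    gaussianPDF 0 1 (q.1.2 - shiftTerm x x' q.1.1 q.2)) ?_
  fun_prop

lemma isTransition_chanDensity (x x' : ℝ) : IsTransition gaussBound (chanDensity ρ x x') where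
  measurable := measurable_chanDensity x x'
  le y y' := by
    refine (lintegral_mono fun z => gaussianPDF_le _).trans ?_
    simp
  lintegral y := by
    unfold chanDensity
    rw [lintegral_lintegral_swap (by fun_prop)]
    simp [lintegral_gaussianPDF_sub]

lemma measurable_evolve {z : ℕ → ℝ} {a : ℝ → ℝ≥0∞} (ha : Measurable a) (j : ℕ) :
    Measurable (evolve ρ z a j) := by
  induction j with
  | zero => exact ha
  | succ j ih => exact measurable_stepDensity (isTransition_chanDensity _ _) ih

lemma lintegral_evolve {z : ℕ → ℝ} {a : ℝ → ℝ≥0∞} (ha : Measurable a) (j : ℕ) :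
    ∫⁻ y, evolve ρ z a j y = ∫⁻ y, a y := by
  induction j with
  | zero => rfl
  | succ j ih =>
    rw [evolve, lintegral_stepDensity (isTransition_chanDensity _ _) (measurable_evolve ha j), ih]

lemma evolve_le {z : ℕ → ℝ} {a : ℝ → ℝ≥0∞} (ha : Measurable a) (hab : ∀ y, a y ≤ gaussBound)
    (ha1 : ∫⁻ y, a y = 1) (j : ℕ) (y : ℝ) : evolve ρ z a j y ≤ gaussBound := by
  cases j with
  | zero => exact hab y
  | succ j =>
    have := stepDensity_le (isTransition_chanDensity (ρ := ρ) (z j) (z (j + 1)))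
      (measurable_evolve (ρ := ρ) (z := z) ha j) y
    rwa [lintegral_evolve ha, ha1, one_mul] at this

lemma stepDensity_lintegral {β : Type*} [MeasurableSpace β] {η : Measure β} [SFinite η]
    {k : ℝ → ℝ → ℝ≥0∞} {c : ℝ≥0∞} (hk : IsTransition c k)
    {F : β → ℝ → ℝ≥0∞} (hF : Measurable (Function.uncurry F)) (y' : ℝ) :
    stepDensity k (fun y => ∫⁻ ξ, F ξ y ∂η) y' = ∫⁻ ξ, stepDensity k (F ξ) y' ∂η := by
  have hkm := hk.measurable
  unfold stepDensity
  rw [lintegral_lintegral_swap]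
  · refine lintegral_congr fun y => ?_
    rw [lintegral_mul_const _ (by fun_prop)]
  · refine Measurable.aemeasurable ?_
    have h1 : Measurable fun q : β × ℝ => F q.1 q.2 := hF
    have h2 : Measurable fun q : β × ℝ => k q.2 y' := by fun_prop
    exact h1.mul h2

lemma measurable_uncurry_stepDensity {β : Type*} [MeasurableSpace β]
    {k : ℝ → ℝ → ℝ≥0∞} {c : ℝ≥0∞} (hk : IsTransition c k)
    {F : β → ℝ → ℝ≥0∞} (hF : Measurable (Function.uncurry F)) :
    Measurable (Function.uncurry fun ξ => stepDensity k (F ξ)) := by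
  have hkm := hk.measurable
  refine Measurable.lintegral_prod_right' (f := fun q : (β × ℝ) × ℝ => F q.1.1 q.2 * k q.2 q.1.2) ?_
  exact (hF.comp (f := fun q : (β × ℝ) × ℝ => (q.1.1, q.2)) (by fun_prop)).mul
    (hkm.comp (f := fun q : (β × ℝ) × ℝ => (q.2, q.1.2)) (by fun_prop))

lemma measurable_uncurry_evolve {β : Type*} [MeasurableSpace β] {z : ℕ → ℝ} {F : β → ℝ → ℝ≥0∞}
    (hF : Measurable (Function.uncurry F)) (j : ℕ) :
    Measurable (Function.uncurry fun ξ => evolve ρ z (F ξ) j) := by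
  induction j with
  | zero => exact hF
  | succ j ih => exact measurable_uncurry_stepDensity (isTransition_chanDensity _ _) ih

lemma evolve_lintegral {β : Type*} [MeasurableSpace β] {η : Measure β} [SFinite η] {z : ℕ → ℝ}
    {F : β → ℝ → ℝ≥0∞} (hF : Measurable (Function.uncurry F)) (j : ℕ) (y : ℝ) :
    evolve ρ z (fun y => ∫⁻ ξ, F ξ y ∂η) j y = ∫⁻ ξ, evolve ρ z (F ξ) j y ∂η := by
  induction j generalizing y with
  | zero => rfl
  | succ j ih =>
    rw [evolve, funext ih,
      stepDensity_lintegral (isTransition_chanDensity _ _) (measurable_uncurry_evolve hF j)]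
    rfl

lemma measurable_affineDensity (θ : Measure (ℝ × ℝ)) [SFinite θ] :
    Measurable (Function.uncurry (affineDensity θ)) := by
  refine Measurable.lintegral_prod_right' (f := fun q : (ℝ × ℝ) × (ℝ × ℝ) =>
    gaussianPDF 0 1 (q.1.2 - q.2.1 - q.2.2 * q.1.1)) ?_
  fun_prop

instance isProbabilityMeasure_nextAffine (x x' : ℝ) (θ : Measure (ℝ × ℝ)) [IsProbabilityMeasure θ] :
    IsProbabilityMeasure (nextAffine ρ x x' θ) :=
  Measure.isProbabilityMeasure_map (by fun_prop)

lemma lintegral_nextAffine (x x' : ℝ) (θ : Measure (ℝ × ℝ)) [IsProbabilityMeasure θ]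
    {f : ℝ × ℝ → ℝ≥0∞} (hf : Measurable f) :
    ∫⁻ q, f q ∂nextAffine ρ x x' θ = ∫⁻ q, ∫⁻ w, ∫⁻ t,
      f (shiftTerm x x' (q.1 + w) t, t.2.2.1 * q.2) ∂ρ ∂gaussianReal 0 1 ∂θ := by
  rw [nextAffine, lintegral_map hf (by fun_prop), lintegral_prod _ (by fun_prop)]
  refine lintegral_congr fun q => ?_
  rw [lintegral_prod _ (by fun_prop)]

/-- The recursion is affine in the previous output. From C + D ξ + W the old W moves into the
constant coefficient, D is multiplied by B, and a new W supplies the Gaussian. So the form persists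
with coefficients whose law does not involve ξ. -/
lemma stepDensity_affineDensity (x x' ξ : ℝ) (θ : Measure (ℝ × ℝ)) [IsProbabilityMeasure θ] :
    stepDensity (chanDensity ρ x x') (affineDensity θ ξ) = affineDensity (nextAffine ρ x x' θ) ξ := by
  funext y'
  have hk := measurable_chanDensity (ρ := ρ) x x'
  have hk' : Measurable fun y => chanDensity ρ x x' y y' := by fun_prop
  rw [affineDensity, lintegral_nextAffine _ _ _ (by fun_prop)]
  unfold stepDensity affineDensity
  have e1 : ∀ y, (∫⁻ q, gaussianPDF 0 1 (y - q.1 - q.2 * ξ) ∂θ) * chanDensity ρ x x' y y'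
      = ∫⁻ q, gaussianPDF 0 1 (y - q.1 - q.2 * ξ) * chanDensity ρ x x' y y' ∂θ := fun y => by
    rw [lintegral_mul_const _ (by fun_prop)]
  simp only [e1]
  rw [lintegral_lintegral_swap (by fun_prop)]
  refine lintegral_congr fun q => ?_
  have e2 : ∀ y, gaussianPDF 0 1 (y - q.1 - q.2 * ξ) * chanDensity ρ x x' y y'
      = (fun w => gaussianPDF 0 1 w * chanDensity ρ x x' (w + (q.1 + q.2 * ξ)) y')
        (y - (q.1 + q.2 * ξ)) := fun y => by
    simp only [sub_add_cancel, sub_sub]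
  simp only [e2]
  rw [lintegral_sub_right_eq_self (fun w => gaussianPDF 0 1 w
    * chanDensity ρ x x' (w + (q.1 + q.2 * ξ)) y'), ← lintegral_gaussianReal_one (by fun_prop)]
  refine lintegral_congr fun w => lintegral_congr fun t => ?_
  congr 1
  simp only [shiftTerm]
  ring

/-- The coefficients of the affine dependence of the output at time `j` on a perturbation of the
first output. -/
def affineLaw (ρ : Measure (ℝ × ℝ × ℝ × ℝ)) (z : ℕ → ℝ) (θ : Measure (ℝ × ℝ)) :
    ℕ → Measure (ℝ × ℝ)
  | 0 => θ
  | j + 1 => nextAffine ρ (z j) (z (j + 1)) (affineLaw ρ z θ j)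

instance isProbabilityMeasure_affineLaw (z : ℕ → ℝ) (θ : Measure (ℝ × ℝ)) [IsProbabilityMeasure θ]
    (j : ℕ) : IsProbabilityMeasure (affineLaw ρ z θ j) := by
  induction j with
  | zero => assumption
  | succ j ih => exact isProbabilityMeasure_nextAffine _ _ _

lemma evolve_affineDensity (z : ℕ → ℝ) (θ : Measure (ℝ × ℝ)) [IsProbabilityMeasure θ] (ξ : ℝ)
    (j : ℕ) : evolve ρ z (affineDensity θ ξ) j = affineDensity (affineLaw ρ z θ j) ξ := by
  induction j with
  | zero => rfl
  | succ j ih => rw [evolve, ih, stepDensity_affineDensity]; rfl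

/-- Each use of the channel multiplies D by a B independent of it, so the second moments multiply.
-/
lemma lintegral_sq_affineLaw (z : ℕ → ℝ) (θ : Measure (ℝ × ℝ)) [IsProbabilityMeasure θ] (j : ℕ) :
    ∫⁻ q, ENNReal.ofReal (q.2 ^ 2) ∂affineLaw ρ z θ j
      = (∫⁻ t, ENNReal.ofReal (t.2.2.1 ^ 2) ∂ρ) ^ j * ∫⁻ q, ENNReal.ofReal (q.2 ^ 2) ∂θ := by
  induction j with
  | zero => simp [affineLaw]
  | succ j ih =>
    rw [affineLaw, lintegral_nextAffine _ _ _ (by fun_prop)]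
    have e : ∀ q : ℝ × ℝ, ∀ t : ℝ × ℝ × ℝ × ℝ, ENNReal.ofReal ((t.2.2.1 * q.2) ^ 2)
        = ENNReal.ofReal (t.2.2.1 ^ 2) * ENNReal.ofReal (q.2 ^ 2) := fun q t => by
      rw [mul_pow, ENNReal.ofReal_mul (sq_nonneg _)]
    simp only [e]
    have e2 : ∀ q : ℝ × ℝ, ∫⁻ _w, ∫⁻ t, ENNReal.ofReal (t.2.2.1 ^ 2) * ENNReal.ofReal (q.2 ^ 2) ∂ρ
        ∂gaussianReal 0 1 = (∫⁻ t, ENNReal.ofReal (t.2.2.1 ^ 2) ∂ρ) * ENNReal.ofReal (q.2 ^ 2) :=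
      fun q => by rw [lintegral_mul_const _ (by fun_prop)]; simp
    simp only [e2]
    rw [lintegral_const_mul _ (by fun_prop), ih]
    ring

/-- The shifted densities are φ(y) exp(± y δ − δ² / 2). By exp t ≥ 1 + t the first-order terms ± y δ
cancel in the sum and only δ² is lost. -/
lemma gaussianPDF_le_symm_add (y δ : ℝ) :
    2 * gaussianPDF 0 1 y ≤ gaussianPDF 0 1 (y - δ) + gaussianPDF 0 1 (y + δ)
      + gaussianPDF 0 1 y * ENNReal.ofReal (δ ^ 2) := by
  have key : 2 * gaussianPDFReal 0 1 y ≤ gaussianPDFReal 0 1 (y - δ) + gaussianPDFReal 0 1 (y + δ)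
      + gaussianPDFReal 0 1 y * δ ^ 2 := by
    have h1 : gaussianPDFReal 0 1 (y - δ) = gaussianPDFReal 0 1 y * Real.exp (y * δ - δ ^ 2 / 2) := by
      simp only [gaussianPDFReal, mul_assoc, ← Real.exp_add]
      congr 2
      simp
      ring
    have h2 : gaussianPDFReal 0 1 (y + δ)
        = gaussianPDFReal 0 1 y * Real.exp (-(y * δ) - δ ^ 2 / 2) := by
      simp only [gaussianPDFReal, mul_assoc, ← Real.exp_add]
      congr 2
      simp
      ring
    rw [h1, h2]
    have h3 := Real.add_one_le_exp (y * δ - δ ^ 2 / 2)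
    have h4 := Real.add_one_le_exp (-(y * δ) - δ ^ 2 / 2)
    nlinarith [gaussianPDFReal_nonneg 0 1 y]
  have p : ∀ y, 0 ≤ gaussianPDFReal 0 1 y := gaussianPDFReal_nonneg 0 1
  simp only [gaussianPDF]
  rw [← ENNReal.ofReal_mul (p y), ← ENNReal.ofReal_add (p _) (p _),
    ← ENNReal.ofReal_add (add_nonneg (p _) (p _)) (mul_nonneg (p _) (sq_nonneg _)),
    show (2 : ℝ≥0∞) = ENNReal.ofReal 2 by simp, ← ENNReal.ofReal_mul zero_le_two]
  exact ENNReal.ofReal_le_ofReal key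

/-- Convolution with a symmetric law changes a Gaussian density by a quadratic term only. -/
lemma gaussianPDF_le_lintegral (η : Measure ℝ) [IsProbabilityMeasure η]
    (hη : η.map (fun ξ => -ξ) = η) (y D : ℝ) :
    2 * gaussianPDF 0 1 y ≤ 2 * ∫⁻ ξ, gaussianPDF 0 1 (y - D * ξ) ∂η
      + gaussianPDF 0 1 y * (ENNReal.ofReal (D ^ 2) * ∫⁻ ξ, ENNReal.ofReal (ξ ^ 2) ∂η) := by
  have h1 : ∫⁻ ξ, gaussianPDF 0 1 (y + D * ξ) ∂η = ∫⁻ ξ, gaussianPDF 0 1 (y - D * ξ) ∂η := by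
    conv_lhs => rw [← hη]
    rw [lintegral_map (by fun_prop) (by fun_prop)]
    simp [sub_eq_add_neg]
  have h2 : ∫⁻ _ξ, 2 * gaussianPDF 0 1 y ∂η ≤ ∫⁻ ξ, (gaussianPDF 0 1 (y - D * ξ)
      + gaussianPDF 0 1 (y + D * ξ) + gaussianPDF 0 1 y * ENNReal.ofReal ((D * ξ) ^ 2)) ∂η :=
    lintegral_mono fun ξ => gaussianPDF_le_symm_add y (D * ξ)
  simp only [mul_pow, ENNReal.ofReal_mul (sq_nonneg D)] at h2
  rw [lintegral_const, measure_univ, mul_one, lintegral_add_left (by fun_prop),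
    lintegral_add_left (by fun_prop), h1, lintegral_const_mul _ (by fun_prop),
    lintegral_const_mul _ (by fun_prop), ← two_mul] at h2
  exact h2

end Channel

/-! ### Exponential loss of memory -/

section Contraction

/-- The joint law of the noise variables `A`, `B`, `E`. -/
def coeffLaw (σA σB σE : ℝ) : Measure (ℝ × ℝ × ℝ) :=
  (gaussianReal 0 (σA ^ 2).toNNReal).prod
    ((gaussianReal 0 (σB ^ 2).toNNReal).prod (gaussianReal 0 (σE ^ 2).toNNReal))

instance (σA σB σE : ℝ) : IsProbabilityMeasure (coeffLaw σA σB σE) := by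
  unfold coeffLaw; infer_instance

lemma lintegral_sq_gaussianReal (σ : ℝ) :
    ∫⁻ x, ENNReal.ofReal (x ^ 2) ∂gaussianReal 0 (σ ^ 2).toNNReal = ENNReal.ofReal (σ ^ 2) := by
  have h1 : MemLp id 2 (gaussianReal 0 (σ ^ 2).toNNReal) := memLp_id_gaussianReal 2
  have h2 := variance_of_integral_eq_zero (μ := gaussianReal 0 (σ ^ 2).toNNReal) (X := fun x => x)
    aemeasurable_id integral_id_gaussianReal
  rw [variance_fun_id_gaussianReal] at h2
  have h3 : Integrable (fun x : ℝ => x ^ 2) (gaussianReal 0 (σ ^ 2).toNNReal) := h1.integrable_sq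
  rw [← ofReal_integral_eq_lintegral_ofReal h3 (Filter.Eventually.of_forall fun x => sq_nonneg x)]
  exact congrArg ENNReal.ofReal (h2.symm.trans (Real.coe_toNNReal _ (sq_nonneg σ)))

variable {σA σB σE : ℝ}

lemma lintegral_coeffLaw_b :
    ∫⁻ t, ENNReal.ofReal (t.2.1 ^ 2) ∂coeffLaw σA σB σE = ENNReal.ofReal (σB ^ 2) := by
  rw [coeffLaw, lintegral_prod _ (by fun_prop)]
  simp only [lintegral_const, measure_univ, mul_one]
  rw [lintegral_prod _ (by fun_prop)]
  simp [lintegral_sq_gaussianReal]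

lemma ofReal_add_sq_le (p q : ℝ) :
    ENNReal.ofReal ((p + q) ^ 2) ≤ 2 * ENNReal.ofReal (p ^ 2) + 2 * ENNReal.ofReal (q ^ 2) := by
  rw [show (2 : ℝ≥0∞) = ENNReal.ofReal 2 by simp, ← ENNReal.ofReal_mul zero_le_two,
    ← ENNReal.ofReal_mul zero_le_two, ← ENNReal.ofReal_add (by positivity) (by positivity)]
  exact ENNReal.ofReal_le_ofReal (by nlinarith [sq_nonneg (p - q)])

/-- Second moment of the perturbation ξ caused by the state. The outer factor 2 from (p + q)² ≤ 2p²
+ 2q² is kept apart, since it cancels against the factor 2 in `gaussianPDF_le_lintegral`. -/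
lemma lintegral_sq_coeffLaw_le (x y : ℝ) :
    ∫⁻ t, ENNReal.ofReal ((t.1 * x + t.2.1 * (y - t.2.2)) ^ 2) ∂coeffLaw σA σB σE
      ≤ 2 * ENNReal.ofReal (σA ^ 2 * x ^ 2 + 2 * σB ^ 2 * (y ^ 2 + σE ^ 2)) := by
  have h1 : ∫⁻ t, ENNReal.ofReal ((t.1 * x) ^ 2) ∂coeffLaw σA σB σE
      = ENNReal.ofReal (σA ^ 2 * x ^ 2) := by
    rw [coeffLaw, lintegral_prod _ (by fun_prop)]
    simp only [lintegral_const, measure_univ, mul_one, mul_pow, ENNReal.ofReal_mul (sq_nonneg _)]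
    rw [lintegral_mul_const _ (by fun_prop), lintegral_sq_gaussianReal]
  have h3 : ∫⁻ e, ENNReal.ofReal ((y - e) ^ 2) ∂gaussianReal 0 (σE ^ 2).toNNReal
      ≤ ENNReal.ofReal (2 * (y ^ 2 + σE ^ 2)) := by
    calc _ ≤ ∫⁻ e, (2 * ENNReal.ofReal (y ^ 2) + 2 * ENNReal.ofReal (e ^ 2))
          ∂gaussianReal 0 (σE ^ 2).toNNReal := lintegral_mono fun e => by
            have := ofReal_add_sq_le y (-e)
            rwa [neg_sq, ← sub_eq_add_neg] at this
      _ = _ := by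
        rw [lintegral_add_left (by fun_prop), lintegral_const, measure_univ, mul_one,
          lintegral_const_mul _ (by fun_prop), lintegral_sq_gaussianReal,
          ENNReal.ofReal_mul zero_le_two, ENNReal.ofReal_add (by positivity) (by positivity)]
        simp [mul_add]
  have h2 : ∫⁻ t, ENNReal.ofReal ((t.2.1 * (y - t.2.2)) ^ 2) ∂coeffLaw σA σB σE
      ≤ ENNReal.ofReal (2 * σB ^ 2 * (y ^ 2 + σE ^ 2)) := by
    rw [coeffLaw, lintegral_prod _ (by fun_prop)]
    simp only [lintegral_const, measure_univ, mul_one, mul_pow, ENNReal.ofReal_mul (sq_nonneg _)]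
    rw [lintegral_prod_mul (f := fun b : ℝ => ENNReal.ofReal (b ^ 2))
      (g := fun e : ℝ => ENNReal.ofReal ((y - e) ^ 2)) (by fun_prop) (by fun_prop),
      lintegral_sq_gaussianReal]
    calc _ ≤ _ := mul_le_mul' le_rfl h3
      _ = _ := by rw [← ENNReal.ofReal_mul (sq_nonneg _)]; congr 1; ring
  calc _ ≤ ∫⁻ t, (2 * ENNReal.ofReal ((t.1 * x) ^ 2)
        + 2 * ENNReal.ofReal ((t.2.1 * (y - t.2.2)) ^ 2)) ∂coeffLaw σA σB σE :=
        lintegral_mono fun t => ofReal_add_sq_le _ _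
    _ ≤ _ := by
      rw [lintegral_add_left (by fun_prop), lintegral_const_mul _ (by fun_prop),
        lintegral_const_mul _ (by fun_prop), h1, ENNReal.ofReal_add (by positivity) (by positivity),
        mul_add]
      gcongr

/-- Changing the signs of A and B together, with E fixed, changes the sign of A x + B (y − E); hence
the perturbation is symmetric although y − E is not. -/
lemma coeffLaw_map_neg :
    (coeffLaw σA σB σE).map (fun t => (-t.1, -t.2.1, t.2.2)) = coeffLaw σA σB σE := by
  have h := Measure.map_prod_map (gaussianReal 0 (σA ^ 2).toNNReal)
    ((gaussianReal 0 (σB ^ 2).toNNReal).prod (gaussianReal 0 (σE ^ 2).toNNReal))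
    (f := fun x : ℝ => -x) (g := Prod.map (fun x : ℝ => -x) id) (by fun_prop) (by fun_prop)
  rw [← Measure.map_prod_map _ _ (by fun_prop) (by fun_prop), gaussianReal_map_neg,
    gaussianReal_map_neg, Measure.map_id, neg_zero] at h
  exact h.symm

variable (μ : Measure ℝ) [IsProbabilityMeasure μ]

lemma measurable_freshDensity (x : ℝ) : Measurable (freshDensity μ x) := by
  refine Measurable.lintegral_prod_right' (f := fun q : ℝ × ℝ => gaussianPDF 0 1 (q.1 - (x + q.2))) ?_
  fun_prop

lemma freshDensity_le (x y : ℝ) : freshDensity μ x y ≤ gaussBound :=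
  (lintegral_mono fun u => gaussianPDF_le _).trans (by simp)

lemma lintegral_freshDensity (x : ℝ) : ∫⁻ y, freshDensity μ x y = 1 := by
  unfold freshDensity
  rw [lintegral_lintegral_swap (by fun_prop)]
  simp [lintegral_gaussianPDF_sub]

/-- The influence of the state `(x, y₀)` on the output after `k` steps decays like `σB ^ (2 * k)`. -/
theorem lintegral_evolve_sub_le (x y₀ : ℝ) (z : ℕ → ℝ) (k : ℕ) :
    ∫⁻ y, (evolve (μ.prod (coeffLaw σA σB σE)) z (freshDensity μ (z 0)) k y
        - evolve (μ.prod (coeffLaw σA σB σE)) z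
            (chanDensity (μ.prod (coeffLaw σA σB σE)) x (z 0) y₀) k y)
      ≤ ENNReal.ofReal ((σA ^ 2 * x ^ 2 + 2 * σB ^ 2 * (y₀ ^ 2 + σE ^ 2)) * σB ^ (2 * k)) := by
  set ρ := μ.prod (coeffLaw σA σB σE) with hρ
  set S := σA ^ 2 * x ^ 2 + 2 * σB ^ 2 * (y₀ ^ 2 + σE ^ 2) with hS
  have hS0 : 0 ≤ S := by positivity
  -- The first output is (z 0 + U) + 1 · ξ + W. A fresh start is ξ = 0; a start from the state
  -- averages over ξ of law η.
  set θ : Measure (ℝ × ℝ) := μ.map fun u => (z 0 + u, 1) with hθ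
  have : IsProbabilityMeasure θ := Measure.isProbabilityMeasure_map (by fun_prop)
  set η : Measure ℝ := (coeffLaw σA σB σE).map fun t => t.1 * x + t.2.1 * (y₀ - t.2.2) with hη
  have : IsProbabilityMeasure η := Measure.isProbabilityMeasure_map (by fun_prop)
  have hηs : η.map (fun ξ => -ξ) = η := by
    rw [hη, Measure.map_map (by fun_prop) (by fun_prop)]
    conv_rhs => rw [← coeffLaw_map_neg, Measure.map_map (by fun_prop) (by fun_prop)]
    congr 1
    funext t
    simp only [Function.comp]
    ring
  have hη2 : ∫⁻ ξ, ENNReal.ofReal (ξ ^ 2) ∂η ≤ 2 * ENNReal.ofReal S := by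
    rw [hη, lintegral_map (by fun_prop) (by fun_prop)]
    exact lintegral_sq_coeffLaw_le x y₀
  have hfresh : freshDensity μ (z 0) = affineDensity θ 0 := by
    funext y
    rw [affineDensity, hθ, lintegral_map (by fun_prop) (by fun_prop), freshDensity]
    refine lintegral_congr fun u => ?_
    congr 1
    ring
  have hstate : chanDensity ρ x (z 0) y₀ = fun y => ∫⁻ ξ, affineDensity θ ξ y ∂η := by
    funext y
    have hm : Measurable fun ξ => affineDensity θ ξ y :=
      (measurable_affineDensity θ).comp (f := fun ξ => (ξ, y)) (by fun_prop)
    rw [hη, lintegral_map hm (by fun_prop), chanDensity, hρ, lintegral_prod_symm _ (by fun_prop)]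
    refine lintegral_congr fun t => ?_
    rw [affineDensity, hθ, lintegral_map (by fun_prop) (by fun_prop)]
    refine lintegral_congr fun u => ?_
    congr 1
    simp only [shiftTerm]
    ring
  have hk := fun ξ => evolve_affineDensity (ρ := ρ) z θ ξ k
  set τ := affineLaw ρ z θ k with hτ
  have hτp : IsProbabilityMeasure τ := isProbabilityMeasure_affineLaw z θ k
  have hb : ∫⁻ q, ENNReal.ofReal (q.2 ^ 2) ∂τ = ENNReal.ofReal (σB ^ (2 * k)) := by
    have h1 : ∫⁻ q, ENNReal.ofReal (q.2 ^ 2) ∂θ = 1 := by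
      rw [hθ, lintegral_map (by fun_prop) (by fun_prop)]; simp
    have h2 : ∫⁻ t, ENNReal.ofReal (t.2.2.1 ^ 2) ∂ρ = ENNReal.ofReal (σB ^ 2) := by
      rw [hρ, lintegral_prod _ (by fun_prop)]; simp [lintegral_coeffLaw_b]
    rw [hτ, lintegral_sq_affineLaw, h1, h2, mul_one, ← ENNReal.ofReal_pow (sq_nonneg _), pow_mul]
  have hpt : ∀ y, evolve ρ z (freshDensity μ (z 0)) k y - evolve ρ z (chanDensity ρ x (z 0) y₀) k y
      ≤ ENNReal.ofReal S * ∫⁻ q, gaussianPDF 0 1 (y - q.1) * ENNReal.ofReal (q.2 ^ 2) ∂τ := by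
    intro y
    rw [tsub_le_iff_left, hfresh, hstate, evolve_lintegral (measurable_affineDensity θ)]
    simp only [hk]
    -- For fixed coefficients (C, D) the comparison is between a Gaussian and its convolution with
    -- the symmetric law of D ξ.
    unfold affineDensity
    rw [lintegral_lintegral_swap (by fun_prop)]
    have key : ∫⁻ q, 2 * gaussianPDF 0 1 (y - q.1) ∂τ
        ≤ ∫⁻ q, (2 * ∫⁻ ξ, gaussianPDF 0 1 (y - q.1 - q.2 * ξ) ∂η
          + 2 * ENNReal.ofReal S
            * (gaussianPDF 0 1 (y - q.1) * ENNReal.ofReal (q.2 ^ 2))) ∂τ := by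
      refine lintegral_mono fun q => (gaussianPDF_le_lintegral η hηs (y - q.1) q.2).trans ?_
      refine add_le_add le_rfl ?_
      calc _ ≤ gaussianPDF 0 1 (y - q.1) * (ENNReal.ofReal (q.2 ^ 2) * (2 * ENNReal.ofReal S)) := by
            gcongr
        _ = _ := by ring
    rw [lintegral_const_mul _ (by fun_prop), lintegral_add_right _ (by fun_prop),
      lintegral_const_mul _ (by fun_prop), lintegral_const_mul _ (by fun_prop), mul_assoc,
      ← mul_add, ENNReal.mul_le_mul_iff_right (by simp) (by simp)] at key
    simpa using key
  refine (lintegral_mono hpt).trans (le_of_eq ?_)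
  rw [lintegral_const_mul _ (by fun_prop), lintegral_lintegral_swap (by fun_prop)]
  have : ∀ q : ℝ × ℝ, ∫⁻ y, gaussianPDF 0 1 (y - q.1) * ENNReal.ofReal (q.2 ^ 2)
      = ENNReal.ofReal (q.2 ^ 2) := fun q => by
    rw [lintegral_mul_const _ (by fun_prop), lintegral_gaussianPDF_sub, one_mul]
  simp only [this, hb]
  rw [← ENNReal.ofReal_mul hS0]

/-- Both sides are half the L¹ distance, since the masses agree. A one-sided estimate thus serves in
both directions. -/
lemma lintegral_tsub_comm {β : Type*} [MeasurableSpace β] {l : Measure β} {f g : β → ℝ≥0∞}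
    (hf : Measurable f) (hg : Measurable g) (h : ∫⁻ y, f y ∂l = ∫⁻ y, g y ∂l)
    (hft : ∫⁻ y, f y ∂l ≠ ∞) : ∫⁻ y, (f y - g y) ∂l = ∫⁻ y, (g y - f y) ∂l := by
  have h1 : ∀ y, f y + (g y - f y) = g y + (f y - g y) := fun y => by
    rw [add_tsub_eq_max, add_tsub_eq_max, max_comm]
  have h2 := lintegral_congr (μ := l) h1
  rw [lintegral_add_left hf, lintegral_add_left hg, h,
    ENNReal.add_right_inj (by rwa [← h])] at h2
  exact h2.symm

end Contraction

/-! ### Independence of the noise and the law of the outputs for fixed inputs -/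

section NoiseLaw

variable {Ω : Type*} [mΩ : MeasurableSpace Ω] {P : Measure Ω} [IsProbabilityMeasure P]
  {σA σB σE α₁ α₂ : ℝ} {N : Noise Ω}

/-- The five noise processes as a single family. -/
def Noise.family (N : Noise Ω) (p : Fin 5 × ℕ) : Ω → ℝ := ![N.A, N.B, N.E, N.W, N.U] p.1 p.2

/-- The σ-algebra generated by a set of noise variables. -/
@[reducible]
def Noise.sigma (N : Noise Ω) (S : Set (Fin 5 × ℕ)) : MeasurableSpace Ω :=
  ⨆ p ∈ S, MeasurableSpace.comap (N.family p) inferInstance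

/-- The noise variables that influence the output up to time `t`. -/
def pastNoise (t : ℕ) : Set (Fin 5 × ℕ) := {p | if p.1 = 2 then p.2 < t else p.2 ≤ t}

/-- The noise variables `U`, `A`, `B`, `E` in the passage from time `t` to time `t + 1`. -/
def Noise.newNoise (N : Noise Ω) (t : ℕ) (ω : Ω) : ℝ × ℝ × ℝ × ℝ :=
  (N.U (t + 1) ω, N.A (t + 1) ω, N.B (t + 1) ω, N.E t ω)

omit mΩ in
lemma Noise.sigma_mono (N : Noise Ω) {S T : Set (Fin 5 × ℕ)} (h : S ⊆ T) : N.sigma S ≤ N.sigma T :=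
  biSup_mono h

omit mΩ in
lemma pastNoise_mono {s t : ℕ} (h : s ≤ t) : pastNoise s ⊆ pastNoise t := by
  intro p hp
  simp only [pastNoise, Set.mem_ofPred_eq] at *
  split_ifs at * <;> omega

omit mΩ in
lemma Noise.measurable_family (N : Noise Ω) {S : Set (Fin 5 × ℕ)} {p : Fin 5 × ℕ} (hp : p ∈ S) :
    Measurable[N.sigma S] (N.family p) :=
  measurable_iff_comap_le.2 (le_iSup₂ (f := fun p (_ : p ∈ S) =>
    MeasurableSpace.comap (N.family p) inferInstance) p hp)

omit [IsProbabilityMeasure P] in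
lemma Noise.IsChannelNoise.measurable_family (hN : N.IsChannelNoise P σA σB σE α₁ α₂)
    (p : Fin 5 × ℕ) : Measurable (N.family p) := by
  obtain ⟨j, i⟩ := p
  fin_cases j
  exacts [hN.measurable_A i, hN.measurable_B i, hN.measurable_E i, hN.measurable_W i,
    hN.measurable_U i]

omit [IsProbabilityMeasure P] in
lemma Noise.IsChannelNoise.sigma_le (hN : N.IsChannelNoise P σA σB σE α₁ α₂)
    (S : Set (Fin 5 × ℕ)) : N.sigma S ≤ mΩ :=
  iSup₂_le fun p _ => (hN.measurable_family p).comap_le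

omit [IsProbabilityMeasure P] in
lemma Noise.IsChannelNoise.iIndepFun_family (hN : N.IsChannelNoise P σA σB σE α₁ α₂) :
    iIndepFun N.family P := by
  refine iIndepFun_uncurry' (X := fun (j : Fin 5) (i : ℕ) => ![N.A, N.B, N.E, N.W, N.U] j i)
    (fun j i => hN.measurable_family (j, i)) hN.indep fun j => ?_
  fin_cases j
  exacts [hN.indep_A, hN.indep_B, hN.indep_E, hN.indep_W, hN.indep_U]

omit [IsProbabilityMeasure P] in
lemma Noise.IsChannelNoise.indepFun (hN : N.IsChannelNoise P σA σB σE α₁ α₂)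
    {S T : Set (Fin 5 × ℕ)} (hST : Disjoint S T) {β γ : Type*} [MeasurableSpace β]
    [MeasurableSpace γ] {f : Ω → β} {g : Ω → γ} (hf : Measurable[N.sigma S] f)
    (hg : Measurable[N.sigma T] g) : IndepFun f g P := by
  have h := indep_iSup_of_disjoint (fun p => (hN.measurable_family p).comap_le)
    hN.iIndepFun_family.iIndep hST
  rw [IndepFun_iff_Indep]
  exact indep_of_indep_of_le_left (indep_of_indep_of_le_right h hg.comap_le) hf.comap_le

/-- The law of `(U, A, B, E)`. -/
def Noise.newLaw (N : Noise Ω) (P : Measure Ω) (σA σB σE : ℝ) : Measure (ℝ × ℝ × ℝ × ℝ) :=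
  (P.map (N.U 0)).prod (coeffLaw σA σB σE)

lemma Noise.IsChannelNoise.isProbabilityMeasure_map_U (hN : N.IsChannelNoise P σA σB σE α₁ α₂) :
    IsProbabilityMeasure (P.map (N.U 0)) :=
  Measure.isProbabilityMeasure_map (hN.measurable_U 0).aemeasurable

lemma Noise.IsChannelNoise.isProbabilityMeasure_newLaw
    (hN : N.IsChannelNoise P σA σB σE α₁ α₂) : IsProbabilityMeasure (N.newLaw P σA σB σE) := by
  have := hN.isProbabilityMeasure_map_U
  unfold Noise.newLaw
  infer_instance

omit [IsProbabilityMeasure P] in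
lemma Noise.IsChannelNoise.map_U (hN : N.IsChannelNoise P σA σB σE α₁ α₂) (i : ℕ) :
    P.map (N.U i) = P.map (N.U 0) :=
  (hN.law_U i).trans (hN.law_U 0).symm

/-- The variables E, B, A, U, W of one step and the past are generated by disjoint sets of noise
indices. Adding them one at a time turns independence into a product law. -/
lemma Noise.IsChannelNoise.map_newNoise (hN : N.IsChannelNoise P σA σB σE α₁ α₂) (t : ℕ)
    {β : Type*} [MeasurableSpace β] {V : Ω → β} (hV : Measurable[N.sigma (pastNoise t)] V) :
    P.map (fun ω => (V ω, N.newNoise t ω, N.W (t + 1) ω))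
      = (P.map V).prod ((N.newLaw P σA σB σE).prod (gaussianReal 0 1)) := by
  have hV' := hV.mono (hN.sigma_le _) le_rfl
  have mA := hN.measurable_A (t + 1)
  have mB := hN.measurable_B (t + 1)
  have mE := hN.measurable_E t
  have mW := hN.measurable_W (t + 1)
  have mU := hN.measurable_U (t + 1)
  have mem : ∀ (S : Set (Fin 5 × ℕ)) (p : Fin 5 × ℕ), p ∈ S → Measurable[N.sigma S] (N.family p) :=
    fun S p hp => N.measurable_family hp
  set S₁ : Set (Fin 5 × ℕ) := {((2 : Fin 5), t)} with hS₁
  set S₂ : Set (Fin 5 × ℕ) := insert ((1 : Fin 5), t + 1) S₁ with hS₂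
  set S₃ : Set (Fin 5 × ℕ) := insert ((0 : Fin 5), t + 1) S₂ with hS₃
  set S₄ : Set (Fin 5 × ℕ) := insert ((4 : Fin 5), t + 1) S₃ with hS₄
  set S₅ : Set (Fin 5 × ℕ) := insert ((3 : Fin 5), t + 1) S₄ with hS₅
  have gE : Measurable[N.sigma S₁] (N.E t) := mem S₁ (2, t) (by simp [hS₁])
  have gBE : Measurable[N.sigma S₂] fun ω => (N.B (t + 1) ω, N.E t ω) :=
    Measurable.prodMk (mem S₂ (1, t + 1) (by simp [hS₂])) (mem S₂ (2, t) (by simp [hS₁, hS₂]))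
  have gABE : Measurable[N.sigma S₃] fun ω => (N.A (t + 1) ω, N.B (t + 1) ω, N.E t ω) :=
    Measurable.prodMk (mem S₃ (0, t + 1) (by simp [hS₃]))
      (gBE.mono (N.sigma_mono (Set.subset_insert _ _)) le_rfl)
  have gZ : Measurable[N.sigma S₄] (N.newNoise t) :=
    Measurable.prodMk (mem S₄ (4, t + 1) (by simp [hS₄]))
      (gABE.mono (N.sigma_mono (Set.subset_insert _ _)) le_rfl)
  have gZW : Measurable[N.sigma S₅] fun ω => (N.newNoise t ω, N.W (t + 1) ω) :=
    Measurable.prodMk (gZ.mono (N.sigma_mono (Set.subset_insert _ _)) le_rfl)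
      (mem S₅ (3, t + 1) (by simp [hS₅]))
  have mBE := gBE.mono (hN.sigma_le _) le_rfl
  have mABE := gABE.mono (hN.sigma_le _) le_rfl
  have mZ := gZ.mono (hN.sigma_le _) le_rfl
  have mZW := gZW.mono (hN.sigma_le _) le_rfl
  have i1 := hN.indepFun (S := {((1 : Fin 5), t + 1)}) (T := S₁) (by simp [hS₁])
    (mem _ (1, t + 1) rfl) gE
  have i2 := hN.indepFun (S := {((0 : Fin 5), t + 1)}) (T := S₂) (by simp [hS₁, hS₂])
    (mem _ (0, t + 1) rfl) gBE
  have i3 := hN.indepFun (S := {((4 : Fin 5), t + 1)}) (T := S₃) (by simp [hS₁, hS₂, hS₃])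
    (mem _ (4, t + 1) rfl) gABE
  have i4 := hN.indepFun (S := S₄) (T := {((3 : Fin 5), t + 1)}) (by simp [hS₁, hS₂, hS₃, hS₄])
    gZ (mem _ (3, t + 1) rfl)
  have i5 := hN.indepFun (S := pastNoise t) (T := S₅)
    (by simp [hS₁, hS₂, hS₃, hS₄, hS₅, pastNoise]) hV gZW
  have e1 := (indepFun_iff_map_prod_eq_prod_map_map mB.aemeasurable mE.aemeasurable).1 i1
  have e2 := (indepFun_iff_map_prod_eq_prod_map_map mA.aemeasurable mBE.aemeasurable).1 i2
  have e3 := (indepFun_iff_map_prod_eq_prod_map_map mU.aemeasurable mABE.aemeasurable).1 i3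
  have e4 := (indepFun_iff_map_prod_eq_prod_map_map mZ.aemeasurable mW.aemeasurable).1 i4
  have e5 := (indepFun_iff_map_prod_eq_prod_map_map hV'.aemeasurable mZW.aemeasurable).1 i5
  rw [hN.law_B, hN.law_E] at e1
  rw [e1, hN.law_A] at e2
  rw [e2, hN.map_U] at e3
  have e3' : P.map (N.newNoise t) = N.newLaw P σA σB σE := e3
  rw [e3', hN.law_W] at e4
  rw [e4] at e5
  exact e5

/-- With the past and (U, A, B, E) fixed, W gives the output a Gaussian density around the
`shiftTerm`; averaging this over (U, A, B, E) is the definition of `chanDensity`. -/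
lemma Noise.IsChannelNoise.lintegral_next (hN : N.IsChannelNoise P σA σB σE α₁ α₂) (t : ℕ)
    {β : Type*} [MeasurableSpace β] {V : Ω → β} (hV : Measurable[N.sigma (pastNoise t)] V)
    {g : β → ℝ} (hg : Measurable g) (x x' : ℝ) {F : β × ℝ → ℝ≥0∞} (hF : Measurable F) :
    ∫⁻ ω, F (V ω, shiftTerm x x' (g (V ω)) (N.newNoise t ω) + N.W (t + 1) ω) ∂P
      = ∫⁻ v, (∫⁻ y, chanDensity (N.newLaw P σA σB σE) x x' (g v) y * F (v, y)) ∂P.map V := by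
  have hV' := hV.mono (hN.sigma_le _) le_rfl
  have := hN.isProbabilityMeasure_newLaw
  have : IsProbabilityMeasure (P.map V) := Measure.isProbabilityMeasure_map hV'.aemeasurable
  have mZ : Measurable (N.newNoise t) := (hN.measurable_U _).prodMk ((hN.measurable_A _).prodMk
    ((hN.measurable_B _).prodMk (hN.measurable_E _)))
  have mW := hN.measurable_W (t + 1)
  have hG : Measurable fun q : β × (ℝ × ℝ × ℝ × ℝ) × ℝ =>
      F (q.1, shiftTerm x x' (g q.1) q.2.1 + q.2.2) := by fun_prop
  rw [← lintegral_map (μ := P) (g := fun ω => (V ω, N.newNoise t ω, N.W (t + 1) ω)) hG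
    (by fun_prop), hN.map_newNoise t hV, lintegral_prod _ hG.aemeasurable]
  refine lintegral_congr fun v => ?_
  rw [lintegral_prod _ (by fun_prop)]
  have e : ∀ z, ∫⁻ w, F (v, shiftTerm x x' (g v) z + w) ∂gaussianReal 0 1
      = ∫⁻ y, gaussianPDF 0 1 (y - shiftTerm x x' (g v) z) * F (v, y) := fun z => by
    rw [lintegral_gaussianReal_one (by fun_prop), ← lintegral_sub_right_eq_self _
      (shiftTerm x x' (g v) z)]
    simp
  simp only [e]
  rw [lintegral_lintegral_swap (by fun_prop)]
  refine lintegral_congr fun y => ?_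
  rw [chanDensity, lintegral_mul_const _ (by fun_prop)]

lemma lintegral_fin_snoc {n : ℕ} {F : (Fin (n + 1) → ℝ) → ℝ≥0∞} (hF : Measurable F) :
    ∫⁻ y, F y = ∫⁻ y : Fin n → ℝ, ∫⁻ y' : ℝ, F (Fin.snoc y y') := by
  have h := (volume_preserving_piFinSuccAbove (fun _ : Fin (n + 1) => ℝ) (Fin.last n)).symm
  rw [← h.lintegral_comp hF, Measure.volume_eq_prod, lintegral_prod_symm' _ (by fun_prop)]
  simp only [MeasurableEquiv.piFinSuccAbove_symm_apply, Fin.insertNthEquiv_last]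
  rfl

lemma measurable_fin_snoc {n : ℕ} :
    Measurable fun z : (Fin n → ℝ) × ℝ => (Fin.snoc z.1 z.2 : Fin (n + 1) → ℝ) := by
  refine measurable_pi_lambda _ fun i => ?_
  refine Fin.lastCases ?_ (fun j => ?_) i
  · simpa using measurable_snd
  · simp only [Fin.snoc_castSucc]; fun_prop

/-- `Y` is the output of the channel from time `s` on, for the inputs `z`. -/
structure Noise.IsRun (N : Noise Ω) (s : ℕ) (z : ℕ → ℝ) (Y : ℕ → Ω → ℝ) : Prop where
  measurable_zero : Measurable[N.sigma (pastNoise s)] (Y 0)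
  succ : ∀ j ω, Y (j + 1) ω
    = shiftTerm (z j) (z (j + 1)) (Y j ω) (N.newNoise (s + j) ω) + N.W (s + j + 1) ω

omit mΩ in
lemma Noise.IsRun.measurable_past {s : ℕ} {z : ℕ → ℝ} {Y : ℕ → Ω → ℝ} (hY : N.IsRun s z Y) (j : ℕ) :
    Measurable[N.sigma (pastNoise (s + j))] (Y j) := by
  induction j with
  | zero => exact hY.measurable_zero
  | succ j ih =>
    have e : Y (j + 1) = fun ω => shiftTerm (z j) (z (j + 1)) (Y j ω) (N.newNoise (s + j) ω)
      + N.W (s + j + 1) ω := funext fun ω => hY.succ j ω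
    rw [e]
    have hm : ∀ p ∈ pastNoise (s + (j + 1)),
        Measurable[N.sigma (pastNoise (s + (j + 1)))] (N.family p) := fun p hp =>
      N.measurable_family hp
    have h0 := ih.mono (N.sigma_mono (pastNoise_mono (by omega : s + j ≤ s + (j + 1)))) le_rfl
    have hA := hm (0, s + j + 1) (by simp [pastNoise, add_assoc])
    have hB := hm (1, s + j + 1) (by simp [pastNoise, add_assoc])
    -- E lags by one: its value at time s + j first enters the output at time s + j + 1, which is
    -- why `pastNoise` bounds its index strictly.
    have hE := hm (2, s + j) (by simp [pastNoise])
    have hW := hm (3, s + j + 1) (by simp [pastNoise, add_assoc])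
    have hU := hm (4, s + j + 1) (by simp [pastNoise, add_assoc])
    have hZ : Measurable[N.sigma (pastNoise (s + (j + 1)))] (N.newNoise (s + j)) :=
      hU.prodMk (hA.prodMk (hB.prodMk hE))
    exact (Measurable.shiftTerm measurable_const measurable_const h0 hZ).add hW

omit mΩ in
lemma Noise.IsRun.measurable_block_past {s : ℕ} {z : ℕ → ℝ} {Y : ℕ → Ω → ℝ} (hY : N.IsRun s z Y)
    (n : ℕ) : Measurable[N.sigma (pastNoise (s + n))] (block Y 0 n) := by
  refine @measurable_pi_lambda _ _ _ (_) _ _ fun i => ?_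
  have h := hY.measurable_past (i : ℕ)
  have e : (fun ω => block Y 0 n ω i) = Y i := by funext ω; simp [block]
  rw [e]
  exact h.mono (N.sigma_mono (pastNoise_mono (by omega))) le_rfl

/-- The transition densities of the channel for the inputs `z`. -/
def chanTransition (ρ : Measure (ℝ × ℝ × ℝ × ℝ)) (z : ℕ → ℝ) (j : ℕ) : ℝ → ℝ → ℝ≥0∞ :=
  chanDensity ρ (z j) (z (j + 1))

/-- The law of a block of outputs. -/
theorem Noise.IsRun.map_block (hN : N.IsChannelNoise P σA σB σE α₁ α₂) {s : ℕ} {z : ℕ → ℝ}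
    {Y : ℕ → Ω → ℝ} (hY : N.IsRun s z Y) {a : ℝ → ℝ≥0∞} (ha : Measurable a)
    (hlaw : P.map (Y 0) = volume.withDensity a) (n : ℕ) :
    P.map (block Y 0 n)
      = volume.withDensity (chainDensity (chanTransition (N.newLaw P σA σB σE) z) a n) := by
  have := hN.isProbabilityMeasure_newLaw
  have hk : ∀ j, IsTransition gaussBound (chanTransition (N.newLaw P σA σB σE) z j) := fun j =>
    isTransition_chanDensity _ _
  have hm : ∀ n, Measurable (block Y 0 n) := fun n =>
    (hY.measurable_block_past n).mono (hN.sigma_le _) le_rfl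
  have hm0 : Measurable (Y 0) := hY.measurable_zero.mono (hN.sigma_le _) le_rfl
  have hd : ∀ n, Measurable (chainDensity (chanTransition (N.newLaw P σA σB σE) z) a n) := fun n =>
    measurable_chainDensity hk ha
  induction n with
  | zero =>
    refine Measure.ext_of_lintegral _ fun F hF => ?_
    rw [lintegral_map hF (hm 0), lintegral_withDensity_eq_lintegral_mul _ (hd 0) hF,
      lintegral_fin_one (by fun_prop)]
    have e : ∀ ω, block Y 0 0 ω = fun _ => Y 0 ω := fun ω => by
      funext i
      rw [Fin.fin_one_eq_zero i]
      simp [block]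
    simp only [e]
    rw [← lintegral_map (f := fun y : ℝ => F fun _ => y) (by fun_prop) hm0, hlaw,
      lintegral_withDensity_eq_lintegral_mul _ ha (by fun_prop)]
    simp [chainDensity, chainTail]
  | succ n ih =>
    refine Measure.ext_of_lintegral _ fun F hF => ?_
    rw [lintegral_map hF (hm (n + 1)), lintegral_withDensity_eq_lintegral_mul _ (hd (n + 1)) hF,
      lintegral_fin_snoc (by fun_prop)]
    -- The block grows at its end, where the new noise is independent of everything before it.
    have e : ∀ ω, block Y 0 (n + 1) ω = Fin.snoc (block Y 0 n ω)
        (shiftTerm (z n) (z (n + 1)) (block Y 0 n ω (Fin.last n)) (N.newNoise (s + n) ω)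
          + N.W (s + n + 1) ω) := fun ω => by
      funext i
      refine Fin.lastCases ?_ (fun j => ?_) i
      · rw [Fin.snoc_last]
        simp only [block, Fin.val_last, zero_add]
        exact hY.succ n ω
      · rw [Fin.snoc_castSucc]
        simp [block]
    simp only [e]
    have hG : Measurable fun q : (Fin (n + 1) → ℝ) × ℝ => F (Fin.snoc q.1 q.2) :=
      hF.comp measurable_fin_snoc
    rw [hN.lintegral_next (s + n) (hY.measurable_block_past n) (g := fun v => v (Fin.last n))
      (by fun_prop) (z n) (z (n + 1)) (F := fun q => F (Fin.snoc q.1 q.2)) hG, ih,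
      lintegral_withDensity_eq_lintegral_mul _ (hd n)]
    · refine lintegral_congr fun v => ?_
      rw [Pi.mul_apply, ← lintegral_const_mul _ ?_]
      · refine lintegral_congr fun y => ?_
        simp only [Pi.mul_apply, chainDensity, chainTail_snoc]
        have h0 : (Fin.snoc v y : Fin (n + 2) → ℝ) 0 = v 0 :=
          Fin.snoc_castSucc (α := fun _ => ℝ) y v 0
        rw [h0]
        simp only [chanTransition]
        ring
      · have h1 := (hk n).measurable
        have h2 : Measurable fun y => F (Fin.snoc v y : Fin (n + 2) → ℝ) :=
          hG.comp (f := fun y => (v, y)) (by fun_prop)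
        have h3 : Measurable fun y => chanDensity (N.newLaw P σA σB σE) (z n) (z (n + 1))
            (v (Fin.last n)) y := h1.comp (f := fun y => (v (Fin.last n), y)) (by fun_prop)
        exact h3.mul h2
    · refine Measurable.lintegral_prod_right' (f := fun q : (Fin (n + 1) → ℝ) × ℝ =>
        chanDensity (N.newLaw P σA σB σE) (z n) (z (n + 1)) (q.1 (Fin.last n)) q.2
          * F (Fin.snoc q.1 q.2)) ?_
      exact ((hk n).measurable.comp (f := fun q : (Fin (n + 1) → ℝ) × ℝ =>
        (q.1 (Fin.last n), q.2)) (by fun_prop)).mul hG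

/-- The law of a single output. -/
theorem Noise.IsRun.map_apply (hN : N.IsChannelNoise P σA σB σE α₁ α₂) {s : ℕ} {z : ℕ → ℝ}
    {Y : ℕ → Ω → ℝ} (hY : N.IsRun s z Y) {a : ℝ → ℝ≥0∞} (ha : Measurable a)
    (hlaw : P.map (Y 0) = volume.withDensity a) (j : ℕ) :
    P.map (Y j) = volume.withDensity (evolve (N.newLaw P σA σB σE) z a j) := by
  have := hN.isProbabilityMeasure_newLaw
  have hm : ∀ j, Measurable (Y j) := fun j => (hY.measurable_past j).mono (hN.sigma_le _) le_rfl
  induction j with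
  | zero => exact hlaw
  | succ j ih =>
    have hk := measurable_chanDensity (ρ := N.newLaw P σA σB σE) (z j) (z (j + 1))
    have he := measurable_evolve (ρ := N.newLaw P σA σB σE) (z := z) ha j
    refine Measure.ext_of_lintegral _ fun F hF => ?_
    rw [lintegral_map hF (hm (j + 1)), lintegral_withDensity_eq_lintegral_mul _
      (measurable_evolve ha (j + 1)) hF]
    simp only [hY.succ j]
    have h := hN.lintegral_next (s + j) (hY.measurable_past j) (g := id) measurable_id
      (z j) (z (j + 1)) (F := fun q => F q.2) (by fun_prop)
    simp only [id] at h
    rw [h, ih, lintegral_withDensity_eq_lintegral_mul _ he (by fun_prop)]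
    simp only [Pi.mul_apply, evolve, stepDensity]
    have e1 : ∀ y, evolve (N.newLaw P σA σB σE) z a j y
          * ∫⁻ y', chanDensity (N.newLaw P σA σB σE) (z j) (z (j + 1)) y y' * F y'
        = ∫⁻ y', evolve (N.newLaw P σA σB σE) z a j y
          * (chanDensity (N.newLaw P σA σB σE) (z j) (z (j + 1)) y y' * F y') := fun y => by
      rw [lintegral_const_mul _ (by fun_prop)]
    have e2 : ∀ y', (∫⁻ y, evolve (N.newLaw P σA σB σE) z a j y
          * chanDensity (N.newLaw P σA σB σE) (z j) (z (j + 1)) y y') * F y'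
        = ∫⁻ y, evolve (N.newLaw P σA σB σE) z a j y
          * (chanDensity (N.newLaw P σA σB σE) (z j) (z (j + 1)) y y' * F y') := fun y' => by
      rw [← lintegral_mul_const _ (by fun_prop)]
      simp only [mul_assoc]
    simp only [e1, e2]
    exact lintegral_lintegral_swap (by fun_prop)

end NoiseLaw

/-! ### Decomposition over input words -/

section Words

variable {Ω : Type*} [mΩ : MeasurableSpace Ω] {P : Measure Ω} [IsProbabilityMeasure P]
  {σA σB σE α₁ α₂ : ℝ} {N : Noise Ω} {𝒳 : Finset ℝ} {X : ℕ → Ω → ℝ}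

omit mΩ in
lemma Noise.isRun_output (N : Noise Ω) (z : ℕ → ℝ) : N.IsRun 0 z (N.output fun i _ => z i) where
  measurable_zero := by
    have hW := N.measurable_family (S := pastNoise 0) (p := (3, 0)) (by simp [pastNoise])
    have hU := N.measurable_family (S := pastNoise 0) (p := (4, 0)) (by simp [pastNoise])
    exact (measurable_const.add hW).add hU
  succ j ω := by
    simp only [Noise.output, shiftTerm, Noise.newNoise, zero_add]
    ring

omit mΩ in
lemma Noise.IsRun.shift {s : ℕ} {z : ℕ → ℝ} {Y : ℕ → Ω → ℝ} (hY : N.IsRun s z Y) (m : ℕ) :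
    N.IsRun (s + m) (fun j => z (m + j)) (fun j => Y (m + j)) where
  measurable_zero := hY.measurable_past m
  succ j ω := by
    have := hY.succ (m + j) ω
    rw [add_assoc s m j]
    exact this

omit mΩ in
lemma Noise.isRun_outputFrom (N : Noise Ω) (z : ℕ → ℝ) (t : ℕ) (x y : ℝ) :
    N.IsRun (t + 1) (fun j => z (t + 1 + j))
      (fun j => N.outputFrom (fun i _ => z i) t x y (j + 1)) where
  measurable_zero := by
    have hA := N.measurable_family (S := pastNoise (t + 1)) (p := (0, t + 1)) (by simp [pastNoise])
    have hB := N.measurable_family (S := pastNoise (t + 1)) (p := (1, t + 1)) (by simp [pastNoise])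
    have hE := N.measurable_family (S := pastNoise (t + 1)) (p := (2, t)) (by simp [pastNoise])
    have hW := N.measurable_family (S := pastNoise (t + 1)) (p := (3, t + 1)) (by simp [pastNoise])
    have hU := N.measurable_family (S := pastNoise (t + 1)) (p := (4, t + 1)) (by simp [pastNoise])
    exact (((measurable_const.add (hA.mul measurable_const)).add
      (hB.mul (measurable_const.sub hE))).add hW).add hU
  succ j ω := by
    have e : ∀ i, t + 1 + i = t + i + 1 := fun i => by omega
    simp only [Noise.outputFrom, shiftTerm, Noise.newNoise, e, if_neg (Nat.succ_ne_zero _),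
      add_assoc t]
    ring

lemma Noise.IsChannelNoise.map_output_zero (hN : N.IsChannelNoise P σA σB σE α₁ α₂) (z : ℕ → ℝ) :
    P.map (N.output (fun i _ => z i) 0)
      = volume.withDensity (freshDensity (P.map (N.U 0)) (z 0)) := by
  have := hN.isProbabilityMeasure_map_U
  have hW := hN.measurable_W 0
  have hU := hN.measurable_U 0
  have h := hN.indepFun (S := {((4 : Fin 5), 0)}) (T := {((3 : Fin 5), 0)}) (by simp)
    (N.measurable_family (p := (4, 0)) rfl) (N.measurable_family (p := (3, 0)) rfl)
  have e : P.map (fun ω => (N.U 0 ω, N.W 0 ω)) = (P.map (N.U 0)).prod (P.map (N.W 0)) :=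
    (indepFun_iff_map_prod_eq_prod_map_map hU.aemeasurable hW.aemeasurable).1 h
  refine Measure.ext_of_lintegral _ fun F hF => ?_
  have hm : Measurable (N.output (fun i _ => z i) 0) := (measurable_const.add hW).add hU
  rw [lintegral_map hF hm, lintegral_withDensity_eq_lintegral_mul _ (measurable_freshDensity _ _) hF]
  simp only [Noise.output]
  rw [← lintegral_map (μ := P) (f := fun q : ℝ × ℝ => F (z 0 + q.2 + q.1))
    (g := fun ω => (N.U 0 ω, N.W 0 ω)) (by fun_prop) (by fun_prop), e, hN.law_W,
    lintegral_prod _ (by fun_prop)]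
  have e1 : ∀ u, ∫⁻ w, F (z 0 + w + u) ∂gaussianReal 0 1
      = ∫⁻ y, gaussianPDF 0 1 (y - (z 0 + u)) * F y := fun u => by
    rw [lintegral_gaussianReal_one (by fun_prop), ← lintegral_sub_right_eq_self _ (z 0 + u)]
    refine lintegral_congr fun y => ?_
    congr 2
    ring
  simp only [e1, Pi.mul_apply, freshDensity]
  rw [lintegral_lintegral_swap (by fun_prop)]
  exact lintegral_congr fun y => lintegral_mul_const _ (by fun_prop)

lemma Noise.IsChannelNoise.map_outputFrom_one (hN : N.IsChannelNoise P σA σB σE α₁ α₂)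
    (z : ℕ → ℝ) (t : ℕ) (x y : ℝ) :
    P.map (N.outputFrom (fun i _ => z i) t x y 1)
      = volume.withDensity (chanDensity (N.newLaw P σA σB σE) x (z (t + 1)) y) := by
  have := hN.isProbabilityMeasure_newLaw
  have hm := ((N.isRun_outputFrom z t x y).measurable_zero).mono (hN.sigma_le _) le_rfl
  have hk := measurable_chanDensity (ρ := N.newLaw P σA σB σE) x (z (t + 1))
  have hk' : Measurable (chanDensity (N.newLaw P σA σB σE) x (z (t + 1)) y) :=
    hk.comp (f := fun y' => (y, y')) (by fun_prop)
  refine Measure.ext_of_lintegral _ fun F hF => ?_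
  rw [lintegral_map hF hm, lintegral_withDensity_eq_lintegral_mul _ hk' hF]
  have h := hN.lintegral_next t (V := fun _ => y) measurable_const (g := id) measurable_id x
    (z (t + 1)) (F := fun q => F q.2) (by fun_prop)
  simp only [Measure.map_const, measure_univ, one_smul, id] at h
  rw [lintegral_dirac' _ (Measurable.lintegral_prod_right' (f := fun q : ℝ × ℝ =>
    chanDensity (N.newLaw P σA σB σE) x (z (t + 1)) q.1 q.2 * F q.2) (by fun_prop))] at h
  simp only [Pi.mul_apply]
  rw [← h]
  refine lintegral_congr fun ω => ?_
  simp only [Noise.outputFrom, shiftTerm, Noise.newNoise, if_true, add_zero]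
  congr 1
  ring

omit mΩ in
-- Causality. On the event that the input spells a given word, the random input may be replaced by
-- the deterministic one.
lemma Noise.output_congr (N : Noise Ω) {X X' : ℕ → Ω → ℝ} {ω : Ω} {n : ℕ}
    (h : ∀ j ≤ n, X j ω = X' j ω) : N.output X n ω = N.output X' n ω := by
  induction n with
  | zero => simp [Noise.output, h 0 le_rfl]
  | succ n ih =>
    simp only [Noise.output, h n (by omega), h (n + 1) le_rfl, ih fun j hj => h j (by omega)]

omit mΩ in
lemma Noise.outputFrom_congr (N : Noise Ω) {X X' : ℕ → Ω → ℝ} {ω : Ω} {t n : ℕ} {x y : ℝ}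
    (h : ∀ j < n, X (t + 1 + j) ω = X' (t + 1 + j) ω) :
    N.outputFrom X t x y n ω = N.outputFrom X' t x y n ω := by
  induction n with
  | zero => rfl
  | succ n ih =>
    have h1 : X (t + n + 1) ω = X' (t + n + 1) ω := by
      have := h n (by omega)
      rwa [show t + 1 + n = t + n + 1 by omega] at this
    -- The first output after the restart reads the prescribed x in place of the input at time t, so
    -- only inputs from t + 1 on matter.
    have h2 : (if n = 0 then x else X (t + n) ω) = if n = 0 then x else X' (t + n) ω := by
      split_ifs with h0
      · rfl
      · have := h (n - 1) (by omega)
        rwa [show t + 1 + (n - 1) = t + n by omega] at this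
    simp only [Noise.outputFrom, h1, h2, ih fun j hj => h j (by omega)]

omit [IsProbabilityMeasure P] in
/-- The input process is independent of the noise. -/
lemma Noise.IsInput.indepFun (hN : N.IsChannelNoise P σA σB σE α₁ α₂) (hX : N.IsInput P 𝒳 X)
    {α β : Type*} [MeasurableSpace α] [MeasurableSpace β] {g : (ℕ → ℝ) → α} (hg : Measurable g)
    {S : Set (Fin 5 × ℕ)} {Y : Ω → β} (hY : Measurable[N.sigma S] Y) :
    IndepFun (fun ω => g fun i => X i ω) Y P := by
  set f : Fin 6 → Ω → ℕ → ℝ := fun j ω i => ![N.A, N.B, N.E, N.W, N.U, X] j i ω with hf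
  have hfm : ∀ j, Measurable (f j) := by
    intro j
    refine measurable_pi_lambda _ fun i => ?_
    fin_cases j
    exacts [hN.measurable_A i, hN.measurable_B i, hN.measurable_E i, hN.measurable_W i,
      hN.measurable_U i, hX.measurable i]
  have h := indep_iSup_of_disjoint (fun j => (hfm j).comap_le) hX.indep.iIndep
    (S := {5}) (T := {5}ᶜ) disjoint_compl_right
  rw [IndepFun_iff_Indep]
  refine indep_of_indep_of_le_left (indep_of_indep_of_le_right h ?_) ?_
  · refine hY.comap_le.trans (iSup₂_le fun p _ => ?_)
    obtain ⟨j, i⟩ := p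
    have hj : (Fin.castSucc j : Fin 6) ∈ ({5}ᶜ : Set (Fin 6)) := by
      simp only [Set.mem_compl_iff, Set.mem_singleton_iff]
      exact (Fin.castSucc_lt_last j).ne
    have hle := le_iSup₂ (f := fun j (_ : j ∈ ({5}ᶜ : Set (Fin 6))) =>
      MeasurableSpace.comap (f j) inferInstance) (Fin.castSucc j) hj
    refine le_trans ?_ hle
    have e : N.family (j, i) = (fun v : ℕ → ℝ => v i) ∘ f (Fin.castSucc j) := by
      funext ω
      fin_cases j <;> rfl
    rw [e, ← MeasurableSpace.comap_comp]
    exact MeasurableSpace.comap_mono (measurable_pi_apply i).comap_le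
  · have hle := le_iSup₂ (f := fun j (_ : j ∈ ({5} : Set (Fin 6))) =>
      MeasurableSpace.comap (f j) inferInstance) 5 rfl
    refine le_trans ?_ hle
    have e : (fun ω => g fun i => X i ω) = g ∘ f 5 := rfl
    rw [e, ← MeasurableSpace.comap_comp]
    exact MeasurableSpace.comap_mono hg.comap_le

omit [IsProbabilityMeasure P] in
/-- The decomposition of an expectation over the values of a finitely valued variable. -/
lemma lintegral_eq_sum_words {ι α β : Type*} [Fintype ι] [MeasurableSpace α]
    [MeasurableSingletonClass α] [MeasurableSpace β] {V : Ω → α} (hV : Measurable V) {e : ι → α}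
    (he : Function.Injective e) (hVe : ∀ ω, ∃ i, V ω = e i) {Y : Ω → β} {Y' : ι → Ω → β}
    (hY' : ∀ i, Measurable (Y' i)) (hind : ∀ i, IndepFun V (Y' i) P)
    (hYY : ∀ i ω, V ω = e i → Y ω = Y' i ω) {F : α × β → ℝ≥0∞} (hF : Measurable F) :
    ∫⁻ ω, F (V ω, Y ω) ∂P = ∑ i, P (V ⁻¹' {e i}) * ∫⁻ y, F (e i, y) ∂P.map (Y' i) := by
  classical
  have hpt : ∀ ω, F (V ω, Y ω)
      = ∑ i, (Set.indicator {e i} (fun _ => (1 : ℝ≥0∞)) (V ω)) * F (e i, Y' i ω) := by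
    intro ω
    obtain ⟨i, hi⟩ := hVe ω
    rw [Finset.sum_eq_single i]
    · simp [hi, hYY i ω hi]
    · intro j _ hj
      have : V ω ∉ ({e j} : Set α) := fun h => hj (he ((Set.mem_singleton_iff.1 h).symm.trans hi))
      simp [this]
    · simp
  have hind1 : ∀ i, Measurable (Set.indicator {e i} (fun _ => (1 : ℝ≥0∞))) := fun i =>
    measurable_const.indicator (measurableSet_singleton _)
  have hFm : ∀ i, Measurable fun y => F (e i, y) := fun i => hF.comp measurable_prodMk_left
  simp only [hpt]
  have hm : ∀ i ∈ Finset.univ, Measurable fun ω =>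
      Set.indicator {e i} (fun _ => (1 : ℝ≥0∞)) (V ω) * F (e i, Y' i ω) := fun i _ =>
    ((hind1 i).comp hV).mul ((hFm i).comp (hY' i))
  rw [lintegral_finsetSum _ hm]
  refine Finset.sum_congr rfl fun i _ => ?_
  have h := lintegral_mul_eq_lintegral_mul_lintegral_of_indepFun ((hind1 i).comp hV)
    ((hFm i).comp (hY' i)) ((hind i).comp (hind1 i) (hFm i))
  simp only [Pi.mul_apply, Function.comp] at h
  rw [h, lintegral_map (hFm i) (hY' i)]
  congr 1
  have e1 : (fun ω => Set.indicator {e i} (fun _ => (1 : ℝ≥0∞)) (V ω))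
      = Set.indicator (V ⁻¹' {e i}) 1 := rfl
  rw [e1, lintegral_indicator_one (hV (measurableSet_singleton _))]

lemma sum_measure_words {ι α : Type*} [Fintype ι] [MeasurableSpace α]
    [MeasurableSingletonClass α] {V : Ω → α} (hV : Measurable V) {e : ι → α}
    (he : Function.Injective e) (hVe : ∀ ω, ∃ i, V ω = e i) : ∑ i, P (V ⁻¹' {e i}) = 1 := by
  have h := lintegral_eq_sum_words (P := P) hV he hVe (Y := fun _ => ()) (Y' := fun _ _ => ())
    (fun _ => measurable_const) (fun i => indepFun_const_right V ()) (fun _ _ _ => rfl)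
    (F := fun _ => 1) measurable_const
  simpa using h.symm

/-- The input sequence that starts with the word `w` and then repeats its last letter. -/
def wordExt {n : ℕ} (w : Fin (n + 1) → 𝒳) (i : ℕ) : ℝ := w ⟨min i n, by omega⟩

/-- The word as a real vector. -/
def wordVal {n : ℕ} (w : Fin (n + 1) → 𝒳) (i : Fin (n + 1)) : ℝ := w i

lemma wordVal_injective {n : ℕ} : Function.Injective (wordVal (𝒳 := 𝒳) (n := n)) :=
  fun _ _ h => funext fun i => Subtype.ext (congrFun h i)

lemma wordExt_mem {n : ℕ} (w : Fin (n + 1) → 𝒳) (i : ℕ) : wordExt w i ∈ 𝒳 := (w _).2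

omit [IsProbabilityMeasure P] in
lemma Noise.IsInput.exists_word (hX : N.IsInput P 𝒳 X) (m n : ℕ) (ω : Ω) :
    ∃ w : Fin (n + 1) → 𝒳, block X m n ω = wordVal w :=
  ⟨fun i => ⟨X (m + i) ω, hX.mem _ _⟩, rfl⟩

omit [IsProbabilityMeasure P] in
lemma Noise.IsInput.measurable_block (hX : N.IsInput P 𝒳 X) (m n : ℕ) :
    Measurable (block X m n) :=
  measurable_pi_lambda _ fun _ => hX.measurable _

omit mΩ in
lemma eq_wordExt_of_block_eq {m n : ℕ} {w : Fin (n + 1) → 𝒳} {ω : Ω}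
    (h : block X m n ω = wordVal w) {j : ℕ} (hj : j ≤ n) : X (m + j) ω = wordExt w j := by
  have := congrFun h ⟨j, by omega⟩
  simp only [block, wordVal] at this
  rw [this, wordExt]
  congr 3
  omega

/-- The probability of an input word. -/
def wordProb (P : Measure Ω) (X : ℕ → Ω → ℝ) (m : ℕ) {n : ℕ} (w : Fin (n + 1) → 𝒳) : ℝ≥0∞ :=
  P (block X m n ⁻¹' {wordVal w})

lemma Noise.IsInput.sum_wordProb (hX : N.IsInput P 𝒳 X) (m n : ℕ) :
    ∑ w : Fin (n + 1) → 𝒳, wordProb P X m w = 1 :=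
  sum_measure_words (hX.measurable_block m n) wordVal_injective (hX.exists_word m n)

omit mΩ in
lemma block_add (Y : ℕ → Ω → ℝ) (m n : ℕ) : block (fun j => Y (m + j)) 0 n = block Y m n := by
  funext ω i
  simp [block]

/-- The part of the word `i` that starts at `m`. -/
def wordDrop {T m n : ℕ} (hT : T = m + n) (i : Fin (T + 1) → 𝒳) (j : Fin (n + 1)) : 𝒳 :=
  i ⟨m + j, by omega⟩

lemma wordExt_wordDrop {T m n : ℕ} (hT : T = m + n) (i : Fin (T + 1) → 𝒳) (j : ℕ) :
    wordExt (wordDrop hT i) j = wordExt i (m + j) := by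
  simp only [wordExt, wordDrop]
  congr 3
  omega

end Words

/-! ### Information of a block as input entropy minus conditional entropy -/

section Information

variable {Ω : Type*} [mΩ : MeasurableSpace Ω] {P : Measure Ω} [IsProbabilityMeasure P]
  {σA σB σE α₁ α₂ : ℝ} {N : Noise Ω} {𝒳 : Finset ℝ} {X : ℕ → Ω → ℝ}

lemma sum_fiber {ι κ : Type*} [Fintype ι] [Fintype κ] [DecidableEq κ] {M : Type*} [AddCommMonoid M]
    (π : ι → κ) (f : ι → M) : ∑ u, ∑ i : {i // π i = u}, f i = ∑ i, f i := by
  rw [← (Equiv.sigmaFiberEquiv π).sum_comp, Fintype.sum_sigma]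
  rfl

/-- The density obtained by averaging the densities `a i` over a fiber of `π`. -/
def fiberDensity {ι κ : Type*} [Fintype ι] [DecidableEq κ] (π : ι → κ) (p : ι → ℝ≥0∞)
    (a : ι → ℝ → ℝ≥0∞) (u : κ) (y : ℝ) : ℝ≥0∞ :=
  ∑ i : {i // π i = u}, p i * a i y

lemma lintegral_fiberDensity {ι κ : Type*} [Fintype ι] [DecidableEq κ] {π : ι → κ} {p : ι → ℝ≥0∞}
    {a : ι → ℝ → ℝ≥0∞} (ha : ∀ i, Measurable (a i)) (u : κ) :
    ∫⁻ y, fiberDensity π p a u y = ∑ i : {i // π i = u}, p i * ∫⁻ y, a i y := by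
  unfold fiberDensity
  have hm : ∀ i ∈ (Finset.univ : Finset {i // π i = u}), Measurable fun y => p i * a i y :=
    fun i _ => (ha i).const_mul _
  rw [lintegral_finsetSum _ hm]
  exact Finset.sum_congr rfl fun i _ => lintegral_const_mul _ (ha i)

lemma measurable_fiberDensity {ι κ : Type*} [Fintype ι] [DecidableEq κ] {π : ι → κ}
    {p : ι → ℝ≥0∞} {a : ι → ℝ → ℝ≥0∞} (ha : ∀ i, Measurable (a i)) (u : κ) :
    Measurable (fiberDensity π p a u) :=
  Finset.measurable_fun_sum _ fun i _ => (ha i).const_mul _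

lemma stepDensity_fiberDensity {ι κ : Type*} [Fintype ι] [DecidableEq κ] {π : ι → κ}
    {p : ι → ℝ≥0∞} {a : ι → ℝ → ℝ≥0∞} (ha : ∀ i, Measurable (a i)) (u : κ) {c : ℝ≥0∞}
    {k : ℝ → ℝ → ℝ≥0∞} (hk : IsTransition c k) :
    stepDensity k (fiberDensity π p a u) = fiberDensity π p (fun i => stepDensity k (a i)) u := by
  funext y'
  have hkm := hk.measurable
  unfold stepDensity fiberDensity
  simp only [Finset.sum_mul]
  have hm : ∀ i ∈ (Finset.univ : Finset {i // π i = u}),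
      Measurable fun y => p i * a i y * k y y' := fun i _ => by
    have := ha i
    fun_prop
  rw [lintegral_finsetSum _ hm]
  refine Finset.sum_congr rfl fun i _ => ?_
  have := ha i
  rw [← lintegral_const_mul _ (by fun_prop)]
  simp only [mul_assoc]

lemma chainDensity_fiberDensity {ι κ : Type*} [Fintype ι] [DecidableEq κ] {π : ι → κ}
    {p : ι → ℝ≥0∞} {a : ι → ℝ → ℝ≥0∞} (k : ℕ → ℝ → ℝ → ℝ≥0∞) (u : κ) (n : ℕ) (y : Fin (n + 1) → ℝ) :
    chainDensity k (fiberDensity π p a u) n y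
      = ∑ i : {i // π i = u}, p i * chainDensity k (a i) n y := by
  simp only [chainDensity, fiberDensity, Finset.sum_mul, mul_assoc]

omit [IsProbabilityMeasure P] in
lemma Noise.IsChannelNoise.measurable_output (hN : N.IsChannelNoise P σA σB σE α₁ α₂)
    (hX : ∀ j, Measurable (X j)) (j : ℕ) : Measurable (N.output X j) := by
  have hA := hN.measurable_A
  have hB := hN.measurable_B
  have hE := hN.measurable_E
  have hW := hN.measurable_W
  have hU := hN.measurable_U
  induction j with
  | zero => exact ((hX 0).add (hW 0)).add (hU 0)
  | succ j ih =>
    exact ((((hX _).add ((hA _).mul (hX _))).add ((hB _).mul (ih.sub (hE _)))).add (hW _)).add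
      (hU _)

omit [IsProbabilityMeasure P] in
lemma Noise.IsChannelNoise.measurable_outputFrom (hN : N.IsChannelNoise P σA σB σE α₁ α₂)
    (hX : ∀ j, Measurable (X j)) (t j : ℕ) :
    Measurable fun q : (ℝ × ℝ) × Ω => N.outputFrom X t q.1.1 q.1.2 j q.2 := by
  have hA := hN.measurable_A
  have hB := hN.measurable_B
  have hE := hN.measurable_E
  have hW := hN.measurable_W
  have hU := hN.measurable_U
  induction j with
  | zero => exact measurable_fst.snd
  | succ j ih =>
    have hif : Measurable fun q : (ℝ × ℝ) × Ω => if j = 0 then q.1.1 else X (t + j) q.2 := by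
      split_ifs
      · exact measurable_fst.fst
      · exact (hX _).comp measurable_snd
    simp only [Noise.outputFrom]
    exact (((((hX _).comp measurable_snd).add (((hA _).comp measurable_snd).mul hif)).add
      (((hB _).comp measurable_snd).mul (ih.sub ((hE _).comp measurable_snd)))).add
      ((hW _).comp measurable_snd)).add ((hU _).comp measurable_snd)

lemma wordProb_eq_sum_fiber (hX : N.IsInput P 𝒳 X) {T m n : ℕ} (hT : T = m + n)
    (w : Fin (n + 1) → 𝒳) :
    wordProb P X m w = ∑ i : {i // wordDrop hT i = w}, wordProb P X 0 (i : Fin (T + 1) → 𝒳) := by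
  classical
  set F : (Fin (T + 1) → ℝ) × Unit → ℝ≥0∞ := fun q =>
    Set.indicator {wordVal w} (fun _ => (1 : ℝ≥0∞)) fun j : Fin (n + 1) => q.1 ⟨m + j, by omega⟩
  have hF : Measurable F := by
    refine (measurable_const.indicator (measurableSet_singleton _)).comp ?_
    fun_prop
  have h := lintegral_eq_sum_words (P := P) (hX.measurable_block 0 T) wordVal_injective
    (hX.exists_word 0 T) (Y := fun _ => ()) (Y' := fun _ _ => ()) (fun _ => measurable_const)
    (fun i => indepFun_const_right _ ()) (fun _ _ _ => rfl) (F := F) hF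
  have e1 : ∀ ω, F (block X 0 T ω, ())
      = Set.indicator (block X m n ⁻¹' {wordVal w}) 1 ω := by
    intro ω
    have : (fun j : Fin (n + 1) => block X 0 T ω ⟨m + j, by omega⟩) = block X m n ω := by
      funext j; simp [block]
    simp only [F, this]
    rfl
  simp only [e1] at h
  rw [lintegral_indicator_one ((hX.measurable_block m n) (measurableSet_singleton _))] at h
  rw [wordProb, h, ← sum_fiber (wordDrop hT), Finset.sum_eq_single w]
  · refine Finset.sum_congr rfl fun i _ => ?_
    have : (fun j : Fin (n + 1) => wordVal (i : Fin (T + 1) → 𝒳) ⟨m + j, by omega⟩) = wordVal w :=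
      congrArg wordVal i.2
    simp [F, this, wordProb]
  · intro w' _ hw'
    refine Finset.sum_eq_zero fun i _ => ?_
    have : (fun j : Fin (n + 1) => wordVal (i : Fin (T + 1) → 𝒳) ⟨m + j, by omega⟩) ≠ wordVal w := by
      intro h
      exact hw' (i.2.symm.trans (wordVal_injective h))
    simp [F, this]
  · simp

/-- The input of a block and the output determine an entropy identity for the information. -/
theorem Noise.IsInput.blockInfo_add (hN : N.IsChannelNoise P σA σB σE α₁ α₂)
    (hX : N.IsInput P 𝒳 X) {T m n : ℕ} (hT : T = m + n) :
    N.blockInfo P X m n + chainEntropy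
        (fun w : Fin (n + 1) → 𝒳 => chanTransition (N.newLaw P σA σB σE) (wordExt w))
        (fiberDensity (wordDrop hT) (wordProb P X 0) fun i : Fin (T + 1) → 𝒳 =>
          evolve (N.newLaw P σA σB σE) (wordExt i) (freshDensity (P.map (N.U 0)) (wordExt i 0)) m) n
      = ENNReal.ofReal
        (∑ w : Fin (n + 1) → 𝒳, Real.negMulLog (wordProb P X m w).toReal) := by
  have := hN.isProbabilityMeasure_newLaw
  have := hN.isProbabilityMeasure_map_U
  set ρ := N.newLaw P σA σB σE with hρ
  set a : (Fin (T + 1) → 𝒳) → ℝ → ℝ≥0∞ := fun i =>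
    evolve ρ (wordExt i) (freshDensity (P.map (N.U 0)) (wordExt i 0)) m with ha
  have hfm := fun x => measurable_freshDensity (P.map (N.U 0)) x
  have ham : ∀ i, Measurable (a i) := fun i => measurable_evolve (hfm _) m
  have ha1 : ∀ i, ∫⁻ y, a i y = 1 := fun i => by
    rw [ha, lintegral_evolve (hfm _), lintegral_freshDensity]
  have hab : ∀ i y, a i y ≤ gaussBound := fun i y =>
    evolve_le (hfm _) (freshDensity_le _ _) (lintegral_freshDensity _ _) m y
  have hk : ∀ z j, IsTransition gaussBound (chanTransition ρ z j) := fun z j =>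
    isTransition_chanDensity _ _
  have hpt : ∀ i : Fin (T + 1) → 𝒳, wordProb P X 0 i ≠ ∞ := fun i => measure_ne_top _ _
  have hαm := fun w => measurable_fiberDensity (π := wordDrop hT) (p := wordProb P X 0) ham w
  have hrun : ∀ i : Fin (T + 1) → 𝒳, N.IsRun m (wordExt (wordDrop hT i))
      fun j => N.output (fun l _ => wordExt i l) (m + j) := fun i => by
    have h := (N.isRun_output (wordExt i)).shift m
    rw [zero_add] at h
    simpa only [← wordExt_wordDrop hT] using h
  have hmap : ∀ i : Fin (T + 1) → 𝒳, P.map (block (N.output fun l _ => wordExt i l) m n)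
      = volume.withDensity (chainDensity (chanTransition ρ (wordExt (wordDrop hT i))) (a i) n) := by
    intro i
    rw [← block_add]
    exact (hrun i).map_block hN (ham i)
      ((N.isRun_output (wordExt i)).map_apply hN (hfm _) (hN.map_output_zero _) m) n
  have hbm : ∀ i : Fin (T + 1) → 𝒳,
      Measurable[N.sigma (pastNoise (m + n))] (block (N.output fun l _ => wordExt i l) m n) := by
    intro i
    rw [← block_add]
    exact (hrun i).measurable_block_past n
  have hcd : ∀ (w : Fin (n + 1) → 𝒳) (i : Fin (T + 1) → 𝒳),
      Measurable (chainDensity (chanTransition ρ (wordExt w)) (a i) n) := fun w i =>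
    measurable_chainDensity (hk _) (ham i)
  -- The outputs of the block also depend on the inputs before time m. The expectation is therefore
  -- split over words of full length T + 1 and regrouped by their tails; within a group only the
  -- initial density varies, which produces the fiber average.
  have hlaw : P.map (fun ω => (block X m n ω, block (N.output X) m n ω))
      = mixedLaw wordVal volume fun w => chainDensity (chanTransition ρ (wordExt w))
        (fiberDensity (wordDrop hT) (wordProb P X 0) a w) n := by
    refine Measure.ext_of_lintegral _ fun F hF => ?_
    have hYm := hN.measurable_output hX.measurable
    have hbl : Measurable (block (N.output X) m n) := measurable_pi_lambda _ fun _ => hYm _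
    rw [lintegral_map hF ((hX.measurable_block m n).prodMk hbl),
      lintegral_mixedLaw _ (fun w => measurable_chainDensity (hk _) (hαm w)) hF]
    have hind : ∀ i : Fin (T + 1) → 𝒳,
        IndepFun (block X 0 T) (block (N.output fun l _ => wordExt i l) m n) P := fun i =>
      hX.indepFun hN (g := fun v (j : Fin (T + 1)) => v (0 + j)) (by fun_prop) (hbm i)
    have h := lintegral_eq_sum_words (P := P) (hX.measurable_block 0 T) wordVal_injective
      (hX.exists_word 0 T) (Y := block (N.output X) m n)
      (Y' := fun i => block (N.output fun l _ => wordExt i l) m n)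
      (fun i => (hbm i).mono (hN.sigma_le _) le_rfl) hind
      (fun i ω hi => by
        funext l
        refine N.output_congr fun j hj => ?_
        have := eq_wordExt_of_block_eq hi (j := j) (by omega)
        rwa [zero_add] at this)
      (F := fun q => F (fun j : Fin (n + 1) => q.1 ⟨m + j, by omega⟩, q.2)) (by fun_prop)
    have e1 : ∀ ω, (fun j : Fin (n + 1) => block X 0 T ω ⟨m + j, by omega⟩) = block X m n ω :=
      fun ω => by funext j; simp [block]
    simp only [e1] at h
    rw [h, ← sum_fiber (wordDrop hT)]
    refine Finset.sum_congr rfl fun w _ => ?_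
    simp only [chainDensity_fiberDensity, Finset.sum_mul]
    have hm : ∀ i ∈ (Finset.univ : Finset {i // wordDrop (𝒳 := 𝒳) hT i = w}), Measurable fun y =>
        wordProb P X 0 (i : Fin (T + 1) → 𝒳)
          * chainDensity (chanTransition ρ (wordExt w)) (a i) n y * F (wordVal w, y) := fun i _ =>
      ((hcd w i).const_mul _).mul (hF.comp measurable_prodMk_left)
    rw [lintegral_finsetSum _ hm]
    refine Finset.sum_congr rfl fun i _ => ?_
    have e2 : (fun j : Fin (n + 1) => wordVal (i : Fin (T + 1) → 𝒳) ⟨m + j, by omega⟩)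
        = wordVal w := congrArg wordVal i.2
    have hFm : Measurable fun y => F (wordVal w, y) := hF.comp measurable_prodMk_left
    simp only [e2, mul_assoc]
    have e3 := hmap i
    rw [show wordDrop hT (i : Fin (T + 1) → 𝒳) = w from i.2] at e3
    rw [e3, lintegral_withDensity_eq_lintegral_mul _ (hcd w i) hFm,
      ← lintegral_const_mul _ ((hcd w i).mul hFm)]
    rfl
  rw [Noise.blockInfo, hlaw]
  refine mutualInfo_mixedLaw wordVal_injective (fun w => measurable_chainDensity (hk _) (hαm w))
    (fun w y => chainDensity_ne_top gaussBound_ne_top (hk _) (fun y => ?_) y) (fun w => ?_)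
    (hX.sum_wordProb m n)
  · exact ENNReal.sum_ne_top.2 fun i _ => ENNReal.mul_ne_top (hpt i)
      (ne_top_of_le_ne_top gaussBound_ne_top (hab i y))
  · rw [lintegral_chainDensity (hk _) (hαm w), lintegral_fiberDensity ham,
      wordProb_eq_sum_fiber hX hT]
    simp [ha1]

/-- No input precedes a block that starts at 0, so the fiber average collapses: apart from the
weight of the word, the initial density depends on the first letter only. Part (a) needs this form.
-/
theorem Noise.IsInput.blockInfo_zero_add (hN : N.IsChannelNoise P σA σB σE α₁ α₂)
    (hX : N.IsInput P 𝒳 X) (n : ℕ) :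
    N.blockInfo P X 0 n + chainEntropy
        (fun w : Fin (n + 1) → 𝒳 => chanTransition (N.newLaw P σA σB σE) (wordExt w))
        (fun (w : Fin (n + 1) → 𝒳) y =>
          wordProb P X 0 w * freshDensity (P.map (N.U 0)) (wordExt w 0) y) n
      = ENNReal.ofReal
        (∑ w : Fin (n + 1) → 𝒳, Real.negMulLog (wordProb P X 0 w).toReal) := by
  have h := hX.blockInfo_add hN (T := n) (m := 0) (n := n) (by omega)
  rw [← h]
  congr 3
  funext w y
  rw [wordProb_eq_sum_fiber hX (T := n) (m := 0) (by omega) w, fiberDensity, Finset.sum_mul]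
  refine Finset.sum_congr rfl fun i _ => ?_
  have e := wordExt_wordDrop (𝒳 := 𝒳) (T := n) (m := 0) (n := n) (by omega) i 0
  rw [show wordDrop _ (i : Fin (n + 1) → 𝒳) = w from i.2] at e
  rw [evolve, e]

/-- The law of the second block given the state is a mixture over the input words. -/
lemma Noise.IsInput.condLaw_eq (hN : N.IsChannelNoise P σA σB σE α₁ α₂)
    (hX : N.IsInput P 𝒳 X) (n : ℕ) (x y : ℝ) :
    N.condLaw P X n x y = mixedLaw wordVal volume fun w : Fin (n + 1) → 𝒳 =>
      chainDensity (chanTransition (N.newLaw P σA σB σE) (wordExt w))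
        (fun y' => wordProb P X (n + 1) w
          * chanDensity (N.newLaw P σA σB σE) x (wordExt w 0) y y') n := by
  have := hN.isProbabilityMeasure_newLaw
  set ρ := N.newLaw P σA σB σE with hρ
  have hk : ∀ z j, IsTransition gaussBound (chanTransition ρ z j) := fun z j =>
    isTransition_chanDensity _ _
  have hcm : ∀ x', Measurable (chanDensity ρ x x' y) := fun x' =>
    (measurable_chanDensity (ρ := ρ) x x').comp (f := fun y' => (y, y')) (by fun_prop)
  -- The word is placed at the times from n + 1 on; the values that truncated subtraction assigns to
  -- earlier times are never read.
  set z : (Fin (n + 1) → 𝒳) → ℕ → ℝ := fun w i => wordExt w (i - (n + 1)) with hz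
  have hze : ∀ w j, z w (n + 1 + j) = wordExt w j := fun w j => by simp [hz]
  have hrun : ∀ w, N.IsRun (n + 1) (wordExt w)
      fun j => N.outputFrom (fun l _ => z w l) n x y (j + 1) := fun w => by
    have h := N.isRun_outputFrom (z w) n x y
    simpa only [hze] using h
  have hblock : ∀ (X' : ℕ → Ω → ℝ), block (fun j => N.outputFrom X' n x y (j + 1)) 0 n
      = block (N.outputFrom X' n x y) 1 n := fun X' => by
    funext ω i
    simp only [block, zero_add, add_comm 1 (i : ℕ)]
  have hbm : ∀ w, Measurable[N.sigma (pastNoise (n + 1 + n))]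
      (block (N.outputFrom (fun l _ => z w l) n x y) 1 n) := fun w => by
    rw [← hblock]
    exact (hrun w).measurable_block_past n
  have hmap : ∀ w, P.map (block (N.outputFrom (fun l _ => z w l) n x y) 1 n)
      = volume.withDensity (chainDensity (chanTransition ρ (wordExt w))
        (chanDensity ρ x (wordExt w 0) y) n) := fun w => by
    rw [← hblock]
    refine (hrun w).map_block hN (hcm _) ?_ n
    have := hN.map_outputFrom_one (z w) n x y
    rwa [← add_zero (n + 1), hze] at this
  refine Measure.ext_of_lintegral _ fun F hF => ?_
  have hYm : ∀ j, Measurable (N.outputFrom X n x y j) := fun j =>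
    (hN.measurable_outputFrom hX.measurable n j).comp (f := fun ω => ((x, y), ω)) (by fun_prop)
  have hbl : Measurable (block (N.outputFrom X n x y) 1 n) := measurable_pi_lambda _ fun _ => hYm _
  rw [Noise.condLaw, lintegral_map hF ((hX.measurable_block (n + 1) n).prodMk hbl),
    lintegral_mixedLaw _ (fun w => measurable_chainDensity (hk _) ((hcm _).const_mul _)) hF,
    lintegral_eq_sum_words (P := P) (hX.measurable_block (n + 1) n) wordVal_injective
      (hX.exists_word (n + 1) n) (fun w => (hbm w).mono (hN.sigma_le _) le_rfl)
      (fun w => hX.indepFun hN (g := fun v (j : Fin (n + 1)) => v (n + 1 + j)) (by fun_prop) (hbm w))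
      (fun w ω hw => by
        funext l
        refine N.outputFrom_congr fun j hj => ?_
        rw [hze]
        exact eq_wordExt_of_block_eq hw (by omega)) hF]
  refine Finset.sum_congr rfl fun w _ => ?_
  have hFm : Measurable fun y => F (wordVal w, y) := hF.comp measurable_prodMk_left
  have hd := measurable_chainDensity (n := n) (hk (wordExt w)) (hcm (wordExt w 0))
  rw [hmap, lintegral_withDensity_eq_lintegral_mul _ hd hFm,
    ← lintegral_const_mul _ (hd.mul hFm)]
  refine lintegral_congr fun y' => ?_
  simp only [Pi.mul_apply, chainDensity, mul_assoc]
  rfl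

theorem Noise.IsInput.condInfo_add (hN : N.IsChannelNoise P σA σB σE α₁ α₂)
    (hX : N.IsInput P 𝒳 X) (n : ℕ) (x y : ℝ) :
    mutualInfo (N.condLaw P X n x y)
        + chainEntropy
        (fun w : Fin (n + 1) → 𝒳 => chanTransition (N.newLaw P σA σB σE) (wordExt w))
          (fun (w : Fin (n + 1) → 𝒳) y' => wordProb P X (n + 1) w
            * chanDensity (N.newLaw P σA σB σE) x (wordExt w 0) y y') n
      = ENNReal.ofReal
        (∑ w : Fin (n + 1) → 𝒳, Real.negMulLog (wordProb P X (n + 1) w).toReal) := by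
  have := hN.isProbabilityMeasure_newLaw
  set ρ := N.newLaw P σA σB σE with hρ
  have hk : ∀ z j, IsTransition gaussBound (chanTransition ρ z j) := fun z j =>
    isTransition_chanDensity _ _
  have hcm : ∀ x', Measurable (chanDensity ρ x x' y) := fun x' =>
    (measurable_chanDensity (ρ := ρ) x x').comp (f := fun y' => (y, y')) (by fun_prop)
  rw [hX.condLaw_eq hN]
  refine mutualInfo_mixedLaw wordVal_injective
    (fun w => measurable_chainDensity (hk _) ((hcm _).const_mul _))
    (fun w y => chainDensity_ne_top gaussBound_ne_top (hk _) (fun y' => ?_) y) (fun w => ?_)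
    (hX.sum_wordProb (n + 1) n)
  · exact ENNReal.mul_ne_top (measure_ne_top _ _) (ne_top_of_le_ne_top gaussBound_ne_top
      ((isTransition_chanDensity _ _).le _ _))
  · rw [lintegral_chainDensity (hk _) ((hcm _).const_mul _), lintegral_const_mul _ (hcm _),
      (isTransition_chanDensity (ρ := ρ) _ _).lintegral, mul_one]

end Information

/-! ### Splitting off a prefix of the word -/

section Prefix

/-- H(i | Y) = H(π i | Y) + H(i | π i, Y), from the pointwise chain rule. -/
lemma chainEntropy_chain {ι υ : Type*} [Fintype ι] [Fintype υ] [DecidableEq υ] (π : ι → υ)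
    {k : ι → ℕ → ℝ → ℝ → ℝ≥0∞} {α : ι → ℝ → ℝ≥0∞} (hk : ∀ i j, IsTransition gaussBound (k i j))
    (hα : ∀ i, Measurable (α i)) (hαt : ∀ i y, α i y ≠ ∞) (n : ℕ) :
    chainEntropy k α n
      = (∫⁻ y, eEntropy fun u => ∑ i : {i // π i = u}, chainDensity (k i) (α i) n y)
        + ∑ u, chainEntropy (fun i : {i // π i = u} => k i) (fun i => α i) n := by
  have hd : ∀ i, Measurable (chainDensity (k i) (α i) n) := fun i =>
    measurable_chainDensity (hk i) (hα i)
  have hE : ∀ u, Measurable fun y => eEntropy fun i : {i // π i = u} => chainDensity (k i) (α i) n y :=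
    fun u => measurable_eEntropy fun i => hd i
  have hS : Measurable fun y => eEntropy fun u => ∑ i : {i // π i = u}, chainDensity (k i) (α i) n y :=
    measurable_eEntropy fun u => Finset.measurable_fun_sum _ fun i _ => hd i
  unfold chainEntropy
  rw [← lintegral_finsetSum _ fun u _ => hE u, ← lintegral_add_left hS]
  exact lintegral_congr fun y => eEntropy_chain π fun i =>
    chainDensity_ne_top gaussBound_ne_top (hk i) (hαt i) y

lemma lintegral_eEntropy_fiber_le {ι υ β : Type*} [Fintype ι] [Fintype υ] [DecidableEq υ]
    [MeasurableSpace β] {l : Measure β} (π : ι → υ) {D : ι → β → ℝ≥0∞} (hD : ∀ i, Measurable (D i))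
    (hDt : ∀ i y, D i y ≠ ∞) :
    ∫⁻ y, eEntropy (fun u => ∑ i : {i // π i = u}, D i y) ∂l
      ≤ (∑ i, ∫⁻ y, D i y ∂l) * ENNReal.ofReal (Real.log (Fintype.card υ)) := by
  rw [← lintegral_finsetSum _ fun i _ => hD i, ← lintegral_mul_const _
    (Finset.measurable_fun_sum _ fun i _ => hD i)]
  refine lintegral_mono fun y => ?_
  have ht : ∀ u, ∑ i : {i // π i = u}, D i y ≠ ∞ := fun u =>
    ENNReal.sum_ne_top.2 fun i _ => hDt i y
  have h := eEntropy_le ht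
  rwa [sum_fiber π fun i => D i y] at h

/-- The entropies of two families of chains which differ in their initial densities only, when these
densities and the first transitions are functions of `π i`. -/
theorem chainEntropy_prefix_le {ι υ : Type*} [Fintype ι] [Fintype υ] [DecidableEq υ] (π : ι → υ)
    {k : ι → ℕ → ℝ → ℝ → ℝ≥0∞} {p : ι → ℝ≥0∞} {κ : υ → ℕ → ℝ → ℝ → ℝ≥0∞}
    {a a' : υ → ℕ → ℝ → ℝ≥0∞} {d : ℕ} (hp : ∑ i, p i = 1)
    (hk : ∀ i j, IsTransition gaussBound (k i j)) (hκ : ∀ u j, IsTransition gaussBound (κ u j))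
    (hkκ : ∀ i, ∀ j < d, k i j = κ (π i) j)
    (ha : ∀ u j, Measurable (a u j)) (ha' : ∀ u j, Measurable (a' u j))
    (hat : ∀ u j y, a u j y ≠ ∞) (hat' : ∀ u j y, a' u j y ≠ ∞) (ha1 : ∀ u, ∫⁻ y, a u 0 y = 1)
    (hstep : ∀ u j, a u (j + 1) = stepDensity (κ u j) (a u j))
    (hstep' : ∀ u j, a' u (j + 1) = stepDensity (κ u j) (a' u j)) {ε : ℝ≥0∞} {L : ℝ}
    (hε : ∀ u, ∫⁻ y, (a u d y - a' u d y) ≤ ε)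
    (hL : ∀ u, Real.log (Fintype.card {i // π i = u}) ≤ L) (n : ℕ) :
    chainEntropy k (fun i y => p i * a (π i) 0 y) (n + d)
      ≤ chainEntropy k (fun i y => p i * a' (π i) 0 y) (n + d)
        + ENNReal.ofReal (Real.log (Fintype.card υ)) + ε * ENNReal.ofReal L := by
  have hpt : ∀ i, p i ≠ ∞ := fun i => ENNReal.sum_ne_top.1 (by rw [hp]; simp) i (Finset.mem_univ i)
  have hαm : ∀ i, Measurable fun y => p i * a (π i) 0 y := fun i => (ha _ _).const_mul _
  have hαt : ∀ i y, p i * a (π i) 0 y ≠ ∞ := fun i y => ENNReal.mul_ne_top (hpt i) (hat _ _ _)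
  have hd : ∀ i, Measurable (chainDensity (k i) (fun y => p i * a (π i) 0 y) (n + d)) := fun i =>
    measurable_chainDensity (hk i) (hαm i)
  have hdt : ∀ i y, chainDensity (k i) (fun y => p i * a (π i) 0 y) (n + d) y ≠ ∞ := fun i y =>
    chainDensity_ne_top gaussBound_ne_top (hk i) (hαt i) y
  rw [chainEntropy_chain π hk hαm hαt, chainEntropy_chain π hk (fun i => (ha' _ _).const_mul _)
    fun i y => ENNReal.mul_ne_top (hpt i) (hat' _ _ _)]
  -- The entropy of π i is bounded by its largest possible value, with no use of the outputs.
  have h1 : ∫⁻ y, eEntropy (fun u => ∑ i : {i // π i = u},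
      chainDensity (k i) (fun y => p i * a (π i) 0 y) (n + d) y)
        ≤ ENNReal.ofReal (Real.log (Fintype.card υ)) := by
    refine (lintegral_eEntropy_fiber_le π hd hdt).trans_eq ?_
    simp only [lintegral_chainDensity (hk _) (hαm _), lintegral_const_mul _ (ha _ _), ha1,
      mul_one, hp, one_mul]
  -- Within a fiber the first d transitions coincide. The first d outputs drop out exactly, and the
  -- initial densities are replaced by their evolutions up to time d, which are close.
  have h2 : ∀ u, chainEntropy (fun i : {i // π i = u} => k i)
      (fun i y => p i * a (π i) 0 y) (n + d)
        ≤ chainEntropy (fun i : {i // π i = u} => k i) (fun i y => p i * a' (π i) 0 y) (n + d)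
          + (∑ i : {i // π i = u}, p i) * (ε * ENNReal.ofReal L) := by
    intro u
    have e : ∀ b : υ → ℕ → ℝ → ℝ≥0∞, (fun (i : {i // π i = u}) y => p i * b (π i) 0 y)
        = fun (i : {i // π i = u}) y => p i * b u 0 y := fun b => by
      funext i y
      rw [i.2]
    have hkκ' : ∀ i : {i // π i = u}, ∀ j < d, k i j = κ u j := fun i j hj => by
      rw [hkκ i j hj, i.2]
    rw [e a, e a', chainEntropy_common_shift (fun (i : {i // π i = u}) j => hk i j) (ha u) (hat u) hkκ' (hκ u)
        (fun j _ => hstep u j), chainEntropy_common_shift (fun (i : {i // π i = u}) j => hk i j) (ha' u) (hat' u) hkκ'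
        (hκ u) (fun j _ => hstep' u j)]
    refine (chainEntropy_common_le (fun i : {i // π i = u} => hpt i) (fun (i : {i // π i = u}) j => hk i _) (ha u d)
      (ha' u d) (hat u d) (hat' u d)).trans ?_
    rw [mul_assoc]
    gcongr
    · exact hε u
    · exact hL u
  calc _ ≤ ENNReal.ofReal (Real.log (Fintype.card υ))
        + ∑ u, (chainEntropy (fun i : {i // π i = u} => k i) (fun i y => p i * a' (π i) 0 y) (n + d)
          + (∑ i : {i // π i = u}, p i) * (ε * ENNReal.ofReal L)) :=
        add_le_add h1 (Finset.sum_le_sum fun u _ => h2 u)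
    _ = (∑ u, chainEntropy (fun i : {i // π i = u} => k i) (fun i y => p i * a' (π i) 0 y) (n + d))
        + ENNReal.ofReal (Real.log (Fintype.card υ)) + ε * ENNReal.ofReal L := by
        rw [Finset.sum_add_distrib, ← Finset.sum_mul, sum_fiber π, hp, one_mul]
        ring
    -- The entropy of π i for the second family is nonnegative and may be added back.
    _ ≤ _ := by
        gcongr
        exact le_add_self

variable {𝒳 : Finset ℝ} {ρ : Measure (ℝ × ℝ × ℝ × ℝ)} [IsProbabilityMeasure ρ]

/-- The first letters of a word. -/
def wordTake {K n : ℕ} (h : K ≤ n) (i : Fin (n + 1) → 𝒳) (j : Fin (K + 1)) : 𝒳 :=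
  i ⟨j, by omega⟩

lemma wordExt_wordTake {K n : ℕ} (h : K ≤ n) (i : Fin (n + 1) → 𝒳) {j : ℕ} (hj : j ≤ K) :
    wordExt (wordTake h i) j = wordExt i j := by
  simp only [wordExt, wordTake]
  congr 3
  omega

lemma card_wordTake_le {K n : ℕ} (h : K ≤ n) (u : Fin (K + 1) → 𝒳) :
    Fintype.card {i // wordTake h i = u} ≤ 𝒳.card ^ (n - K) := by
  have hinj : Function.Injective fun (i : {i : Fin (n + 1) → 𝒳 // wordTake h i = u})
      (j : Fin (n - K)) => (i : Fin (n + 1) → 𝒳) ⟨K + 1 + j, by omega⟩ := by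
    intro i i' hii
    refine Subtype.ext (funext fun j => ?_)
    by_cases hj : (j : ℕ) ≤ K
    · exact congrFun (i.2.trans i'.2.symm) ⟨j, by omega⟩
    · have := congrFun hii ⟨j - (K + 1), by omega⟩
      have e : K + 1 + ((j : ℕ) - (K + 1)) = j := by omega
      simpa only [e] using this
  simpa using Fintype.card_le_of_injective _ hinj

/-- Two initial densities that depend on the first letter only. -/
theorem chainEntropy_words_le {n K : ℕ} (hK : K ≤ n) {p : (Fin (n + 1) → 𝒳) → ℝ≥0∞}
    (hp : ∑ w, p w = 1) {a a' : ℝ → ℝ → ℝ≥0∞} (ha : ∀ x, Measurable (a x))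
    (ha' : ∀ x, Measurable (a' x)) (hab : ∀ x y, a x y ≤ gaussBound)
    (hab' : ∀ x y, a' x y ≤ gaussBound) (ha1 : ∀ x, ∫⁻ y, a x y = 1)
    (ha1' : ∀ x, ∫⁻ y, a' x y = 1) {ε : ℝ≥0∞}
    (hε : ∀ z : ℕ → ℝ, ∫⁻ y, (evolve ρ z (a (z 0)) K y - evolve ρ z (a' (z 0)) K y) ≤ ε) :
    chainEntropy (fun w => chanTransition ρ (wordExt w)) (fun w y => p w * a (wordExt w 0) y) n
      ≤ chainEntropy (fun w => chanTransition ρ (wordExt w))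
          (fun w y => p w * a' (wordExt w 0) y) n
        + ENNReal.ofReal ((K + 1) * Real.log 𝒳.card)
        + ε * ENNReal.ofReal ((n - K) * Real.log 𝒳.card) := by
  obtain ⟨d, rfl⟩ : ∃ d, n = d + K := ⟨n - K, by omega⟩
  have hne : ∀ {b : ℝ → ℝ → ℝ≥0∞}, (∀ x, Measurable (b x)) → (∀ x y, b x y ≤ gaussBound) →
      (∀ x, ∫⁻ y, b x y = 1) → ∀ (z : ℕ → ℝ) j y, evolve ρ z (b (z 0)) j y ≠ ∞ :=
    fun h1 h2 h3 z j y => ne_top_of_le_ne_top gaussBound_ne_top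
      (evolve_le (h1 _) (h2 _) (h3 _) j y)
  -- K + 1 letters are split off: the initial density reads letter 0, and the K transitions read the
  -- letters 0 to K.
  have h := chainEntropy_prefix_le (wordTake hK) (p := p) (d := K)
    (k := fun w => chanTransition ρ (wordExt w)) (κ := fun u => chanTransition ρ (wordExt u))
    (a := fun u => evolve ρ (wordExt u) (a (wordExt u 0)))
    (a' := fun u => evolve ρ (wordExt u) (a' (wordExt u 0))) (L := d * Real.log 𝒳.card) hp
    (fun _ _ => isTransition_chanDensity _ _) (fun _ _ => isTransition_chanDensity _ _)
    (fun i j hj => by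
      simp only [chanTransition]
      rw [wordExt_wordTake hK i hj.le, wordExt_wordTake hK i hj])
    (fun _ j => measurable_evolve (ha _) j) (fun _ j => measurable_evolve (ha' _) j)
    (fun u => hne ha hab ha1 _) (fun u => hne ha' hab' ha1' _) (fun u => ha1 _)
    (fun _ _ => rfl) (fun _ _ => rfl) (fun u => hε (wordExt u)) (fun u => ?_) d
  · simp only [evolve, wordExt_wordTake hK _ (Nat.zero_le _)] at h
    have e : Real.log (Fintype.card (Fin (K + 1) → 𝒳)) = (K + 1) * Real.log 𝒳.card := by
      simp
    rw [e] at h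
    simpa using h
  · have h := card_wordTake_le hK u
    rw [Nat.add_sub_cancel] at h
    rcases Nat.eq_zero_or_pos (Fintype.card {i // wordTake hK i = u}) with h0 | h0
    · rw [h0]
      simp only [Nat.cast_zero, Real.log_zero]
      positivity
    · rw [← Real.log_pow]
      exact Real.log_le_log (by exact_mod_cast h0) (by exact_mod_cast h)

end Prefix

/-! ### Changing the state before a block, and the conditional law -/

section CondInfo

variable {Ω : Type*} [mΩ : MeasurableSpace Ω] {P : Measure Ω} [IsProbabilityMeasure P]
  {σA σB σE α₁ α₂ : ℝ} {N : Noise Ω} {𝒳 : Finset ℝ} {X : ℕ → Ω → ℝ}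

/-- I and I' are the same finite number minus H and H', so a two-sided comparison of the conditional
entropies transfers to the informations; finiteness of all terms comes for free. -/
lemma abs_toReal_sub_le_of_add_eq {I I' H H' : ℝ≥0∞} {s c : ℝ} (hI : I + H = ENNReal.ofReal s)
    (hI' : I' + H' = ENNReal.ofReal s) (h : H ≤ H' + ENNReal.ofReal c)
    (h' : H' ≤ H + ENNReal.ofReal c) (hc : 0 ≤ c) :
    I ≠ ∞ ∧ I' ≠ ∞ ∧ |I.toReal - I'.toReal| ≤ c := by
  have ht : I + H ≠ ∞ := by rw [hI]; exact ENNReal.ofReal_ne_top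
  have ht' : I' + H' ≠ ∞ := by rw [hI']; exact ENNReal.ofReal_ne_top
  obtain ⟨h1, h2⟩ := ENNReal.add_ne_top.1 ht
  obtain ⟨h1', h2'⟩ := ENNReal.add_ne_top.1 ht'
  refine ⟨h1, h1', ?_⟩
  have e : I.toReal + H.toReal = I'.toReal + H'.toReal := by
    rw [← ENNReal.toReal_add h1 h2, ← ENNReal.toReal_add h1' h2', hI, hI']
  have g : ∀ {H H' : ℝ≥0∞}, H' ≠ ∞ → H ≤ H' + ENNReal.ofReal c → H.toReal ≤ H'.toReal + c := by
    intro H H' ht h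
    have := ENNReal.toReal_mono (ENNReal.add_ne_top.2 ⟨ht, ENNReal.ofReal_ne_top⟩) h
    rwa [ENNReal.toReal_add ht ENNReal.ofReal_ne_top, ENNReal.toReal_ofReal hc] at this
  have g1 := g h2' h
  have g2 := g h2 h'
  rw [abs_le]
  constructor <;> linarith

/-- Changing the state before a block with unchanged input law. -/
theorem Noise.IsInput.abs_blockInfo_sub_condInfo_le (hN : N.IsChannelNoise P σA σB σE α₁ α₂)
    (hX : N.IsInput P 𝒳 X) (hσB : 0 ≤ σB) {n K : ℕ} (hK : K ≤ n)
    (hp : ∀ w : Fin (n + 1) → 𝒳, wordProb P X (n + 1) w = wordProb P X 0 w) (x y : ℝ) :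
    N.blockInfo P X 0 n ≠ ∞ ∧ mutualInfo (N.condLaw P X n x y) ≠ ∞ ∧
      |(N.blockInfo P X 0 n).toReal - (mutualInfo (N.condLaw P X n x y)).toReal|
        ≤ (K + 1) * Real.log 𝒳.card
          + (n - K) * (σA ^ 2 * x ^ 2 + 2 * σB ^ 2 * (y ^ 2 + σE ^ 2)) * σB ^ (2 * K)
            * Real.log 𝒳.card := by
  have := hN.isProbabilityMeasure_newLaw
  have := hN.isProbabilityMeasure_map_U
  have h1 := hX.blockInfo_zero_add hN n
  have h2 := hX.condInfo_add hN n x y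
  simp only [hp] at h2
  set ρ := N.newLaw P σA σB σE with hρ
  set S := σA ^ 2 * x ^ 2 + 2 * σB ^ 2 * (y ^ 2 + σE ^ 2) with hS
  have hS0 : 0 ≤ S := by positivity
  have hlog : 0 ≤ Real.log 𝒳.card := Real.log_natCast_nonneg _
  have hnK : (0 : ℝ) ≤ n - K := sub_nonneg.2 (by exact_mod_cast hK)
  have hfm := fun x => measurable_freshDensity (P.map (N.U 0)) x
  have hcm : ∀ x', Measurable (chanDensity ρ x x' y) := fun x' =>
    (measurable_chanDensity (ρ := ρ) x x').comp (f := fun y' => (y, y')) (by fun_prop)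
  have hcb : ∀ x' y', chanDensity ρ x x' y y' ≤ gaussBound := fun x' =>
    (isTransition_chanDensity _ _).le _
  have hc1 : ∀ x', ∫⁻ y', chanDensity ρ x x' y y' = 1 := fun x' =>
    (isTransition_chanDensity _ _).lintegral _
  have hε : ∀ z : ℕ → ℝ, ∫⁻ y', (evolve ρ z (freshDensity (P.map (N.U 0)) (z 0)) K y'
      - evolve ρ z (chanDensity ρ x (z 0) y) K y') ≤ ENNReal.ofReal (S * σB ^ (2 * K)) := fun z =>
    lintegral_evolve_sub_le _ x y z K
  -- The reverse estimate holds because both evolved densities have mass one.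
  have hε' : ∀ z : ℕ → ℝ, ∫⁻ y', (evolve ρ z (chanDensity ρ x (z 0) y) K y'
      - evolve ρ z (freshDensity (P.map (N.U 0)) (z 0)) K y')
        ≤ ENNReal.ofReal (S * σB ^ (2 * K)) := fun z => by
    rw [lintegral_tsub_comm (measurable_evolve (hcm _) K) (measurable_evolve (hfm _) K)]
    · exact hε z
    · rw [lintegral_evolve (hcm _), lintegral_evolve (hfm _), lintegral_freshDensity, hc1]
    · rw [lintegral_evolve (hcm _), hc1]
      exact ENNReal.one_ne_top
  have hsum := hX.sum_wordProb 0 n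
  have e : ENNReal.ofReal ((K + 1) * Real.log 𝒳.card)
      + ENNReal.ofReal (S * σB ^ (2 * K)) * ENNReal.ofReal ((n - K) * Real.log 𝒳.card)
        = ENNReal.ofReal ((K + 1) * Real.log 𝒳.card
          + (n - K) * S * σB ^ (2 * K) * Real.log 𝒳.card) := by
    rw [← ENNReal.ofReal_mul (by positivity), ← ENNReal.ofReal_add (by positivity) (by positivity)]
    congr 1
    ring
  refine abs_toReal_sub_le_of_add_eq h1 h2 ?_ ?_ (by positivity)
  · rw [← e, ← add_assoc]
    exact chainEntropy_words_le hK hsum hfm hcm (fun _ => freshDensity_le _ _) hcb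
      (lintegral_freshDensity _) hc1 hε
  · rw [← e, ← add_assoc]
    exact chainEntropy_words_le hK hsum hcm hfm hcb (fun _ => freshDensity_le _ _) hc1
      (lintegral_freshDensity _) hε'

/-- The law of a block given the state, as a Markov kernel. -/
def Noise.condKernel (N : Noise Ω) (P : Measure Ω) (X : ℕ → Ω → ℝ) (n : ℕ) :
    Kernel (ℝ × ℝ) ((Fin (n + 1) → ℝ) × (Fin (n + 1) → ℝ)) :=
  (Kernel.id ×ₖ Kernel.const (ℝ × ℝ) P).map
    fun q => (block X (n + 1) n q.2, block (N.outputFrom X n q.1.1 q.1.2) 1 n q.2)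

omit [IsProbabilityMeasure P] in
lemma Noise.IsInput.measurable_condKernel_fun (hN : N.IsChannelNoise P σA σB σE α₁ α₂)
    (hX : N.IsInput P 𝒳 X) (n : ℕ) : Measurable fun q : (ℝ × ℝ) × Ω =>
      (block X (n + 1) n q.2, block (N.outputFrom X n q.1.1 q.1.2) 1 n q.2) :=
  ((hX.measurable_block _ _).comp measurable_snd).prodMk
    (measurable_pi_lambda _ fun _ => hN.measurable_outputFrom hX.measurable n _)

lemma Noise.IsInput.condKernel_apply (hN : N.IsChannelNoise P σA σB σE α₁ α₂)
    (hX : N.IsInput P 𝒳 X) (n : ℕ) (z : ℝ × ℝ) :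
    N.condKernel P X n z = N.condLaw P X n z.1 z.2 := by
  have hg := hX.measurable_condKernel_fun hN n
  rw [condKernel, Kernel.map_apply _ hg, Kernel.prod_apply, Kernel.id_apply, Kernel.const_apply,
    Measure.dirac_prod, Measure.map_map hg (by fun_prop)]
  rfl

lemma Noise.IsInput.isMarkovKernel_condKernel (hN : N.IsChannelNoise P σA σB σE α₁ α₂)
    (hX : N.IsInput P 𝒳 X) (n : ℕ) : IsMarkovKernel (N.condKernel P X n) :=
  Kernel.IsMarkovKernel.map _ (hX.measurable_condKernel_fun hN n)

/-- The inputs `w₀` followed by the inputs `w₁`. -/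
def wordAppend {n : ℕ} (w₀ w₁ : Fin (n + 1) → 𝒳) (j : ℕ) : ℝ :=
  if j ≤ n then wordExt w₀ j else wordExt w₁ (j - (n + 1))

lemma wordAppend_of_le {n : ℕ} (w₀ w₁ : Fin (n + 1) → 𝒳) {j : ℕ} (hj : j ≤ n) :
    wordAppend w₀ w₁ j = wordExt w₀ j := if_pos hj

lemma wordAppend_add {n : ℕ} (w₀ w₁ : Fin (n + 1) → 𝒳) (j : ℕ) :
    wordAppend w₀ w₁ (n + 1 + j) = wordExt w₁ j := by
  rw [wordAppend, if_neg (by omega), Nat.add_sub_cancel_left]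

lemma chainDensity_cons {k : ℕ → ℝ → ℝ → ℝ≥0∞} {a : ℝ → ℝ≥0∞} {n : ℕ} (y : ℝ)
    (v : Fin (n + 1) → ℝ) : chainDensity k a (n + 1) (Fin.cons y v)
      = a y * chainDensity (fun j => k (j + 1)) (k 0 y) n v := by
  rw [chainDensity, chainTail_cons, Fin.cons_zero, chainDensity]

/-- The law of the outputs at the times `n, …, 2 * n + 1`, for deterministic inputs. -/
lemma Noise.IsChannelNoise.lintegral_block_append (hN : N.IsChannelNoise P σA σB σE α₁ α₂) {n : ℕ}
    (w₀ w₁ : Fin (n + 1) → 𝒳) {g : ℝ × (Fin (n + 1) → ℝ) → ℝ≥0∞} (hg : Measurable g) :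
    ∫⁻ v, g (v 0, fun j : Fin (n + 1) => v j.succ)
        ∂P.map (block (fun j => N.output (fun l _ => wordAppend w₀ w₁ l) (n + j)) 0 (n + 1))
      = ∫⁻ y, evolve (N.newLaw P σA σB σE) (wordExt w₀)
          (freshDensity (P.map (N.U 0)) (wordExt w₀ 0)) n y
        * ∫⁻ v, chainDensity (chanTransition (N.newLaw P σA σB σE) (wordExt w₁))
          (chanDensity (N.newLaw P σA σB σE) (wordExt w₀ n) (wordExt w₁ 0) y) n v * g (y, v) := by
  have := hN.isProbabilityMeasure_newLaw
  have := hN.isProbabilityMeasure_map_U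
  set ρ := N.newLaw P σA σB σE with hρ
  have hk : ∀ z j, IsTransition gaussBound (chanTransition ρ z j) := fun z j =>
    isTransition_chanDensity _ _
  have hfm := fun x => measurable_freshDensity (P.map (N.U 0)) x
  set b : ℝ → ℝ≥0∞ :=
    evolve ρ (wordExt w₀) (freshDensity (P.map (N.U 0)) (wordExt w₀ 0)) n with hb
  have hbm : Measurable b := measurable_evolve (hfm _) n
  set x := wordExt w₀ n with hx
  set D : ℝ → (Fin (n + 1) → ℝ) → ℝ≥0∞ := fun y v =>
    chainDensity (chanTransition ρ (wordExt w₁)) (chanDensity ρ x (wordExt w₁ 0) y) n v with hD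
  have hDm : Measurable (Function.uncurry D) :=
    ((measurable_chanDensity x (wordExt w₁ 0)).comp
      (f := fun q : ℝ × (Fin (n + 1) → ℝ) => (q.1, q.2 0)) (by fun_prop)).mul
        ((measurable_chainTail (hk (wordExt w₁))).comp measurable_snd)
  have hrun := (N.isRun_output (wordAppend w₀ w₁)).shift n
  rw [zero_add] at hrun
  have hb' : evolve ρ (wordAppend w₀ w₁)
      (freshDensity (P.map (N.U 0)) (wordAppend w₀ w₁ 0)) n = b := by
    rw [wordAppend_of_le w₀ w₁ (Nat.zero_le n)]
    exact evolve_congr _ fun i hi => wordAppend_of_le w₀ w₁ hi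
  have hlaw := (N.isRun_output (wordAppend w₀ w₁)).map_apply hN (hfm _) (hN.map_output_zero _) n
  rw [← hρ, hb'] at hlaw
  have hk0 : chanTransition ρ (fun j => wordAppend w₀ w₁ (n + j)) 0
      = chanDensity ρ x (wordExt w₁ 0) := by
    simp only [chanTransition]
    rw [add_zero, wordAppend_of_le w₀ w₁ le_rfl, zero_add, ← add_zero (n + 1), wordAppend_add]
  have hks : (fun j => chanTransition ρ (fun j => wordAppend w₀ w₁ (n + j)) (j + 1))
      = chanTransition ρ (wordExt w₁) := by
    funext j
    simp only [chanTransition]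
    rw [← wordAppend_add w₀ w₁ j, ← wordAppend_add w₀ w₁ (j + 1)]
    congr 2 <;> omega
  have hd := measurable_chainDensity (n := n + 1) (hk fun j => wordAppend w₀ w₁ (n + j)) hbm
  have hgm : Measurable fun v : Fin (n + 2) → ℝ => g (v 0, fun j => v j.succ) := by fun_prop
  rw [hrun.map_block hN hbm hlaw (n + 1), lintegral_withDensity_eq_lintegral_mul _ hd hgm,
    lintegral_fin_cons (hd.mul hgm)]
  simp only [Pi.mul_apply, chainDensity_cons, hks, hk0, Fin.cons_zero, Fin.cons_succ,
    mul_assoc]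
  rw [lintegral_lintegral_swap]
  · refine lintegral_congr fun y => ?_
    exact lintegral_const_mul _ ((hDm.comp measurable_prodMk_left).mul
      (hg.comp measurable_prodMk_left))
  · exact ((hbm.comp measurable_snd).mul
      ((hDm.comp measurable_swap).mul (hg.comp measurable_swap))).aemeasurable

/-- The mixture over words with the word probability pulled out of the density, to be matched with
the expansion of the joint law. -/
lemma Noise.IsInput.lintegral_condKernel (hN : N.IsChannelNoise P σA σB σE α₁ α₂)
    (hX : N.IsInput P 𝒳 X) (n : ℕ) (x y : ℝ)
    {g : (Fin (n + 1) → ℝ) × (Fin (n + 1) → ℝ) → ℝ≥0∞} (hg : Measurable g) :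
    ∫⁻ v, g v ∂N.condKernel P X n (x, y) = ∑ w : Fin (n + 1) → 𝒳, wordProb P X (n + 1) w
      * ∫⁻ v, chainDensity (chanTransition (N.newLaw P σA σB σE) (wordExt w))
        (chanDensity (N.newLaw P σA σB σE) x (wordExt w 0) y) n v * g (wordVal w, v) := by
  have := hN.isProbabilityMeasure_newLaw
  have hk : ∀ z j, IsTransition gaussBound (chanTransition (N.newLaw P σA σB σE) z j) :=
    fun z j => isTransition_chanDensity _ _
  have hcm : ∀ x', Measurable (chanDensity (N.newLaw P σA σB σE) x x' y) := fun x' =>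
    (measurable_chanDensity x x').comp (f := fun y' => (y, y')) (by fun_prop)
  rw [hX.condKernel_apply hN, hX.condLaw_eq hN, lintegral_mixedLaw _
    (fun w => measurable_chainDensity (hk _) ((hcm _).const_mul _)) hg]
  refine Finset.sum_congr rfl fun w _ => ?_
  have hm : Measurable fun v => chainDensity (chanTransition (N.newLaw P σA σB σE) (wordExt w))
      (chanDensity (N.newLaw P σA σB σE) x (wordExt w 0) y) n v * g (wordVal w, v) :=
    (measurable_chainDensity (hk _) (hcm _)).mul (hg.comp measurable_prodMk_left)
  rw [← lintegral_const_mul _ hm]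
  simp only [chainDensity, mul_assoc]

lemma measurable_lintegral_chain {ρ : Measure (ℝ × ℝ × ℝ × ℝ)} [IsProbabilityMeasure ρ] {n : ℕ}
    (x : ℝ) (w : Fin (n + 1) → 𝒳) {g : ℝ × (Fin (n + 1) → ℝ) → ℝ≥0∞} (hg : Measurable g) :
    Measurable fun y => ∫⁻ v, chainDensity (chanTransition ρ (wordExt w))
      (chanDensity ρ x (wordExt w 0) y) n v * g (y, v) := by
  have hk : ∀ j, IsTransition gaussBound (chanTransition ρ (wordExt w) j) := fun j =>
    isTransition_chanDensity _ _
  refine Measurable.lintegral_prod_right' (f := fun q : ℝ × (Fin (n + 1) → ℝ) =>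
    chainDensity (chanTransition ρ (wordExt w)) (chanDensity ρ x (wordExt w 0) q.1) n q.2 * g q) ?_
  exact (((measurable_chanDensity x (wordExt w 0)).comp
    (f := fun q : ℝ × (Fin (n + 1) → ℝ) => (q.1, q.2 0)) (by fun_prop)).mul
      ((measurable_chainTail hk).comp measurable_snd)).mul hg

/-- `condKernel` disintegrates the joint law of the state and the second block. -/
theorem Noise.IsInput.map_eq_compProd (hN : N.IsChannelNoise P σA σB σE α₁ α₂)
    (hX : N.IsInput P 𝒳 X) {n : ℕ} (hind : IndepFun (block X 0 n) (block X (n + 1) n) P) :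
    P.map (fun ω => ((X n ω, N.output X n ω),
        (block X (n + 1) n ω, block (N.output X) (n + 1) n ω)))
      = P.map (fun ω => (X n ω, N.output X n ω)) ⊗ₘ N.condKernel P X n := by
  have := hN.isProbabilityMeasure_newLaw
  have := hN.isProbabilityMeasure_map_U
  have := hX.isMarkovKernel_condKernel hN n
  set ρ := N.newLaw P σA σB σE with hρ
  have hfm := fun x => measurable_freshDensity (P.map (N.U 0)) x
  set b : (Fin (n + 1) → 𝒳) → ℝ → ℝ≥0∞ := fun w =>
    evolve ρ (wordExt w) (freshDensity (P.map (N.U 0)) (wordExt w 0)) n with hb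
  have hbm : ∀ w, Measurable (b w) := fun w => measurable_evolve (hfm _) n
  have hY := hN.measurable_output hX.measurable
  have hV0 := hX.measurable_block 0 n
  have hV1 := hX.measurable_block (n + 1) n
  have hZ : Measurable fun ω => (X n ω, N.output X n ω) := (hX.measurable n).prodMk (hY n)
  have hB : Measurable fun ω => (block X (n + 1) n ω, block (N.output X) (n + 1) n ω) :=
    hV1.prodMk (measurable_pi_lambda _ fun _ => hY _)
  refine Measure.ext_of_lintegral _ fun F hF => ?_
  have hG : Measurable fun z => ∫⁻ v, F (z, v) ∂N.condKernel P X n z := hF.lintegral_kernel_prod_right'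
  rw [lintegral_map hF (hZ.prodMk hB), Measure.lintegral_compProd hF, lintegral_map hG hZ]
  -- the right side
  have hR := lintegral_eq_sum_words (P := P) hV0 wordVal_injective (hX.exists_word 0 n)
    (Y := N.output X n) (Y' := fun w => N.output (fun l _ => wordExt w l) n)
    (fun w => hN.measurable_output (fun _ => measurable_const) n)
    (fun w => hX.indepFun hN (g := fun v (j : Fin (n + 1)) => v (0 + j)) (by fun_prop)
      ((N.isRun_output (wordExt w)).measurable_past n))
    (fun w ω hw => N.output_congr fun j hj => by
      have := eq_wordExt_of_block_eq hw hj
      rwa [zero_add] at this)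
    (F := fun q => ∫⁻ v, F ((q.1 (Fin.last n), q.2), v)
      ∂N.condKernel P X n (q.1 (Fin.last n), q.2))
    (hG.comp (f := fun q : (Fin (n + 1) → ℝ) × ℝ => (q.1 (Fin.last n), q.2)) (by fun_prop))
  have e0 : ∀ ω, block X 0 n ω (Fin.last n) = X n ω := fun ω => by simp [block]
  simp only [e0] at hR
  rw [hR]
  -- the left side
  set e : (Fin (n + 1) → 𝒳) × (Fin (n + 1) → 𝒳) → (Fin (n + 1) → ℝ) × (Fin (n + 1) → ℝ) :=
    Prod.map wordVal wordVal with he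
  have hrun : ∀ w₀ w₁ : Fin (n + 1) → 𝒳, N.IsRun n (fun j => wordAppend w₀ w₁ (n + j))
      fun j => N.output (fun l _ => wordAppend w₀ w₁ l) (n + j) := fun w₀ w₁ => by
    have h := (N.isRun_output (wordAppend w₀ w₁)).shift n
    rwa [zero_add] at h
  have hL := lintegral_eq_sum_words (P := P) (hV0.prodMk hV1) (e := e)
    (wordVal_injective.prodMap wordVal_injective)
    (fun ω => by
      obtain ⟨w₀, h₀⟩ := hX.exists_word 0 n ω
      obtain ⟨w₁, h₁⟩ := hX.exists_word (n + 1) n ω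
      exact ⟨(w₀, w₁), by rw [h₀, h₁]; rfl⟩)
    (Y := block (fun j => N.output X (n + j)) 0 (n + 1))
    (Y' := fun w => block (fun j => N.output (fun l _ => wordAppend w.1 w.2 l) (n + j)) 0 (n + 1))
    (fun w => ((hrun w.1 w.2).measurable_block_past (n + 1)).mono (hN.sigma_le _) le_rfl)
    (fun w => hX.indepFun hN
      (g := fun v => (fun j : Fin (n + 1) => v (0 + j), fun j : Fin (n + 1) => v (n + 1 + j)))
      (by fun_prop) ((hrun w.1 w.2).measurable_block_past (n + 1)))
    (fun w ω hw => by
      have h₀ : block X 0 n ω = wordVal w.1 := congrArg Prod.fst hw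
      have h₁ : block X (n + 1) n ω = wordVal w.2 := congrArg Prod.snd hw
      funext i
      refine N.output_congr fun j hj => ?_
      rcases le_or_gt j n with hjn | hjn
      · have := eq_wordExt_of_block_eq h₀ hjn
        rwa [zero_add, ← wordAppend_of_le _ w.2 hjn] at this
      · obtain ⟨l, rfl⟩ : ∃ l, j = n + 1 + l := ⟨j - (n + 1), by omega⟩
        rw [wordAppend_add]
        exact eq_wordExt_of_block_eq h₁ (by omega))
    (F := fun q => F ((q.1.1 (Fin.last n), q.2 0), (q.1.2, fun j : Fin (n + 1) => q.2 j.succ)))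
    (by fun_prop)
  have e1 : ∀ ω, block (fun j => N.output X (n + j)) 0 (n + 1) ω 0 = N.output X n ω := fun ω => by
    simp [block]
  have e2 : ∀ ω, (fun j : Fin (n + 1) => block (fun j => N.output X (n + j)) 0 (n + 1) ω j.succ)
      = block (N.output X) (n + 1) n ω := fun ω => by
    funext j
    simp only [block, Fin.val_succ, zero_add]
    congr 1
    omega
  simp only [e0, e1, e2] at hL
  rw [hL, Fintype.sum_prod_type]
  refine Finset.sum_congr rfl fun w₀ _ => ?_
  -- Independence of the two input blocks enters here: the probability of a pair of words factors,
  -- and the second factor is the weight in the kernel.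
  have hp : ∀ w₁, P ((fun ω => (block X 0 n ω, block X (n + 1) n ω)) ⁻¹' {e (w₀, w₁)})
      = P (block X 0 n ⁻¹' {wordVal w₀}) * wordProb P X (n + 1) w₁ := fun w₁ => by
    rw [wordProb, ← hind.measure_inter_preimage_eq_mul _ _ (measurableSet_singleton _)
      (measurableSet_singleton _)]
    congr 1
    ext ω
    simp [e, Prod.ext_iff]
  simp only [hp, mul_assoc]
  rw [← Finset.mul_sum]
  congr 1
  have hlaw := (N.isRun_output (wordExt w₀)).map_apply hN (hfm _) (hN.map_output_zero _) n
  have hG' : Measurable fun y => ∫⁻ v, F ((wordVal w₀ (Fin.last n), y), v)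
      ∂N.condKernel P X n (wordVal w₀ (Fin.last n), y) :=
    hG.comp (f := fun y => (wordVal w₀ (Fin.last n), y)) (by fun_prop)
  rw [hlaw, lintegral_withDensity_eq_lintegral_mul _ (hbm w₀) hG']
  have hx : wordVal w₀ (Fin.last n) = wordExt w₀ n := by
    simp [wordVal, wordExt, Fin.last]
  set J : (Fin (n + 1) → 𝒳) → ℝ → ℝ≥0∞ := fun w₁ y => ∫⁻ v,
    chainDensity (chanTransition ρ (wordExt w₁)) (chanDensity ρ (wordExt w₀ n) (wordExt w₁ 0) y) n v
      * F ((wordExt w₀ n, y), wordVal w₁, v) with hJ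
  have hJm : ∀ w₁, Measurable (J w₁) := fun w₁ => measurable_lintegral_chain (wordExt w₀ n) w₁
    (g := fun q => F ((wordExt w₀ n, q.1), wordVal w₁, q.2)) (by fun_prop)
  have hm : ∀ w₁ ∈ (Finset.univ : Finset (Fin (n + 1) → 𝒳)), Measurable fun y =>
      b w₀ y * (wordProb P X (n + 1) w₁ * J w₁ y) := fun w₁ _ =>
    (hbm w₀).mul ((hJm w₁).const_mul _)
  simp only [hx, Pi.mul_apply]
  simp_rw [fun y => hX.lintegral_condKernel hN n (wordExt w₀ n) y
    (g := fun v => F ((wordExt w₀ n, y), v)) (by fun_prop), Finset.mul_sum]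
  refine Eq.trans ?_ (lintegral_finsetSum _ hm).symm
  refine Finset.sum_congr rfl fun w₁ _ => ?_
  have h := hN.lintegral_block_append w₀ w₁
    (g := fun q => F ((wordExt w₀ n, q.1), wordVal w₁, q.2)) (by fun_prop)
  simp only [he, Prod.map, hx]
  have hm' : Measurable fun y => b w₀ y * J w₁ y := (hbm w₀).mul (hJm w₁)
  simp only [mul_left_comm (b w₀ _)]
  rw [h, lintegral_const_mul _ hm']

end CondInfo

/-! ### Second moments of the outputs -/

section Power

variable {Ω : Type*} [mΩ : MeasurableSpace Ω] {P : Measure Ω} [IsProbabilityMeasure P]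
  {σA σB σE α₁ α₂ : ℝ} {N : Noise Ω} {𝒳 : Finset ℝ}

omit [IsProbabilityMeasure P] in
lemma lintegral_sq_of_map_eq {V : Ω → ℝ} (hV : Measurable V) {σ : ℝ}
    (h : P.map V = gaussianReal 0 (σ ^ 2).toNNReal) :
    ∫⁻ ω, ENNReal.ofReal (V ω ^ 2) ∂P = ENNReal.ofReal (σ ^ 2) := by
  rw [← lintegral_sq_gaussianReal, ← h, lintegral_map (by fun_prop) hV]

omit [IsProbabilityMeasure P] in
lemma Noise.IsChannelNoise.ae_mem_U (hN : N.IsChannelNoise P σA σB σE α₁ α₂) (hα : α₁ < α₂)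
    (i : ℕ) : ∀ᵐ ω ∂P, N.U i ω ∈ Set.Ioo α₁ α₂ := by
  have h := (hN.law_U i).measure_preimage (A := (Set.Ioo α₁ α₂)ᶜ) (by simp [hα]) (by simp)
    measurableSet_Ioo.compl
  rw [Set.inter_compl_self, measure_empty, ENNReal.zero_div] at h
  rw [ae_iff]
  exact h

lemma Noise.IsChannelNoise.lintegral_sq_U_le (hN : N.IsChannelNoise P σA σB σE α₁ α₂)
    (hα₁ : 0 ≤ α₁) (hα : α₁ < α₂) (i : ℕ) :
    ∫⁻ ω, ENNReal.ofReal (N.U i ω ^ 2) ∂P ≤ ENNReal.ofReal (α₂ ^ 2) := by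
  calc _ ≤ ∫⁻ _, ENNReal.ofReal (α₂ ^ 2) ∂P := by
        refine lintegral_mono_ae ?_
        filter_upwards [hN.ae_mem_U hα i] with ω hω
        have h1 := hω.1
        have h2 := hω.2
        exact ENNReal.ofReal_le_ofReal (by gcongr; linarith)
    _ = _ := by simp

lemma abs_le_constM₀ {x : ℝ} (hx : x ∈ 𝒳) : |x| ≤ constM₀ 𝒳 α₁ α₂ :=
  Finset.le_max' _ _ (by
    simp only [Finset.mem_insert, Finset.mem_image]
    exact Or.inr (Or.inr ⟨x, hx, rfl⟩))

lemma constM₀_nonneg : 0 ≤ constM₀ 𝒳 α₁ α₂ :=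
  (abs_nonneg α₁).trans (Finset.le_max' _ _ (Finset.mem_insert_self _ _))

lemma sq_le_constM₀_sq {x : ℝ} (hx : x ∈ 𝒳) : x ^ 2 ≤ constM₀ 𝒳 α₁ α₂ ^ 2 := by
  rw [← sq_abs x]
  exact pow_le_pow_left₀ (abs_nonneg x) (abs_le_constM₀ hx) 2

omit [IsProbabilityMeasure P] in
lemma lintegral_sq_mul_of_indepFun {V V' : Ω → ℝ} (hV : Measurable V) (hV' : Measurable V')
    (h : IndepFun V V' P) : ∫⁻ ω, ENNReal.ofReal (V ω ^ 2) * ENNReal.ofReal (V' ω ^ 2) ∂P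
      = (∫⁻ ω, ENNReal.ofReal (V ω ^ 2) ∂P) * ∫⁻ ω, ENNReal.ofReal (V' ω ^ 2) ∂P :=
  lintegral_mul_eq_lintegral_mul_lintegral_of_indepFun'' (by fun_prop) (by fun_prop)
    (h.comp (φ := fun x : ℝ => ENNReal.ofReal (x ^ 2)) (ψ := fun x : ℝ => ENNReal.ofReal (x ^ 2))
      (by fun_prop) (by fun_prop))

/-- A bound for the second moment of the part of an output that does not depend on the past. -/
def powerStep (𝒳 : Finset ℝ) (α₁ α₂ σA σB σE : ℝ) : ℝ :=
  5 * (constM₀ 𝒳 α₁ α₂ ^ 2 + α₂ ^ 2 + constM₀ 𝒳 α₁ α₂ ^ 2 * σA ^ 2 + σB ^ 2 * σE ^ 2 + 1)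

/-- The output is c + b y with c a sum of five terms. Cauchy–Schwarz bounds c², and the weighted
inequality (c + b y)² ≤ c² / (1 − s) + (b y)² / s avoids mixed moments. With s = σB the last term
has expectation σB E[y²], a contraction. -/
lemma output_sq_le {s x x' u a b e w y : ℝ} (hs : 0 < s) (hs1 : s < 1) :
    (x' + a * x + b * (y - e) + w + u) ^ 2
      ≤ 5 / (1 - s) * (x' ^ 2 + u ^ 2 + x ^ 2 * a ^ 2 + b ^ 2 * e ^ 2 + w ^ 2)
        + 1 / s * (b ^ 2 * y ^ 2) := by
  set c := x' + a * x - b * e + w + u with hc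
  have h1 : c ^ 2 ≤ 5 * (x' ^ 2 + u ^ 2 + x ^ 2 * a ^ 2 + b ^ 2 * e ^ 2 + w ^ 2) := by
    nlinarith [sq_nonneg (x' - a * x), sq_nonneg (x' + b * e), sq_nonneg (x' - w), sq_nonneg (x' - u),
      sq_nonneg (a * x + b * e), sq_nonneg (a * x - w), sq_nonneg (a * x - u),
      sq_nonneg (b * e + w), sq_nonneg (b * e + u), sq_nonneg (w - u)]
  have h2 : (c + b * y) ^ 2 ≤ c ^ 2 / (1 - s) + (b * y) ^ 2 / s := by
    have h1s : 0 < 1 - s := by linarith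
    rw [div_add_div _ _ h1s.ne' hs.ne', le_div_iff₀ (by positivity)]
    nlinarith [sq_nonneg (c * s - (1 - s) * (b * y))]
  have h1s : 0 < 1 - s := by linarith
  calc _ = (c + b * y) ^ 2 := by rw [hc]; ring
    _ ≤ c ^ 2 / (1 - s) + (b * y) ^ 2 / s := h2
    _ ≤ 5 * (x' ^ 2 + u ^ 2 + x ^ 2 * a ^ 2 + b ^ 2 * e ^ 2 + w ^ 2) / (1 - s)
        + (b * y) ^ 2 / s := by gcongr
    _ = _ := by ring

theorem Noise.IsChannelNoise.exists_powerBound (hN : N.IsChannelNoise P σA σB σE α₁ α₂)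
    (𝒳 : Finset ℝ) (hσB : 0 < σB) (hσB1 : σB < 1) (hα₁ : 0 ≤ α₁) (hα : α₁ < α₂) :
    ∃ M₃ : ℝ, 0 < M₃ ∧ N.PowerBound P 𝒳 M₃ := by
  set M := constM₀ 𝒳 α₁ α₂ with hM
  set C := powerStep 𝒳 α₁ α₂ σA σB σE with hC
  have hC0 : 0 < C := by rw [hC, powerStep]; positivity
  have h1 : 0 < 1 - σB := by linarith
  -- The fixed point of t = C / (1 − σB) + σB t.
  refine ⟨C / (1 - σB) ^ 2, by positivity, fun x hx n => ?_⟩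
  have hA := fun i => lintegral_sq_of_map_eq (hN.measurable_A i) (hN.law_A i)
  have hB := fun i => lintegral_sq_of_map_eq (hN.measurable_B i) (hN.law_B i)
  have hE := fun i => lintegral_sq_of_map_eq (hN.measurable_E i) (hN.law_E i)
  have hW := fun i => lintegral_sq_of_map_eq (hN.measurable_W i) (σ := 1)
    (by simpa using hN.law_W i)
  have hU := fun i => hN.lintegral_sq_U_le hα₁ hα i
  have mA := hN.measurable_A
  have mB := hN.measurable_B
  have mE := hN.measurable_E
  have mW := hN.measurable_W
  have mU := hN.measurable_U
  have mY := hN.measurable_output (X := fun i _ => x i) fun _ => measurable_const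
  have hx2 : ∀ i, x i ^ 2 ≤ M ^ 2 := fun i => sq_le_constM₀_sq (hx i)
  have hBE : ∀ i, ∫⁻ ω, ENNReal.ofReal (N.B (i + 1) ω ^ 2) * ENNReal.ofReal (N.E i ω ^ 2) ∂P
      = ENNReal.ofReal (σB ^ 2 * σE ^ 2) := fun i => by
    rw [lintegral_sq_mul_of_indepFun (mB _) (mE _), hB, hE, ENNReal.ofReal_mul (by positivity)]
    exact hN.indepFun (S := {((1 : Fin 5), i + 1)}) (T := {((2 : Fin 5), i)}) (by simp)
      (N.measurable_family (p := (1, i + 1)) rfl) (N.measurable_family (p := (2, i)) rfl)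
  have hBY : ∀ i, ∫⁻ ω, ENNReal.ofReal (N.B (i + 1) ω ^ 2)
      * ENNReal.ofReal (N.output (fun i _ => x i) i ω ^ 2) ∂P
        = ENNReal.ofReal (σB ^ 2) * ∫⁻ ω, ENNReal.ofReal (N.output (fun i _ => x i) i ω ^ 2) ∂P :=
    fun i => by
      rw [lintegral_sq_mul_of_indepFun (mB _) (mY _), hB]
      have h := (N.isRun_output x).measurable_past i
      rw [zero_add] at h
      exact hN.indepFun (S := {((1 : Fin 5), i + 1)}) (T := pastNoise i) (by simp [pastNoise])
        (N.measurable_family (p := (1, i + 1)) rfl) h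
  induction n with
  | zero =>
    have key : ∀ ω, N.output (fun i _ => x i) 0 ω ^ 2
        ≤ 5 * (x 0 ^ 2 + N.U 0 ω ^ 2 + N.W 0 ω ^ 2) := fun ω => by
      simp only [Noise.output]
      nlinarith [sq_nonneg (x 0 - N.W 0 ω), sq_nonneg (x 0 - N.U 0 ω),
        sq_nonneg (N.W 0 ω - N.U 0 ω), sq_nonneg (x 0), sq_nonneg (N.U 0 ω), sq_nonneg (N.W 0 ω)]
    calc _ ≤ ∫⁻ ω, ENNReal.ofReal 5 * (ENNReal.ofReal (x 0 ^ 2) + ENNReal.ofReal (N.U 0 ω ^ 2)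
          + ENNReal.ofReal (N.W 0 ω ^ 2)) ∂P := lintegral_mono fun ω => by
          rw [← ENNReal.ofReal_add (by positivity) (by positivity),
            ← ENNReal.ofReal_add (by positivity) (by positivity),
            ← ENNReal.ofReal_mul (by positivity)]
          exact ENNReal.ofReal_le_ofReal (key ω)
      _ ≤ ENNReal.ofReal 5 * (ENNReal.ofReal (M ^ 2) + ENNReal.ofReal (α₂ ^ 2)
          + ENNReal.ofReal (1 ^ 2)) := by
          rw [lintegral_const_mul _ (by fun_prop), lintegral_add_right _ (by fun_prop),
            lintegral_add_right _ (by fun_prop), lintegral_const, measure_univ, mul_one, hW]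
          gcongr ENNReal.ofReal 5 * (?_ + ?_ + _)
          exacts [ENNReal.ofReal_le_ofReal (hx2 0), hU 0]
      _ = ENNReal.ofReal (5 * (M ^ 2 + α₂ ^ 2 + 1)) := by
          rw [← ENNReal.ofReal_add (by positivity) (by positivity),
            ← ENNReal.ofReal_add (by positivity) (by positivity),
            ← ENNReal.ofReal_mul (by positivity), one_pow]
      _ ≤ _ := by
          refine ENNReal.ofReal_le_ofReal ?_
          have h2 : 5 * (M ^ 2 + α₂ ^ 2 + 1) ≤ C := by
            rw [hC, powerStep]
            nlinarith [sq_nonneg (M * σA), sq_nonneg (σB * σE)]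
          refine h2.trans ?_
          rw [le_div_iff₀ (by positivity)]
          exact mul_le_of_le_one_right hC0.le (pow_le_one₀ h1.le (by linarith))
  | succ n ih =>
    have key : ∀ ω, ENNReal.ofReal (N.output (fun i _ => x i) (n + 1) ω ^ 2)
        ≤ ENNReal.ofReal (5 / (1 - σB)) * (ENNReal.ofReal (x (n + 1) ^ 2)
          + ENNReal.ofReal (N.U (n + 1) ω ^ 2)
          + ENNReal.ofReal (x n ^ 2) * ENNReal.ofReal (N.A (n + 1) ω ^ 2)
          + ENNReal.ofReal (N.B (n + 1) ω ^ 2) * ENNReal.ofReal (N.E n ω ^ 2)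
          + ENNReal.ofReal (N.W (n + 1) ω ^ 2))
          + ENNReal.ofReal (1 / σB) * (ENNReal.ofReal (N.B (n + 1) ω ^ 2)
            * ENNReal.ofReal (N.output (fun i _ => x i) n ω ^ 2)) := fun ω => by
      simp only [← ENNReal.ofReal_mul (sq_nonneg _)]
      rw [← ENNReal.ofReal_add (by positivity) (by positivity),
        ← ENNReal.ofReal_add (by positivity) (by positivity),
        ← ENNReal.ofReal_add (by positivity) (by positivity),
        ← ENNReal.ofReal_add (by positivity) (by positivity),
        ← ENNReal.ofReal_mul (by positivity), ← ENNReal.ofReal_mul (by positivity),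
        ← ENNReal.ofReal_add (by positivity) (by positivity)]
      exact ENNReal.ofReal_le_ofReal (output_sq_le hσB hσB1)
    calc _ ≤ _ := lintegral_mono key
      _ ≤ ENNReal.ofReal (5 / (1 - σB)) * (ENNReal.ofReal (M ^ 2) + ENNReal.ofReal (α₂ ^ 2)
          + ENNReal.ofReal (M ^ 2) * ENNReal.ofReal (σA ^ 2) + ENNReal.ofReal (σB ^ 2 * σE ^ 2)
          + ENNReal.ofReal (1 ^ 2))
          + ENNReal.ofReal (1 / σB) * (ENNReal.ofReal (σB ^ 2)
            * ENNReal.ofReal (C / (1 - σB) ^ 2)) := by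
          rw [lintegral_add_right _ (by fun_prop), lintegral_const_mul _ (by fun_prop),
            lintegral_const_mul _ (by fun_prop), lintegral_add_right _ (by fun_prop),
            lintegral_add_right _ (by fun_prop), lintegral_add_right _ (by fun_prop),
            lintegral_add_right _ (by fun_prop), lintegral_const_mul _ (by fun_prop), hBE, hBY,
            hA, hW, lintegral_const, measure_univ, mul_one]
          gcongr ENNReal.ofReal (5 / (1 - σB)) * (?_ + ?_ + ?_ * _ + _ + _) + _ * (_ * ?_)
          exacts [ENNReal.ofReal_le_ofReal (hx2 _), hU _, ENNReal.ofReal_le_ofReal (hx2 _)]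
      _ = ENNReal.ofReal (C / (1 - σB) ^ 2) := by
          rw [← ENNReal.ofReal_mul (sq_nonneg M), ← ENNReal.ofReal_mul (sq_nonneg σB),
            ← ENNReal.ofReal_add (by positivity) (by positivity),
            ← ENNReal.ofReal_add (by positivity) (by positivity),
            ← ENNReal.ofReal_add (by positivity) (by positivity),
            ← ENNReal.ofReal_add (by positivity) (by positivity),
            ← ENNReal.ofReal_mul (by positivity), ← ENNReal.ofReal_mul (by positivity),
            ← ENNReal.ofReal_add (by positivity) (by positivity)]
          congr 1
          have e : 5 / (1 - σB) * (M ^ 2 + α₂ ^ 2 + M ^ 2 * σA ^ 2 + σB ^ 2 * σE ^ 2 + 1 ^ 2)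
              = C / (1 - σB) := by
            rw [hC, powerStep]; ring
          rw [e]
          field_simp
          ring

/-- The noise `W` alone has second moment one. -/
theorem Noise.IsChannelNoise.one_le_of_powerBound (hN : N.IsChannelNoise P σA σB σE α₁ α₂)
    (hα : α₁ < α₂) (h𝒳 : 𝒳.Nonempty) {M₃ : ℝ} (h : N.PowerBound P 𝒳 M₃) : 1 ≤ M₃ := by
  obtain ⟨x, hx⟩ := h𝒳
  have h0 := h (fun _ => x) (fun _ => hx) 0
  have hind : IndepFun (N.U 0) (N.W 0) P :=
    hN.indepFun (S := {((4 : Fin 5), 0)}) (T := {((3 : Fin 5), 0)}) (by simp)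
      (N.measurable_family (p := (4, 0)) rfl) (N.measurable_family (p := (3, 0)) rfl)
  have hU : MemLp (N.U 0) 2 P := by
    refine MemLp.of_bound (hN.measurable_U 0).aestronglyMeasurable (max |α₁| |α₂|) ?_
    filter_upwards [hN.ae_mem_U hα 0] with ω hω
    exact abs_le_max_abs_abs hω.1.le hω.2.le
  have hW : MemLp (N.W 0) 2 P := by
    have h1 : MemLp id 2 (P.map (N.W 0)) := by
      rw [hN.law_W]
      exact memLp_id_gaussianReal 2
    exact h1.comp_of_map (hN.measurable_W 0).aemeasurable
  have hvW : Var[N.W 0; P] = 1 := by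
    have := variance_id_map (X := N.W 0) (μ := P) (hN.measurable_W 0).aemeasurable
    rw [hN.law_W, variance_id_gaussianReal] at this
    simpa using this.symm
  have hY : MemLp (fun ω => x + (N.U 0 + N.W 0) ω) 2 P := (memLp_const x).add (hU.add hW)
  -- The second moment is at least the variance, and the variance of x + U + W is that of U plus 1.
  have hv : 1 ≤ Var[fun ω => x + (N.U 0 + N.W 0) ω; P] := by
    rw [variance_const_add (hU.add hW).aestronglyMeasurable, hind.variance_add hU hW, hvW]
    linarith [variance_nonneg (N.U 0) P]
  have h2 := hv.trans (variance_le_expectation_sq hY.aestronglyMeasurable)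
  have e : ∫⁻ ω, ENNReal.ofReal (N.output (fun i _ => x) 0 ω ^ 2) ∂P
      = ENNReal.ofReal (∫ ω, (x + (N.U 0 + N.W 0) ω) ^ 2 ∂P) := by
    rw [ofReal_integral_eq_lintegral_ofReal hY.integrable_sq
      (Filter.Eventually.of_forall fun _ => sq_nonneg _)]
    refine lintegral_congr fun ω => ?_
    simp only [Noise.output, Pi.add_apply]
    congr 2
    ring
  rw [e] at h0
  have h3 := (ENNReal.ofReal_le_ofReal h2).trans h0
  rw [ENNReal.ofReal_one, ENNReal.one_le_ofReal] at h3
  exact h3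

end Power

/-! ### Stationary inputs: blocks that start at different times -/

section Stationary

variable {Ω : Type*} [mΩ : MeasurableSpace Ω] {P : Measure Ω} [IsProbabilityMeasure P]
  {σA σB σE α₁ α₂ : ℝ} {N : Noise Ω} {𝒳 : Finset ℝ} {X : ℕ → Ω → ℝ}

/-- The output started at time `m + 1` afresh and the output started at time `0` merge. -/
theorem lintegral_evolve_fresh_sub_le (μ : Measure ℝ) [IsProbabilityMeasure μ] (z : ℕ → ℝ)
    (m j : ℕ) {v : ℝ} (hv : 0 ≤ v)
    (h : ∫⁻ y, evolve (μ.prod (coeffLaw σA σB σE)) z (freshDensity μ (z 0)) m y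
      * ENNReal.ofReal (y ^ 2) ≤ ENNReal.ofReal v) :
    ∫⁻ y, (evolve (μ.prod (coeffLaw σA σB σE)) (fun i => z (m + 1 + i))
          (freshDensity μ (z (m + 1))) j y
        - evolve (μ.prod (coeffLaw σA σB σE)) z (freshDensity μ (z 0)) (m + 1 + j) y)
      ≤ ENNReal.ofReal ((σA ^ 2 * z m ^ 2 + 2 * σB ^ 2 * (v + σE ^ 2)) * σB ^ (2 * j)) := by
  set ρ := μ.prod (coeffLaw σA σB σE) with hρ
  set g := evolve ρ z (freshDensity μ (z 0)) m with hg
  set z' : ℕ → ℝ := fun i => z (m + 1 + i) with hz'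
  have hgm : Measurable g := measurable_evolve (measurable_freshDensity μ _) m
  have hg1 : ∫⁻ y, g y = 1 := by
    rw [hg, lintegral_evolve (measurable_freshDensity μ _), lintegral_freshDensity]
  set η : Measure ℝ := volume.withDensity g with hη
  have : IsProbabilityMeasure η := ⟨by rw [hη, withDensity_apply _ MeasurableSet.univ]; simpa⟩
  set f := evolve ρ z' (freshDensity μ (z (m + 1))) j with hf
  have hfm : Measurable f := measurable_evolve (measurable_freshDensity μ _) j
  set c : ℝ → ℝ → ℝ≥0∞ := fun y₀ => evolve ρ z' (chanDensity ρ (z m) (z (m + 1)) y₀) j with hc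
  have hchan := measurable_chanDensity (ρ := ρ) (z m) (z (m + 1))
  have hcm : Measurable (Function.uncurry c) := measurable_uncurry_evolve hchan j
  have hcm' : ∀ y, Measurable fun y₀ => c y₀ y := fun y =>
    hcm.comp (f := fun y₀ => (y₀, y)) (by fun_prop)
  -- By the Markov property the run from time 0 is a mixture, over its output y₀ at time m, of runs
  -- restarted from the state (z m, y₀). The contraction applies to each, and its bound is affine in
  -- y₀².
  have e : ∀ y, evolve ρ z (freshDensity μ (z 0)) (m + 1 + j) y = ∫⁻ y₀, c y₀ y ∂η := fun y => by
    rw [evolve_add, ← evolve_lintegral hchan]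
    congr 1
    funext y'
    have hy' : Measurable fun y₀ => chanDensity ρ (z m) (z (m + 1)) y₀ y' :=
      hchan.comp (f := fun y₀ => (y₀, y')) (by fun_prop)
    rw [hη, lintegral_withDensity_eq_lintegral_mul _ hgm hy']
    rfl
  calc _ ≤ ∫⁻ y, ∫⁻ y₀, (f y - c y₀ y) ∂η := by
        refine lintegral_mono fun y => ?_
        rw [e]
        have h1 := lintegral_sub_le (μ := η) (fun y₀ => c y₀ y) (fun _ => f y) (hcm' y)
        rwa [lintegral_const, measure_univ, mul_one] at h1
    _ = ∫⁻ y₀, (∫⁻ y, (f y - c y₀ y)) ∂η := by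
        refine lintegral_lintegral_swap (μ := volume) (ν := η) (f := fun y y₀ => f y - c y₀ y) ?_
        exact ((hfm.comp measurable_fst).sub (hcm.comp measurable_swap)).aemeasurable
    _ ≤ ∫⁻ y₀, (ENNReal.ofReal ((σA ^ 2 * z m ^ 2 + 2 * σB ^ 2 * σE ^ 2) * σB ^ (2 * j))
          + ENNReal.ofReal (2 * σB ^ 2 * σB ^ (2 * j)) * ENNReal.ofReal (y₀ ^ 2)) ∂η := by
        refine lintegral_mono fun y₀ => ?_
        have h1 : ∫⁻ y, (f y - c y₀ y) ≤ _ := lintegral_evolve_sub_le μ (z m) y₀ z' j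
        refine h1.trans_eq ?_
        have h2 : 0 ≤ σB ^ (2 * j) := by rw [pow_mul]; positivity
        rw [← ENNReal.ofReal_mul (by positivity), ← ENNReal.ofReal_add (by positivity)
          (by positivity)]
        congr 1
        ring
    _ ≤ _ := by
        have h2 : 0 ≤ σB ^ (2 * j) := by rw [pow_mul]; positivity
        have h3 : ∫⁻ y₀, ENNReal.ofReal (y₀ ^ 2) ∂η ≤ ENNReal.ofReal v := by
          rw [hη, lintegral_withDensity_eq_lintegral_mul _ hgm (by fun_prop)]
          exact h
        rw [lintegral_add_left measurable_const, lintegral_const, measure_univ, mul_one,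
          lintegral_const_mul _ (by fun_prop)]
        calc _ ≤ ENNReal.ofReal ((σA ^ 2 * z m ^ 2 + 2 * σB ^ 2 * σE ^ 2) * σB ^ (2 * j))
              + ENNReal.ofReal (2 * σB ^ 2 * σB ^ (2 * j)) * ENNReal.ofReal v := by gcongr
          _ = _ := by
              rw [← ENNReal.ofReal_mul (by positivity), ← ENNReal.ofReal_add (by positivity)
                (by positivity)]
              congr 1
              ring

lemma sum_lintegral_fiberDensity_mul {ι κ : Type*} [Fintype ι] [Fintype κ] [DecidableEq κ]
    {π : ι → κ} {p : ι → ℝ≥0∞} {a : ι → ℝ → ℝ≥0∞} (ha : ∀ i, Measurable (a i)) {g : ℝ → ℝ≥0∞}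
    (hg : Measurable g) :
    ∑ u, ∫⁻ y, fiberDensity π p a u y * g y = ∑ i, p i * ∫⁻ y, a i y * g y := by
  rw [← sum_fiber π fun i => p i * ∫⁻ y, a i y * g y]
  refine Finset.sum_congr rfl fun u _ => ?_
  have hm : ∀ i ∈ (Finset.univ : Finset {i // π i = u}), Measurable fun y => p i * a i y * g y :=
    fun i _ => ((ha i).const_mul _).mul hg
  simp only [fiberDensity, Finset.sum_mul]
  rw [lintegral_finsetSum _ hm]
  refine Finset.sum_congr rfl fun i _ => ?_
  simp only [mul_assoc]
  exact lintegral_const_mul _ ((ha i).mul hg)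

lemma Noise.PowerBound.lintegral_evolve_le (hN : N.IsChannelNoise P σA σB σE α₁ α₂) {M₃ : ℝ}
    (h : N.PowerBound P 𝒳 M₃) {z : ℕ → ℝ} (hz : ∀ i, z i ∈ 𝒳) (j : ℕ) :
    ∫⁻ y, evolve (N.newLaw P σA σB σE) z (freshDensity (P.map (N.U 0)) (z 0)) j y
      * ENNReal.ofReal (y ^ 2) ≤ ENNReal.ofReal M₃ := by
  have := hN.isProbabilityMeasure_newLaw
  have := hN.isProbabilityMeasure_map_U
  have hlaw := (N.isRun_output z).map_apply hN (measurable_freshDensity _ _) (hN.map_output_zero _) j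
  have h1 := h z hz j
  rw [← lintegral_map (f := fun y : ℝ => ENNReal.ofReal (y ^ 2)) (by fun_prop)
    (hN.measurable_output (fun _ => measurable_const) j), hlaw,
    lintegral_withDensity_eq_lintegral_mul _ (measurable_evolve (measurable_freshDensity _ _) j)
      (by fun_prop)] at h1
  exact h1

/-- The density of the output at time `m + j`, jointly with the event that the input word from time
`m` on is `w`. -/
def wordDensity (N : Noise Ω) (P : Measure Ω) (X : ℕ → Ω → ℝ) (σA σB σE : ℝ) {T m n : ℕ}
    (hT : T = m + n) (j : ℕ) : (Fin (n + 1) → 𝒳) → ℝ → ℝ≥0∞ :=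
  fiberDensity (wordDrop hT) (wordProb P X 0) fun i : Fin (T + 1) → 𝒳 =>
    evolve (N.newLaw P σA σB σE) (wordExt i) (freshDensity (P.map (N.U 0)) (wordExt i 0)) (m + j)

section WordDensity

variable {T m n : ℕ} (hT : T = m + n)

lemma measurable_wordDensity (hN : N.IsChannelNoise P σA σB σE α₁ α₂) (j : ℕ)
    (w : Fin (n + 1) → 𝒳) : Measurable (wordDensity N P X σA σB σE hT j w) := by
  have := hN.isProbabilityMeasure_newLaw
  have := hN.isProbabilityMeasure_map_U
  exact measurable_fiberDensity (fun i => measurable_evolve (measurable_freshDensity _ _) _) w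

lemma lintegral_wordDensity (hN : N.IsChannelNoise P σA σB σE α₁ α₂) (hX : N.IsInput P 𝒳 X) (j : ℕ)
    (w : Fin (n + 1) → 𝒳) :
    ∫⁻ y, wordDensity N P X σA σB σE hT j w y = wordProb P X m w := by
  have := hN.isProbabilityMeasure_newLaw
  have := hN.isProbabilityMeasure_map_U
  rw [wordDensity, lintegral_fiberDensity fun i => measurable_evolve (measurable_freshDensity _ _) _,
    wordProb_eq_sum_fiber hX hT]
  simp [lintegral_evolve (measurable_freshDensity _ _), lintegral_freshDensity]

lemma wordDensity_le (hN : N.IsChannelNoise P σA σB σE α₁ α₂) (hX : N.IsInput P 𝒳 X) (j : ℕ)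
    (w : Fin (n + 1) → 𝒳) (y : ℝ) :
    wordDensity N P X σA σB σE hT j w y ≤ wordProb P X m w * gaussBound := by
  have := hN.isProbabilityMeasure_newLaw
  have := hN.isProbabilityMeasure_map_U
  rw [wordProb_eq_sum_fiber hX hT, Finset.sum_mul]
  refine Finset.sum_le_sum fun i _ => mul_le_mul_right ?_ _
  exact evolve_le (measurable_freshDensity _ _) (freshDensity_le _ _) (lintegral_freshDensity _ _) _ _

lemma wordDensity_succ (hN : N.IsChannelNoise P σA σB σE α₁ α₂) (j : ℕ)
    (w : Fin (n + 1) → 𝒳) : wordDensity N P X σA σB σE hT (j + 1) w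
      = stepDensity (chanTransition (N.newLaw P σA σB σE) (wordExt w) j)
        (wordDensity N P X σA σB σE hT j w) := by
  have := hN.isProbabilityMeasure_newLaw
  have := hN.isProbabilityMeasure_map_U
  rw [wordDensity, wordDensity, stepDensity_fiberDensity
    (k := chanTransition (N.newLaw P σA σB σE) (wordExt w) j) (fun i => measurable_evolve (measurable_freshDensity _ _) _) w (isTransition_chanDensity _ _)]
  funext y
  refine Finset.sum_congr rfl fun i _ => ?_
  have h : ∀ l, wordExt w l = wordExt (i : Fin (T + 1) → 𝒳) (m + l) := fun l => by
    rw [← wordExt_wordDrop hT, show wordDrop hT (i : Fin (T + 1) → 𝒳) = w from i.2]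
  simp only [chanTransition, h]
  rfl

lemma sum_lintegral_wordDensity_sq_le (hN : N.IsChannelNoise P σA σB σE α₁ α₂)
    (hX : N.IsInput P 𝒳 X) {M₃ : ℝ} (h : N.PowerBound P 𝒳 M₃) (j : ℕ) :
    ∑ w : Fin (n + 1) → 𝒳, ∫⁻ y, wordDensity N P X σA σB σE hT j w y * ENNReal.ofReal (y ^ 2)
      ≤ ENNReal.ofReal M₃ := by
  have := hN.isProbabilityMeasure_newLaw
  have := hN.isProbabilityMeasure_map_U
  set a : (Fin (T + 1) → 𝒳) → ℝ → ℝ≥0∞ := fun i => evolve (N.newLaw P σA σB σE) (wordExt i)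
    (freshDensity (P.map (N.U 0)) (wordExt i 0)) (m + j) with ha
  have ham : ∀ i, Measurable (a i) := fun i => measurable_evolve (measurable_freshDensity _ _) _
  calc _ = ∑ i, wordProb P X 0 (i : Fin (T + 1) → 𝒳) * ∫⁻ y, a i y * ENNReal.ofReal (y ^ 2) :=
        sum_lintegral_fiberDensity_mul ham (by fun_prop)
    _ ≤ ∑ i : Fin (T + 1) → 𝒳, wordProb P X 0 i * ENNReal.ofReal M₃ :=
        Finset.sum_le_sum fun i _ => mul_le_mul_right (h.lintegral_evolve_le hN (wordExt_mem i) _) _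
    _ = _ := by rw [← Finset.sum_mul, hX.sum_wordProb, one_mul]

/-- The first `d` outputs of a block matter little. -/
lemma chainEntropy_wordDensity (hN : N.IsChannelNoise P σA σB σE α₁ α₂)
    (hX : N.IsInput P 𝒳 X) {M₃ : ℝ} (h : N.PowerBound P 𝒳 M₃) (hM : 1 ≤ M₃) {d l : ℕ} :
    chainEntropy (fun w : Fin (n + 1) → 𝒳 => chanTransition (N.newLaw P σA σB σE) (wordExt w))
        (wordDensity N P X σA σB σE hT 0) (l + d)
      ≤ chainEntropy (fun (w : Fin (n + 1) → 𝒳) j =>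
          chanTransition (N.newLaw P σA σB σE) (wordExt w) (j + d))
        (wordDensity N P X σA σB σE hT d) l ∧
    chainEntropy (fun (w : Fin (n + 1) → 𝒳) j =>
          chanTransition (N.newLaw P σA σB σE) (wordExt w) (j + d))
        (wordDensity N P X σA σB σE hT d) l
      ≤ chainEntropy (fun w : Fin (n + 1) → 𝒳 => chanTransition (N.newLaw P σA σB σE) (wordExt w))
          (wordDensity N P X σA σB σE hT 0) (l + d)
        + d * (ENNReal.ofReal (Real.log M₃) + 1) := by
  have := hN.isProbabilityMeasure_newLaw
  have hs := chainEntropy_shift (v := M₃.toNNReal) (by simpa using hM) (p := wordProb P X m)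
    (α := wordDensity N P X σA σB σE hT)
    (k := fun w : Fin (n + 1) → 𝒳 => chanTransition (N.newLaw P σA σB σE) (wordExt w))
    (fun _ _ => isTransition_chanDensity _ _) (fun j w => measurable_wordDensity hT hN j w)
    (fun j w y => wordDensity_le hT hN hX j w y) (fun j w => lintegral_wordDensity hT hN hX j w)
    (hX.sum_wordProb m n) (fun j => sum_lintegral_wordDensity_sq_le hT hN hX h j)
    (fun j w => wordDensity_succ hT hN j w) d l
  rwa [Real.coe_toNNReal _ (by linarith)] at hs

end WordDensity

omit [IsProbabilityMeasure P] in
lemma wordDensity_zero_eq {n : ℕ} (hT : n = 0 + n) (j : ℕ) (w : Fin (n + 1) → 𝒳) :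
    wordDensity N P X σA σB σE hT j w = fun y => wordProb P X 0 w
      * evolve (N.newLaw P σA σB σE) (wordExt w) (freshDensity (P.map (N.U 0)) (wordExt w 0)) j y := by
  have hd : ∀ i : Fin (n + 1) → 𝒳, wordDrop hT i = i := fun i => by
    funext l
    simp only [wordDrop, zero_add]
  funext y
  rw [wordDensity, fiberDensity, Fintype.sum_eq_single ⟨w, hd w⟩, zero_add]
  rintro ⟨i, hi⟩ h
  exact absurd (Subtype.ext ((hd i).symm.trans hi)) h

/-- Stationary inputs: the densities for blocks that start at different times merge. -/
lemma sum_lintegral_wordDensity_sub_le (hN : N.IsChannelNoise P σA σB σE α₁ α₂)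
    (hX : N.IsInput P 𝒳 X) {M₃ S : ℝ} (h : N.PowerBound P 𝒳 M₃) (hM : 0 ≤ M₃)
    (hS : ∀ x ∈ 𝒳, σA ^ 2 * x ^ 2 + 2 * σB ^ 2 * (M₃ + σE ^ 2) ≤ S) {T m n : ℕ}
    (hT : T = m + 1 + n) (hT₀ : n = 0 + n)
    (hp : ∀ w : Fin (n + 1) → 𝒳, wordProb P X (m + 1) w = wordProb P X 0 w) (j : ℕ) :
    ∑ w : Fin (n + 1) → 𝒳, ∫⁻ y, (wordDensity N P X σA σB σE hT₀ j w y
        - wordDensity N P X σA σB σE hT j w y) ≤ ENNReal.ofReal (S * σB ^ (2 * j)) := by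
  have := hN.isProbabilityMeasure_newLaw
  have := hN.isProbabilityMeasure_map_U
  have hw : ∀ w : Fin (n + 1) → 𝒳, ∫⁻ y, (wordDensity N P X σA σB σE hT₀ j w y
      - wordDensity N P X σA σB σE hT j w y)
        ≤ wordProb P X 0 w * ENNReal.ofReal (S * σB ^ (2 * j)) := by
    intro w
    set a : ℝ → ℝ≥0∞ := evolve (N.newLaw P σA σB σE) (wordExt w)
      (freshDensity (P.map (N.U 0)) (wordExt w 0)) j with ha
    set c : (Fin (T + 1) → 𝒳) → ℝ → ℝ≥0∞ := fun i => evolve (N.newLaw P σA σB σE) (wordExt i)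
      (freshDensity (P.map (N.U 0)) (wordExt i 0)) (m + 1 + j) with hc
    have ham : Measurable a := measurable_evolve (measurable_freshDensity _ _) _
    have hcm : ∀ i, Measurable (c i) := fun i => measurable_evolve (measurable_freshDensity _ _) _
    have hm : ∀ i ∈ (Finset.univ : Finset {i // wordDrop (𝒳 := 𝒳) hT i = w}), Measurable fun y =>
        wordProb P X 0 (i : Fin (T + 1) → 𝒳) * (a y - c i y) := fun i _ =>
      (ham.sub (hcm i)).const_mul _
    have hq : wordProb P X 0 w
        = ∑ i : {i // wordDrop hT i = w}, wordProb P X 0 (i : Fin (T + 1) → 𝒳) := by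
      rw [← hp, wordProb_eq_sum_fiber hX hT]
    -- Equality of the word probabilities lets the fresh density be distributed over the pasts of w
    -- with the same weights; the positive part of a sum is then at most the sum of the positive
    -- parts.
    calc _ ≤ ∫⁻ y, ∑ i : {i // wordDrop hT i = w},
          wordProb P X 0 (i : Fin (T + 1) → 𝒳) * (a y - c i y) := by
          refine lintegral_mono fun y => ?_
          rw [wordDensity_zero_eq]
          change wordProb P X 0 w * a y - _ ≤ _
          rw [hq, Finset.sum_mul, wordDensity, fiberDensity, tsub_le_iff_right, ← Finset.sum_add_distrib]
          refine Finset.sum_le_sum fun i _ => ?_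
          rw [← mul_add]
          exact mul_le_mul_right le_tsub_add _
      _ = ∑ i : {i // wordDrop hT i = w}, wordProb P X 0 (i : Fin (T + 1) → 𝒳)
          * ∫⁻ y, (a y - c i y) := by
          rw [lintegral_finsetSum _ hm]
          exact Finset.sum_congr rfl fun i _ => lintegral_const_mul _ (ham.sub (hcm i))
      _ ≤ ∑ i : {i // wordDrop hT i = w}, wordProb P X 0 (i : Fin (T + 1) → 𝒳)
          * ENNReal.ofReal (S * σB ^ (2 * j)) := by
          refine Finset.sum_le_sum fun i _ => mul_le_mul_right ?_ _
          have e : wordExt w = fun l => wordExt (i : Fin (T + 1) → 𝒳) (m + 1 + l) := by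
            funext l
            rw [← wordExt_wordDrop hT, show wordDrop hT (i : Fin (T + 1) → 𝒳) = w from i.2]
          have h1 := lintegral_evolve_fresh_sub_le (σA := σA) (σB := σB) (σE := σE) (P.map (N.U 0))
            (wordExt (i : Fin (T + 1) → 𝒳)) m j hM (h.lintegral_evolve_le hN (wordExt_mem _) m)
          rw [ha, e]
          refine h1.trans (ENNReal.ofReal_le_ofReal ?_)
          have h2 : 0 ≤ σB ^ (2 * j) := by rw [pow_mul]; positivity
          exact mul_le_mul_of_nonneg_right (hS _ (wordExt_mem _ _)) h2
      _ = _ := by rw [← Finset.sum_mul, ← hq]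
  refine (Finset.sum_le_sum fun w _ => hw w).trans_eq ?_
  rw [← Finset.sum_mul, hX.sum_wordProb, one_mul]

theorem Noise.IsInput.abs_blockInfo_sub_le (hN : N.IsChannelNoise P σA σB σE α₁ α₂)
    (hX : N.IsInput P 𝒳 X) {M₃ S : ℝ} (h : N.PowerBound P 𝒳 M₃) (hM : 1 ≤ M₃) (hS0 : 0 ≤ S)
    (hS : ∀ x ∈ 𝒳, σA ^ 2 * x ^ 2 + 2 * σB ^ 2 * (M₃ + σE ^ 2) ≤ S) {m n d : ℕ}
    (hp : ∀ w : Fin (n + 1) → 𝒳, wordProb P X (m + 1) w = wordProb P X 0 w) (hd : d ≤ n) :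
    N.blockInfo P X 0 n ≠ ∞ ∧ N.blockInfo P X (m + 1) n ≠ ∞ ∧
      |(N.blockInfo P X 0 n).toReal - (N.blockInfo P X (m + 1) n).toReal|
        ≤ S * σB ^ (2 * d) * ((n + 1) * Real.log 𝒳.card) + Real.log 2
          + d * (Real.log M₃ + 1) := by
  have := hN.isProbabilityMeasure_newLaw
  have hT₀ : n = 0 + n := (zero_add n).symm
  have hT : m + 1 + n = m + 1 + n := rfl
  have h0 := hX.blockInfo_add hN hT₀
  have h1 := hX.blockInfo_add hN hT
  simp only [hp] at h1
  have hσ : 0 ≤ σB ^ (2 * d) := by rw [pow_mul]; positivity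
  have hlogM : 0 ≤ Real.log M₃ := Real.log_nonneg hM
  have hlog : 0 ≤ Real.log 𝒳.card := Real.log_natCast_nonneg _
  have hlog2 : 0 ≤ Real.log 2 := Real.log_nonneg one_le_two
  -- Of the n + 1 outputs, d are discarded and l + 1 remain.
  obtain ⟨l, rfl⟩ : ∃ l, n = l + d := ⟨n - d, by omega⟩
  set ε := ENNReal.ofReal (S * σB ^ (2 * d)) with hε
  have hsub := sum_lintegral_wordDensity_sub_le hN hX h (by linarith) hS hT hT₀ hp d
  have hmass : ∀ w, ∫⁻ y, wordDensity N P X σA σB σE hT₀ d w y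
      = ∫⁻ y, wordDensity N P X σA σB σE hT d w y := fun w => by
    rw [lintegral_wordDensity hT₀ hN hX, lintegral_wordDensity hT hN hX, hp]
  have hfin : ∀ {T m : ℕ} (hT : T = m + (l + d)) (w : Fin (l + d + 1) → 𝒳) y,
      wordDensity N P X σA σB σE hT d w y ≠ ∞ := fun hT w y =>
    ne_top_of_le_ne_top (ENNReal.mul_ne_top (measure_ne_top _ _) gaussBound_ne_top)
      (wordDensity_le hT hN hX d w y)
  have hsub' : ∑ w : Fin (l + d + 1) → 𝒳, ∫⁻ y, (wordDensity N P X σA σB σE hT d w y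
      - wordDensity N P X σA σB σE hT₀ d w y) ≤ ε := by
    refine (Finset.sum_congr rfl fun w _ => ?_).trans_le hsub
    refine lintegral_tsub_comm (measurable_wordDensity hT hN d w) (measurable_wordDensity hT₀ hN d w)
      (hmass w).symm ?_
    rw [lintegral_wordDensity hT hN hX]
    exact measure_ne_top _ _
  have hcard : Real.log (Fintype.card (Fin (l + d + 1) → 𝒳))
      = ((l + d : ℕ) + 1) * Real.log 𝒳.card := by simp
  have hle : ∀ {T T' m m' : ℕ} (hT : T = m + (l + d)) (hT' : T' = m' + (l + d)),
      ∑ w : Fin (l + d + 1) → 𝒳, ∫⁻ y, (wordDensity N P X σA σB σE hT d w y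
        - wordDensity N P X σA σB σE hT' d w y) ≤ ε →
      chainEntropy (fun w : Fin (l + d + 1) → 𝒳 => chanTransition (N.newLaw P σA σB σE) (wordExt w))
          (wordDensity N P X σA σB σE hT 0) (l + d)
        ≤ chainEntropy (fun w : Fin (l + d + 1) → 𝒳 =>
            chanTransition (N.newLaw P σA σB σE) (wordExt w))
          (wordDensity N P X σA σB σE hT' 0) (l + d)
          + ENNReal.ofReal (S * σB ^ (2 * d) * (((l + d : ℕ) + 1) * Real.log 𝒳.card)
            + Real.log 2 + d * (Real.log M₃ + 1)) := by
    intro T T' m m' hT hT' hs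
    -- Discard d outputs of the first chain (free), exchange the densities at time d, and restore
    -- the d outputs of the second chain (log M₃ + 1 each).
    have g1 := (chainEntropy_wordDensity hT hN hX h hM (d := d) (l := l)).1
    have g2 := (chainEntropy_wordDensity hT' hN hX h hM (d := d) (l := l)).2
    have g3 := chainEntropy_le_add (n := l) (k := fun (w : Fin (l + d + 1) → 𝒳) j =>
        chanTransition (N.newLaw P σA σB σE) (wordExt w) (j + d))
      (fun _ _ => isTransition_chanDensity _ _) (measurable_wordDensity hT hN d)
      (measurable_wordDensity hT' hN d) (hfin hT) (hfin hT')
    simp only [lintegral_wordDensity hT hN hX, hX.sum_wordProb, one_mul, hcard] at g3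
    refine g1.trans (g3.trans ?_)
    rw [ENNReal.ofReal_add (by positivity) (by positivity), ENNReal.ofReal_add (by positivity)
      (by positivity), ENNReal.ofReal_mul (p := S * σB ^ (2 * d)) (by positivity),
      ENNReal.ofReal_mul (p := (d : ℝ)) (by positivity), ENNReal.ofReal_natCast,
      ENNReal.ofReal_add hlogM zero_le_one, ENNReal.ofReal_one]
    calc _ ≤ _ := add_le_add (add_le_add g2 (mul_le_mul_left hs _)) le_rfl
      _ = _ := by ring
  exact abs_toReal_sub_le_of_add_eq h0 h1 (hle hT₀ hT hsub) (hle hT hT₀ hsub') (by positivity)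

end Stationary

end FlashChannel

end

/-! ### Assembly of the two parts -/

theorem mainTheorem6 {Ω : Type*} [MeasurableSpace Ω] (P : Measure Ω) [IsProbabilityMeasure P]
    (𝒳 : Finset ℝ) (σA σB σE α₁ α₂ : ℝ)
    (hσA : 0 ≤ σA) (hσB : 0 < σB) (hσB1 : σB < 1) (hσE : 0 ≤ σE) (hα₁ : 0 < α₁) (hα : α₁ < α₂)
    (N : FlashChannel.Noise Ω) (hN : N.IsChannelNoise P σA σB σE α₁ α₂) :
    -- part (a)
    (∀ (n : ℕ) (X : ℕ → Ω → ℝ), N.IsInput P 𝒳 X →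
      IndepFun (FlashChannel.block X 0 n) (FlashChannel.block X (n + 1) n) P →
      IdentDistrib (FlashChannel.block X (n + 1) n) (FlashChannel.block X 0 n) P P →
      -- `condLaw` is the regular conditional law of the second block given `(X_n, Y_n)`
      (∀ᵐ z ∂(P.map fun ω => (X n ω, N.output X n ω)),
        condDistrib (fun ω => (FlashChannel.block X (n + 1) n ω,
            FlashChannel.block (N.output X) (n + 1) n ω))
          (fun ω => (X n ω, N.output X n ω)) P z = N.condLaw P X n z.1 z.2) ∧
      ∀ k ≤ n, ∀ x ∈ 𝒳, ∀ y : ℝ,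
        N.blockInfo P X 0 n ≠ ∞ ∧ FlashChannel.mutualInfo (N.condLaw P X n x y) ≠ ∞ ∧
        |(N.blockInfo P X 0 n).toReal - (FlashChannel.mutualInfo (N.condLaw P X n x y)).toReal|
          ≤ 2 * ((k : ℝ) + 1) * Real.log 𝒳.card
            + ((n : ℝ) - k) * (σA ^ 2 * x ^ 2 + 2 * σB ^ 2 * (y ^ 2 + σE ^ 2)) * σB ^ (2 * k)
              * Real.log 𝒳.card) ∧
    -- part (b)
    (∃ M₃ : ℝ, 0 < M₃ ∧ N.PowerBound P 𝒳 M₃) ∧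
    (∀ M₃ : ℝ, 0 < M₃ → N.PowerBound P 𝒳 M₃ →
      ∃ M₄ M₅ M₆ M₇ M₈ M₉ : ℝ, 0 < M₄ ∧ 0 < M₅ ∧ 0 < M₆ ∧ 0 < M₇ ∧ 0 < M₈ ∧ 0 < M₉ ∧
        ∀ X : ℕ → Ω → ℝ, N.IsInput P 𝒳 X → FlashChannel.IsStationary P X →
          ∀ m k n : ℕ, m ≤ k → k ≤ n →
            N.blockInfo P X 0 n ≠ ∞ ∧ N.blockInfo P X m n ≠ ∞ ∧
            |1 / ((n : ℝ) + 1) * (N.blockInfo P X 0 n).toReal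
                - 1 / ((n : ℝ) + 1) * (N.blockInfo P X m n).toReal|
              ≤ 3 * ((k : ℝ) + 1) * Real.log (2 * Real.pi * Real.exp 1 * M₃) / ((n : ℝ) + 1)
                + 2 * M₃ * Real.pi * Real.exp 1 * (M₈ + 3 * M₉) * σB ^ (2 * k)
                + 1 / ((n : ℝ) + 1) * (M₄ + M₅ * M₃)
                + (M₆ + 4 * FlashChannel.constM₁ 𝒳 α₁ α₂ σA σB σE * M₃ * M₇ / (1 - σB) ^ 2
                    + 12 * M₃ * M₇ / (((n : ℝ) + 1) * (1 - σB ^ 2))) * σB ^ (2 * k)) := by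
  have hL0 : 0 ≤ Real.log 𝒳.card := Real.log_natCast_nonneg _
  have hM0 : 0 ≤ FlashChannel.constM₀ 𝒳 α₁ α₂ := FlashChannel.constM₀_nonneg
  refine ⟨fun n X hX hind hid => ⟨?_, fun k hk x _ y => ?_⟩,
    hN.exists_powerBound 𝒳 hσB hσB1 hα₁.le hα, fun M₃ hM₃ hP => ?_⟩
  · have := hX.isMarkovKernel_condKernel hN n
    have hY := hN.measurable_output hX.measurable
    have hB : Measurable fun ω => (FlashChannel.block X (n + 1) n ω,
        FlashChannel.block (N.output X) (n + 1) n ω) :=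
      (hX.measurable_block _ _).prodMk (measurable_pi_lambda _ fun _ => hY _)
    filter_upwards [condDistrib_ae_eq_of_measure_eq_compProd _ hB.aemeasurable
      (hX.map_eq_compProd hN hind)] with z hz
    rw [hz, hX.condKernel_apply hN]
  · obtain ⟨h1, h2, h3⟩ := hX.abs_blockInfo_sub_condInfo_le hN hσB.le hk
      -- Equality in law of the two input blocks makes their word entropies cancel.
      (fun w => hid.measure_mem_eq (measurableSet_singleton _)) x y
    refine ⟨h1, h2, h3.trans ?_⟩
    -- The argument costs (k + 1) log M only once; the stated bound allows twice as much.
    have h4 : 0 ≤ ((k : ℝ) + 1) * Real.log 𝒳.card := by positivity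
    linarith
  · set S := σA ^ 2 * FlashChannel.constM₀ 𝒳 α₁ α₂ ^ 2 + 2 * σB ^ 2 * (M₃ + σE ^ 2) with hS
    have hS0 : 0 ≤ S := by positivity
    -- log 2 comes from the continuity of entropy and S log M from the contraction over n + 1
    -- letters. The added 1 ensures positivity for a one-letter alphabet; the other constants
    -- multiply nonnegative terms that are pure slack.
    refine ⟨Real.log 2, 1, S * Real.log 𝒳.card + 1, 1, 1, 1, Real.log_pos one_lt_two, one_pos,
      by positivity, one_pos, one_pos, one_pos, fun X hX hstat m k n hmk hkn => ?_⟩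
    have hΩ : Nonempty Ω := nonempty_of_isProbabilityMeasure P
    -- The noise W forces M₃ ≥ 1, so log M₃ is nonnegative. A letter of the alphabet is obtained
    -- from a value of the input.
    have h1M : 1 ≤ M₃ := hN.one_le_of_powerBound hα ⟨_, hX.mem 0 hΩ.some⟩ hP
    have hlogM : 0 ≤ Real.log M₃ := Real.log_nonneg h1M
    have hn : (0 : ℝ) < n + 1 := by positivity
    have hσ : 0 ≤ σB ^ (2 * k) := by positivity
    have hM1 : 0 ≤ FlashChannel.constM₁ 𝒳 α₁ α₂ σA σB σE := by
      rw [FlashChannel.constM₁]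
      positivity
    have h1σ : 0 < 1 - σB := by linarith
    have h1σ2 : 0 < 1 - σB ^ 2 := by nlinarith
    -- The price of a discarded output fits below log (2πe M₃), since log (2π) is nonnegative.
    have hlog : 1 + Real.log M₃ ≤ Real.log (2 * Real.pi * Real.exp 1 * M₃) := by
      rw [Real.log_mul (by positivity) (by positivity), Real.log_mul (by positivity) (by positivity),
        Real.log_exp]
      have : 0 ≤ Real.log (2 * Real.pi) := Real.log_nonneg (by linarith [Real.pi_gt_three])
      linarith
    have key : N.blockInfo P X 0 n ≠ ∞ ∧ N.blockInfo P X m n ≠ ∞ ∧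
        |(N.blockInfo P X 0 n).toReal - (N.blockInfo P X m n).toReal|
          ≤ S * σB ^ (2 * k) * ((n + 1) * Real.log 𝒳.card) + Real.log 2
            + k * (Real.log M₃ + 1) := by
      have hw : ∀ m, ∀ w : Fin (n + 1) → 𝒳,
          FlashChannel.wordProb P X m w = FlashChannel.wordProb P X 0 w := fun m w => by
        simp only [FlashChannel.wordProb]
        rw [← Measure.map_apply (hX.measurable_block m n) (measurableSet_singleton _), hstat m n,
          Measure.map_apply (hX.measurable_block 0 n) (measurableSet_singleton _)]
      have h := fun m => hX.abs_blockInfo_sub_le hN hP h1M hS0 (m := m) (d := k)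
        (fun x hx => by
          rw [hS]
          gcongr σA ^ 2 * ?_ + _
          exact FlashChannel.sq_le_constM₀_sq hx) (hw (m + 1)) hkn
      -- The contraction compares a fresh start with a state one step before the block, so it needs
      -- a positive starting time; for m = 0 the difference vanishes.
      cases m with
      | zero =>
        refine ⟨(h 0).1, (h 0).1, ?_⟩
        rw [sub_self, abs_zero]
        have : 0 ≤ Real.log 2 := Real.log_nonneg one_le_two
        positivity
      | succ m => exact h m
    refine ⟨key.1, key.2.1, ?_⟩
    rw [← mul_sub, abs_mul, abs_of_pos (by positivity : (0 : ℝ) < 1 / (n + 1))]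
    calc _ ≤ 1 / ((n : ℝ) + 1) * (S * σB ^ (2 * k) * ((n + 1) * Real.log 𝒳.card) + Real.log 2
            + k * (Real.log M₃ + 1)) := by gcongr; exact key.2.2
      _ = k * (1 + Real.log M₃) / ((n : ℝ) + 1) + 1 / ((n : ℝ) + 1) * Real.log 2
            + S * Real.log 𝒳.card * σB ^ (2 * k) := by
          field_simp
          ring
      _ ≤ 3 * ((k : ℝ) + 1) * Real.log (2 * Real.pi * Real.exp 1 * M₃) / ((n : ℝ) + 1)
            + 1 / ((n : ℝ) + 1) * (Real.log 2 + 1 * M₃)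
            + (S * Real.log 𝒳.card + 1) * σB ^ (2 * k) := by
          gcongr
          · linarith [(Nat.cast_nonneg k : (0 : ℝ) ≤ k)]
          · linarith
          · linarith
      _ ≤ _ := by
          have g1 : 0 ≤ 2 * M₃ * Real.pi * Real.exp 1 * (1 + 3 * 1) * σB ^ (2 * k) := by positivity
          have g2 : 0 ≤ (4 * FlashChannel.constM₁ 𝒳 α₁ α₂ σA σB σE * M₃ * 1 / (1 - σB) ^ 2
              + 12 * M₃ * 1 / (((n : ℝ) + 1) * (1 - σB ^ 2))) * σB ^ (2 * k) := by positivity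
          linarith
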